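/- **Definitions.** An *increasing tableau* of shape $\lambda$ is a filling of the Young diagram $\lambda$ by positive integers, strictly increasing along rows and down columns, whose set of entries is an initial segment $\{1,\dots,M\}$. Let $\mathrm{Inc}^{\lambda}_k$ be the set of those with $M=|\lambda|-k$, and let $\mathrm{SYT}(\lambda)$ be the set of standard Young tableaux of shape $\lambda$. The SE-neighbors of a box are the boxes of $\lambda$ immediately right of it and immediately below it. *K-promotion* $\mathcal P_K$: delete the entry $1$ from $T$, leaving an empty box. Repeat the following, simultaneously at all empty boxes, until no empty box has an SE-neighbor: each empty box receives the minimal label of its SE-neighbors, and this label is removed from those of its SE-neighbors in which it appears (an empty box without SE-neighbors is unchanged). Finally label all empty boxes $M+1$ and subtract $1$ from all labels. *Ordinary promotion* $\mathcal P$ of a standard Young tableau is defined in the same way with a single hole and ordinary jeu de taquin slides (the smaller of the SE-neighbors slides into the hole). For $j\ge 0$ let $[T]_j$ be the set of boxes of $T$ with label at most $j$. *K-evacuation* $\mathcal E_K(T)$ is the tableau encoded by the chain $([\mathcal P_K^{M-j}(T)]_j)_{0\le j\le M}$, that is, each box is labelled by the least $j$ such that it lies in $[\mathcal P_K^{M-j}(T)]_j$.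 *Ordinary (Schützenberger) evacuation* $\mathcal E(S)$ of a standard Young tableau $S$ is defined in the same way with $\mathcal P$ in place of $\mathcal P_K$. For $T\in\mathrm{Inc}^{2\times n}_k$ let $A$ be the set of numbers that appear twice in $T$, and $B$ the set of numbers that appear in the second row immediately right of an element of $A$. Let $\mathcal F(T)$ be obtained by deleting the elements of $A$ from the first row of $T$ and the elements of $B$ from the second row (closing the gaps), and appending $B$, in increasing order, to the bottom of the first column. **Proposition.** Let $n,k\ge 0$ be integers. If $k<n$, then $\mathcal F$ is a bijection from $\mathrm{Inc}^{2\times n}_k$ onto $\mathrm{SYT}(n-k,n-k,1^k)$. For every $T\in\mathrm{Inc}^{2\times n}_k$, the tableau $\mathcal E_K(T)$ again lies in $\mathrm{Inc}^{2\times n}_k$, and $$\mathcal E(\mathcal F(T))=\mathcal E_K(\mathcal F(T))=\mathcal F(\mathcal E_K(T)).$$ -/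

import Mathlib

namespace IncTableau

/-- A filling of boxes by natural numbers. Boxes are `(row, column)`, numbered from `0` in English
convention. Tableaux of shape `μ` have positive labels on `μ` and are required to be `0` outside
`μ`, so that two tableaux of the same shape are equal iff they are equal as functions. While labels
are being moved around, the label `0` on a box of `μ` means that this box is empty. -/
abbrev Filling : Type := ℕ × ℕ → ℕ

/-- The largest label of a filling of `μ` (`0` for the empty shape). -/
def maxEntry (μ : YoungDiagram) (T : Filling) : ℕ := μ.cells.sup T

/-- Rows and columns of `T` are strictly increasing along `μ`. -/
def IsStrict (μ : YoungDiagram) (T : Filling) : Prop :=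
  (∀ r c₁ c₂, c₁ < c₂ → (r, c₂) ∈ μ → T (r, c₁) < T (r, c₂)) ∧
  (∀ r₁ r₂ c, r₁ < r₂ → (r₂, c) ∈ μ → T (r₁, c) < T (r₂, c))

/-- Increasing tableaux of shape `μ` with maximum value `|μ| - k`: rows and columns are strictly
increasing and the set of labels is an initial segment `{1, …, M}` of the positive integers, with
`M + k = |μ|`. -/
def Inc (μ : YoungDiagram) (k : ℕ) : Set Filling :=
  {T | (∀ b, b ∉ μ → T b = 0) ∧ IsStrict μ T ∧
    μ.cells.image T = Finset.Icc 1 (maxEntry μ T) ∧ maxEntry μ T + k = μ.card}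

/-- Standard Young tableaux of shape `μ`: rows and columns are strictly increasing and each of
`1, …, |μ|` is used exactly once. -/
def SYT (μ : YoungDiagram) : Set Filling :=
  {T | (∀ b, b ∉ μ → T b = 0) ∧ IsStrict μ T ∧
    Set.BijOn T (μ.cells : Set (ℕ × ℕ)) (Set.Icc 1 μ.card)}

/-- The rectangle with `m` rows and `n` columns. -/
def rect (m n : ℕ) : YoungDiagram where
  cells := Finset.range m ×ˢ Finset.range n
  isLowerSet := by
    rintro ⟨r, c⟩ ⟨r', c'⟩ ⟨hr, hc⟩ h
    simp only [Finset.coe_product, Finset.coe_range, Set.mem_prod, Set.mem_Iio] at h hr hc ⊢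
    exact ⟨lt_of_le_of_lt hr h.1, lt_of_le_of_lt hc h.2⟩

/-- The flag shape `(n - k, n - k, 1ᵏ)`: two rows of length `n - k`, followed by `k` rows of
length `1`. It is meant for `k < n` (and is empty for `n ≤ k`). -/
def flagShape (n k : ℕ) : YoungDiagram where
  cells := (Finset.range (k + 2) ×ˢ Finset.range (n - k)).filter fun b => b.1 < 2 ∨ b.2 = 0
  isLowerSet := by
    rintro ⟨r, c⟩ ⟨r', c'⟩ ⟨hr, hc⟩ h
    simp only [Finset.coe_filter, Finset.mem_product, Finset.mem_range, Set.mem_ofPred_eq]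
      at h hr hc ⊢
    omega

/-- The flag shape has the row lengths it should have. -/
theorem rowLen_flagShape (n k r : ℕ) (hk : k < n) :
    (flagShape n k).rowLen r = if r < 2 then n - k else if r < k + 2 then 1 else 0 := by
  have key : ∀ c, c < (flagShape n k).rowLen r ↔
      c < if r < 2 then n - k else if r < k + 2 then 1 else 0 := by
    intro c
    rw [← YoungDiagram.mem_iff_lt_rowLen, ← YoungDiagram.mem_cells]
    simp only [flagShape, Finset.mem_filter, Finset.mem_product, Finset.mem_range]
    split_ifs <;> omega
  exact le_antisymm (not_lt.1 fun h => lt_irrefl _ ((key _).1 h))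
    (not_lt.1 fun h => lt_irrefl _ ((key _).2 h))

/-! ### K-promotion and ordinary promotion -/

/-- The boxes of `μ` immediately right of or immediately below `b`. -/
def seNeighbors (μ : YoungDiagram) (b : ℕ × ℕ) : Finset (ℕ × ℕ) :=
  ({(b.1, b.2 + 1), (b.1 + 1, b.2)} : Finset (ℕ × ℕ)).filter (· ∈ μ)

/-- The minimal label of the SE-neighbors of `b`, or `0` (empty) if there are none. -/
def minLabel (μ : YoungDiagram) (T : Filling) (b : ℕ × ℕ) : ℕ :=
  if h : (seNeighbors μ b).Nonempty then (seNeighbors μ b).inf' h T else 0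

/-- One step of K-jeu de taquin, performed simultaneously at all empty boxes: each empty box
receives the minimal label of its SE-neighbors (and stays empty if it has none), and that label is
removed from the SE-neighbors in which it appears. -/
def kStep (μ : YoungDiagram) (T : Filling) : Filling := fun b =>
  if b ∈ μ ∧ T b = 0 then minLabel μ T b
  else if ∃ e ∈ μ.cells, T e = 0 ∧ b ∈ seNeighbors μ e ∧ T b = minLabel μ T e then 0
  else T b

/-- Delete the label `1`. -/
def deleteOne (T : Filling) : Filling := fun b => if T b = 1 then 0 else T b

/-- Label all empty boxes of `μ` by `M + 1`, then subtract one from every label. -/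
def fillAndShift (μ : YoungDiagram) (M : ℕ) (T : Filling) : Filling := fun b =>
  if b ∈ μ then (if T b = 0 then M + 1 else T b) - 1 else 0

/-- K-promotion. In each step the empty boxes that have an SE-neighbor move one antidiagonal
further, so after `|μ|` steps no empty box has an SE-neighbor, and then `kStep` changes nothing. -/
def kPromotion (μ : YoungDiagram) (T : Filling) : Filling :=
  fillAndShift μ (maxEntry μ T) ((kStep μ)^[μ.card] (deleteOne T))

/-- One step of ordinary jeu de taquin on a filling with one hole `p.2`: the smaller of the labels
immediately right of and immediately below the hole slides into it. Nothing happens if the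
hole has neither neighbor in `μ`. -/
def slideStep (μ : YoungDiagram) (p : Filling × (ℕ × ℕ)) : Filling × (ℕ × ℕ) :=
  let R : ℕ × ℕ := (p.2.1, p.2.2 + 1)
  let D : ℕ × ℕ := (p.2.1 + 1, p.2.2)
  if R ∈ μ ∧ (D ∉ μ ∨ p.1 R < p.1 D) then
    (Function.update (Function.update p.1 p.2 (p.1 R)) R 0, R)
  else if D ∈ μ then
    (Function.update (Function.update p.1 p.2 (p.1 D)) D 0, D)
  else p

/-- Ordinary (Schützenberger) promotion of standard Young tableaux: delete the label `1`, which is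
in the corner box `(0, 0)`, slide the resulting hole outwards as far as possible (this takes fewer
than `|μ|` steps), label it by `M + 1`, and subtract one from every label. -/
def promotion (μ : YoungDiagram) (T : Filling) : Filling :=
  fillAndShift μ (maxEntry μ T) ((slideStep μ)^[μ.card] (deleteOne T, (0, 0))).1

/-! ### K-evacuation and ordinary evacuation -/

/-- `[T]_j`: the boxes of `μ` whose label in `T` is at most `j`. -/
def sublevel (μ : YoungDiagram) (T : Filling) (j : ℕ) : Finset (ℕ × ℕ) :=
  μ.cells.filter fun b => T b ≤ j

/-- The tableau encoded by the chain `([P^(M - j) T]_j)`, `0 ≤ j ≤ M`, where `M` is the maximal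
label of `T`: a box is labelled by the least `j` for which it belongs to the `j`th member of the
chain (boxes outside `μ` belong to no member, and get `sInf ∅ = 0`). -/
noncomputable def evacuationVia (P : Filling → Filling) (μ : YoungDiagram) (T : Filling) :
    Filling := fun b =>
  sInf {j | j ≤ maxEntry μ T ∧ b ∈ sublevel μ (P^[maxEntry μ T - j] T) j}

/-- K-evacuation of increasing tableaux of shape `μ`. -/
noncomputable def kEvacuation (μ : YoungDiagram) : Filling → Filling :=
  evacuationVia (kPromotion μ) μ

/-- Ordinary (Schützenberger) evacuation of standard Young tableaux of shape `μ`. -/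
noncomputable def evacuation (μ : YoungDiagram) : Filling → Filling :=
  evacuationVia (promotion μ) μ

/-! ### The map to flag-shaped standard Young tableaux -/

/-- Row `r` of a filling with `n` columns, as a list. -/
def rowList (n : ℕ) (T : Filling) (r : ℕ) : List ℕ := (List.range n).map fun c => T (r, c)

/-- The set `A` of numbers that appear in both rows of a two-row filling. -/
def setA (n : ℕ) (T : Filling) : Finset ℕ :=
  (rowList n T 0).toFinset ∩ (rowList n T 1).toFinset

/-- The set `B` of numbers that appear in the second row immediately right of an element of `A`. -/
def setB (n : ℕ) (T : Filling) : Finset ℕ :=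
  ((Finset.range n).filter fun c => c + 1 < n ∧ T (1, c) ∈ setA n T).image fun c => T (1, c + 1)

/-- Delete all elements of `A` from the first row of `T` and all elements of `B` from the second
row (closing the gaps), and append `B`, in increasing order, to the first column. -/
def flagMap (n : ℕ) (T : Filling) : Filling := fun b =>
  if b.1 = 0 then ((rowList n T 0).filter (· ∉ setA n T)).getD b.2 0
  else if b.1 = 1 then ((rowList n T 1).filter (· ∉ setB n T)).getD b.2 0
  else if b.2 = 0 then ((setB n T).sort (· ≤ ·)).getD (b.1 - 2) 0
  else 0

end IncTableau

open IncTableau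

namespace IncTableau

/-! A row is recorded by its counting function, the number of its labels at most `v`. A two-row
increasing tableau with largest label `M` becomes a pair `R₀`, `R₁` (`Ballot`): a lattice path of
height `h = R₀ - R₁`, where a label of the first row is a step up, one of the second row a step
down, and a label appearing twice goes down and then up. Column strictness, `R₁ (v + 1) ≤ R₀ v`,
says that even these dips stay nonnegative. A standard tableau of flag shape becomes a triple `N₀`,
`N₁`, `N₂` (`FlagBallot`), exactly one member of which grows at each label.

The flag map. Let `ε v` tell whether the last second-row label `≤ v` appears twice. A second-row
label `v + 1` belongs to `B` iff `ε v = 1`, and every label `≤ v` appearing twice has its right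
neighbor among those counted by `N₂ v`, except possibly the last, counted by `ε v`. Hence `R₀ = N₀ +
N₂ + ε` and `R₁ = N₁ + N₂` (`FlagRel`). Conversely `ε M = 0`, and the triple determines `ε` from `M`
downwards; this gives the bijection.

K-evacuation. The holes of K-jeu de taquin can be read off the original tableau (`IsHole`), and in
two rows they are known explicitly (`kPromotion_rect`). On counting functions, K-promotion shifts
the labels and corrects by indicators that the path has come down to zero (`Meet`) or dipped to zero
(`Touch`). After `i` rounds, for `i + j ≤ M` (`RectState`): `A₀ j = R₀ (i + j) - R₁ i - min h` and
`A₁ j = R₁ (i + j) - R₀ i + min dip`, with minima over the interval from `i` to `i + j`. Evacuation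
only uses `i + j = M`; there both minima are `0`, because the path ends at height `0`. So
K-evacuation is rotation by half a turn with reversed labels (`Counts₂.kEvacuation`).

The flag side. Labels of a standard tableau are distinct, so K-promotion is ordinary promotion
(`kPromotion_eq_promotion`). Its iterates on the flag are again expressed through the path of `T`
(`FlagState`): the labels outside the first row are counted by the same formula as the second row of
the K-promoted `T`, and the column counts right neighbors of labels appearing twice, with a
correction `nextTwice`. At `i + j = M` these numbers satisfy `FlagRel` with the rotated pair, `ε v`
being `nextTwice` at `M - v` (`Ballot.flagRel_rotate`). Thus the evacuated flag tableau is the flag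
image of the rotated one. -/

/-! ### The holes of K-jeu de taquin, and comparison with ordinary promotion -/

theorem mem_seNeighbors {μ : YoungDiagram} {e b : ℕ × ℕ} :
    b ∈ seNeighbors μ e ↔ (b = (e.1, e.2 + 1) ∨ b = (e.1 + 1, e.2)) ∧ b ∈ μ := by
  simp [seNeighbors]

theorem seNeighbors_antidiag {μ : YoungDiagram} {e b : ℕ × ℕ} (h : b ∈ seNeighbors μ e) :
    b.1 + b.2 = e.1 + e.2 + 1 := by
  rcases mem_seNeighbors.1 h with ⟨rfl | rfl, -⟩ <;> dsimp only <;> omega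

theorem mem_of_seNeighbors {μ : YoungDiagram} {e b : ℕ × ℕ} (h : b ∈ seNeighbors μ e) : b ∈ μ :=
  (mem_seNeighbors.1 h).2

theorem minLabel_congr {μ : YoungDiagram} {T T' : Filling} {e : ℕ × ℕ}
    (h : ∀ b ∈ seNeighbors μ e, T b = T' b) : minLabel μ T e = minLabel μ T' e := by
  unfold minLabel
  split_ifs with hn
  · exact Finset.inf'_congr hn rfl h
  · rfl

theorem minLabel_eq_zero {μ : YoungDiagram} {T : Filling} {e : ℕ × ℕ}
    (h : seNeighbors μ e = ∅) : minLabel μ T e = 0 := by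
  simp [minLabel, h]

theorem minLabel_pos {μ : YoungDiagram} {T : Filling} {e : ℕ × ℕ}
    (hpos : ∀ b ∈ seNeighbors μ e, T b ≠ 0) (h : (seNeighbors μ e).Nonempty) :
    minLabel μ T e ≠ 0 := by
  rw [minLabel, dif_pos h]
  obtain ⟨b, hb, hbe⟩ := Finset.exists_mem_eq_inf' h T
  rw [hbe]
  exact hpos b hb

theorem minLabel_both {μ : YoungDiagram} {T : Filling} {r c : ℕ}
    (hR : (r, c + 1) ∈ μ) (hD : (r + 1, c) ∈ μ) :
    minLabel μ T (r, c) = min (T (r, c + 1)) (T (r + 1, c)) := by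
  have h : seNeighbors μ (r, c) = {(r, c + 1), (r + 1, c)} := by
    ext b; rw [mem_seNeighbors]; simp only [Finset.mem_insert, Finset.mem_singleton]
    exact ⟨fun h => h.1, fun h => ⟨h, by rcases h with rfl | rfl <;> assumption⟩⟩
  simp only [minLabel, h]
  simp

theorem minLabel_right {μ : YoungDiagram} {T : Filling} {r c : ℕ}
    (hR : (r, c + 1) ∈ μ) (hD : (r + 1, c) ∉ μ) :
    minLabel μ T (r, c) = T (r, c + 1) := by
  have h : seNeighbors μ (r, c) = {(r, c + 1)} := by
    ext b; rw [mem_seNeighbors]; simp only [Finset.mem_singleton]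
    constructor
    · rintro ⟨rfl | rfl, h⟩
      · rfl
      · exact absurd h hD
    · rintro rfl; exact ⟨Or.inl rfl, hR⟩
  simp only [minLabel, h]
  simp

theorem minLabel_below {μ : YoungDiagram} {T : Filling} {r c : ℕ}
    (hR : (r, c + 1) ∉ μ) (hD : (r + 1, c) ∈ μ) :
    minLabel μ T (r, c) = T (r + 1, c) := by
  have h : seNeighbors μ (r, c) = {(r + 1, c)} := by
    ext b; rw [mem_seNeighbors]; simp only [Finset.mem_singleton]
    constructor
    · rintro ⟨rfl | rfl, h⟩
      · exact absurd h hR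
      · rfl
    · rintro rfl; exact ⟨Or.inr rfl, hD⟩
  simp only [minLabel, h]
  simp

theorem minLabel_none {μ : YoungDiagram} {T : Filling} {r c : ℕ}
    (hR : (r, c + 1) ∉ μ) (hD : (r + 1, c) ∉ μ) : minLabel μ T (r, c) = 0 := by
  apply minLabel_eq_zero
  ext b; rw [mem_seNeighbors]; simp only [Finset.notMem_empty, iff_false]
  rintro ⟨rfl | rfl, h⟩
  · exact hR h
  · exact hD h

/-- The boxes that are empty at some time during K-jeu de taquin, started at the corner. -/
inductive IsHole (μ : YoungDiagram) (T : Filling) : ℕ × ℕ → Prop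
  | corner : (0, 0) ∈ μ → IsHole μ T (0, 0)
  | slide {e b : ℕ × ℕ} : IsHole μ T e → b ∈ seNeighbors μ e → T b = minLabel μ T e → IsHole μ T b

theorem IsHole.mem {μ : YoungDiagram} {T : Filling} {b : ℕ × ℕ} (h : IsHole μ T b) : b ∈ μ := by
  cases h with
  | corner h => exact h
  | slide _ h _ => exact mem_of_seNeighbors h

open Classical in
/-- The filling after `t` steps of K-jeu de taquin: the holes on the first `t` antidiagonals have
been filled, and the holes on antidiagonal `t` are empty. -/
noncomputable def jdtState (μ : YoungDiagram) (T : Filling) (t : ℕ) : Filling := fun b =>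
  if IsHole μ T b ∧ b.1 + b.2 < t then minLabel μ T b
  else if IsHole μ T b ∧ b.1 + b.2 = t then 0 else T b

theorem jdtState_of_lt {μ : YoungDiagram} {T : Filling} {t : ℕ} {b : ℕ × ℕ} (h : t < b.1 + b.2) :
    jdtState μ T t b = T b := by
  rw [jdtState, if_neg (by omega), if_neg (by omega)]

theorem jdtState_of_not {μ : YoungDiagram} {T : Filling} {t : ℕ} {b : ℕ × ℕ}
    (h : ¬ IsHole μ T b) : jdtState μ T t b = T b := by
  rw [jdtState, if_neg (by tauto), if_neg (by tauto)]

theorem jdtState_eq {μ : YoungDiagram} {T : Filling} {t : ℕ} {b : ℕ × ℕ} (h : IsHole μ T b)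
    (ht : b.1 + b.2 = t) : jdtState μ T t b = 0 := by
  rw [jdtState, if_neg (by omega), if_pos ⟨h, ht⟩]

theorem jdtState_hole {μ : YoungDiagram} {T : Filling} {t : ℕ} {b : ℕ × ℕ} (h : IsHole μ T b)
    (ht : b.1 + b.2 < t) : jdtState μ T t b = minLabel μ T b := by
  rw [jdtState, if_pos ⟨h, ht⟩]

/-- SE-neighbors of antidiagonal `t` lie on antidiagonal `t + 1`, which no earlier step has touched.
So step `t` only compares labels of `T` itself, and this is why the holes can be defined from `T`
alone. -/
theorem kStep_jdtState {μ : YoungDiagram} {T : Filling} (hpos : ∀ b ∈ μ, T b ≠ 0) (t : ℕ) :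
    kStep μ (jdtState μ T t) = jdtState μ T (t + 1) := by
  -- An empty box before antidiagonal `t` has no SE-neighbor: otherwise it would have received a
  -- positive label.
  have hzero : ∀ e ∈ μ, jdtState μ T t e = 0 → IsHole μ T e ∧
      (e.1 + e.2 = t ∨ e.1 + e.2 < t ∧ seNeighbors μ e = ∅) := by
    intro e he h0
    by_cases hh : IsHole μ T e
    · refine ⟨hh, ?_⟩
      rcases lt_trichotomy (e.1 + e.2) t with h | h | h
      · right
        refine ⟨h, ?_⟩
        rw [jdtState_hole hh h] at h0
        by_contra hne
        exact minLabel_pos (fun b hb => hpos b (mem_of_seNeighbors hb))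
          (Finset.nonempty_iff_ne_empty.2 hne) h0
      · exact Or.inl h
      · rw [jdtState_of_lt h] at h0
        exact absurd h0 (hpos e he)
    · rw [jdtState_of_not hh] at h0
      exact absurd h0 (hpos e he)
  have hmin : ∀ e, e.1 + e.2 = t → minLabel μ (jdtState μ T t) e = minLabel μ T e := by
    intro e he
    apply minLabel_congr
    intro b hb
    have := seNeighbors_antidiag hb
    exact jdtState_of_lt (by omega)
  funext b
  unfold kStep
  split_ifs with h1 h2
  · obtain ⟨hh, ht | ⟨ht, he⟩⟩ := hzero b h1.1 h1.2
    · rw [hmin b ht, jdtState_hole hh (by omega)]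
    · rw [jdtState_hole hh (by omega), minLabel_eq_zero he, minLabel_eq_zero he]
  · obtain ⟨e, heμ, he0, hbe, hbm⟩ := h2
    obtain ⟨hh, ht | ⟨ht, he⟩⟩ := hzero e heμ he0
    · have hb := seNeighbors_antidiag hbe
      rw [hmin e ht, jdtState_of_lt (by omega)] at hbm
      rw [jdtState_eq (hh.slide hbe hbm) (by omega)]
    · rw [he] at hbe
      simp at hbe
  · by_cases hh : IsHole μ T b
    · rcases lt_trichotomy (b.1 + b.2) t with h | h | h
      · rw [jdtState_hole hh h, jdtState_hole hh (by omega)]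
      · exact absurd ⟨hh.mem, jdtState_eq hh h⟩ h1
      · by_cases h' : b.1 + b.2 = t + 1
        · exfalso
          apply h2
          cases hh with
          | corner _ => simp at h'
          | @slide e _ he hbe hbm =>
            have hb := seNeighbors_antidiag hbe
            refine ⟨e, he.mem, jdtState_eq he (by omega), hbe, ?_⟩
            rw [hmin e (by omega), jdtState_of_lt h, hbm]
        · rw [jdtState_of_lt h, jdtState_of_lt (by omega)]
    · rw [jdtState_of_not hh, jdtState_of_not hh]

theorem kStep_iterate {μ : YoungDiagram} {T : Filling} (hpos : ∀ b ∈ μ, T b ≠ 0)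
    (h1 : ∀ b, T b = 1 ↔ b = (0, 0) ∧ b ∈ μ) (t : ℕ) :
    (kStep μ)^[t] (deleteOne T) = jdtState μ T t := by
  induction t with
  | zero =>
    funext b
    by_cases hb : b = (0, 0) ∧ b ∈ μ
    · have : IsHole μ T b := by
        obtain ⟨rfl, h⟩ := hb
        exact .corner h
      rw [jdtState_eq this (by simp [hb.1])]
      simp [deleteOne, (h1 b).2 hb]
    · have h0 : T b ≠ 1 := fun h => hb ((h1 b).1 h)
      rw [Function.iterate_zero, id, deleteOne, if_neg h0]
      by_cases h : 0 < b.1 + b.2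
      · rw [jdtState_of_lt h]
      · rw [jdtState_of_not]
        intro hh
        exact hb ⟨Prod.ext (by simp; omega) (by simp; omega), hh.mem⟩
  | succ t ih => rw [Function.iterate_succ_apply', ih, kStep_jdtState hpos]

/-- The path down the first column and then along row `r` joins the corner to `b` inside `μ` and has
one box on each antidiagonal. Consequently `|μ|` steps suffice for the holes to pass every box. -/
theorem antidiag_lt_card {μ : YoungDiagram} {b : ℕ × ℕ} (hb : b ∈ μ) : b.1 + b.2 < μ.card := by
  obtain ⟨r, c⟩ := b
  have hinj : Set.InjOn (fun t : ℕ => if t ≤ r then (t, 0) else (r, t - r))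
      (Finset.range (r + c + 1)) := by
    intro s _ t _ h
    dsimp only at h
    split_ifs at h <;> simp only [Prod.mk.injEq] at h <;> omega
  have hsub : (Finset.range (r + c + 1)).image
      (fun t : ℕ => if t ≤ r then (t, 0) else (r, t - r)) ⊆ μ.cells := by
    intro x hx
    obtain ⟨t, ht, rfl⟩ := Finset.mem_image.1 hx
    rw [Finset.mem_range] at ht
    rw [YoungDiagram.mem_cells]
    split_ifs
    · exact μ.up_left_mem (by omega) (Nat.zero_le _) hb
    · exact μ.up_left_mem le_rfl (by omega) hb
  have := Finset.card_le_card hsub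
  rw [Finset.card_image_of_injOn hinj, Finset.card_range] at this
  exact this

theorem kPromotion_hole {μ : YoungDiagram} {T : Filling} (hpos : ∀ b ∈ μ, T b ≠ 0)
    (h1 : ∀ b, T b = 1 ↔ b = (0, 0) ∧ b ∈ μ) {b : ℕ × ℕ} (hb : IsHole μ T b) :
    kPromotion μ T b =
      if minLabel μ T b = 0 then maxEntry μ T else minLabel μ T b - 1 := by
  rw [kPromotion, kStep_iterate hpos h1, fillAndShift, if_pos hb.mem,
    jdtState_hole hb (antidiag_lt_card hb.mem)]
  split_ifs <;> omega

theorem kPromotion_not_hole {μ : YoungDiagram} {T : Filling} (hpos : ∀ b ∈ μ, T b ≠ 0)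
    (h1 : ∀ b, T b = 1 ↔ b = (0, 0) ∧ b ∈ μ) {b : ℕ × ℕ} (hb : ¬ IsHole μ T b) (hμ : b ∈ μ) :
    kPromotion μ T b = T b - 1 := by
  rw [kPromotion, kStep_iterate hpos h1, fillAndShift, if_pos hμ, jdtState_of_not hb,
    if_neg (hpos b hμ)]

theorem kPromotion_not_mem {μ : YoungDiagram} {T : Filling} {b : ℕ × ℕ} (hb : b ∉ μ) :
    kPromotion μ T b = 0 := by
  rw [kPromotion, fillAndShift, if_neg hb]

/-- A filling with exactly one empty box `p.2`, all other labels being distinct. -/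
structure OneHole (μ : YoungDiagram) (p : Filling × (ℕ × ℕ)) : Prop where
  mem : p.2 ∈ μ
  eq_zero : ∀ b ∈ μ, p.1 b = 0 ↔ b = p.2
  inj : ∀ a ∈ μ, ∀ b ∈ μ, p.1 a = p.1 b → a = b

/-- Since labels are distinct, the minimal label sits in only one SE-neighbor, so a single hole
never splits. -/
theorem oneHole_move {μ : YoungDiagram} {X : Filling} {h q : ℕ × ℕ} (H : OneHole μ (X, h))
    (hq : q ∈ seNeighbors μ h) (hmin : minLabel μ X h = X q) :
    OneHole μ (Function.update (Function.update X h (X q)) q 0, q) ∧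
      kStep μ X = Function.update (Function.update X h (X q)) q 0 := by
  obtain ⟨hm, hz, hi⟩ := H
  dsimp only at hm hz hi
  have hqμ := mem_of_seNeighbors hq
  have hne : q ≠ h := by
    rintro rfl
    have := seNeighbors_antidiag hq
    omega
  have hq0 : X q ≠ 0 := fun h => hne ((hz q hqμ).1 h)
  have hval : ∀ b, Function.update (Function.update X h (X q)) q 0 b =
      if b = q then 0 else if b = h then X q else X b := by
    intro b
    simp only [Function.update_apply]
  refine ⟨⟨hqμ, ?_, ?_⟩, ?_⟩
  · intro b hb
    dsimp only
    rw [hval]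
    split_ifs with h1 h2
    · simp [h1]
    · simp [h1, hq0]
    · simp [h1, hz b hb, h2]
  · intro a ha b hb
    dsimp only
    rw [hval, hval]
    have := hz a ha
    have := hz b hb
    have h3 := hi a ha b hb
    have h4 := hi a ha q hqμ
    have h5 := hi q hqμ b hb
    split_ifs <;> grind
  · funext b
    rw [hval]
    unfold kStep
    have hdel : (∃ e ∈ μ.cells, X e = 0 ∧ b ∈ seNeighbors μ e ∧ X b = minLabel μ X e) ↔ b = q := by
      constructor
      · rintro ⟨e, he, he0, hbe, hbm⟩
        obtain rfl := (hz e he).1 he0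
        rw [hmin] at hbm
        exact hi b (mem_of_seNeighbors hbe) q hqμ hbm
      · rintro rfl
        exact ⟨h, hm, (hz h hm).2 rfl, hq, hmin.symm⟩
    simp only [hdel]
    by_cases hbq : b = q
    · subst hbq
      rw [if_neg (fun h => hq0 h.2), if_pos rfl, if_pos rfl]
    · by_cases hbh : b = h
      · subst hbh
        rw [if_pos ⟨hm, (hz b hm).2 rfl⟩, if_neg hbq, if_pos rfl, hmin]
      · rw [if_neg (fun h' => hbh ((hz b h'.1).1 h'.2)), if_neg hbq, if_neg hbq, if_neg hbh]

theorem kStep_eq_slideStep {μ : YoungDiagram} {p : Filling × (ℕ × ℕ)} (H : OneHole μ p) :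
    OneHole μ (slideStep μ p) ∧ kStep μ p.1 = (slideStep μ p).1 := by
  obtain ⟨X, ⟨r, c⟩⟩ := p
  unfold slideStep
  dsimp only
  split_ifs with h1 h2
  · obtain ⟨hR, h⟩ := h1
    refine oneHole_move H (mem_seNeighbors.2 ⟨Or.inl rfl, hR⟩) ?_
    by_cases hD : (r + 1, c) ∈ μ
    · rw [minLabel_both hR hD]
      have : X (r, c + 1) < X (r + 1, c) := by tauto
      omega
    · exact minLabel_right hR hD
  · refine oneHole_move H (mem_seNeighbors.2 ⟨Or.inr rfl, h2⟩) ?_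
    by_cases hR : (r, c + 1) ∈ μ
    · rw [minLabel_both hR h2]
      have : ¬ X (r, c + 1) < X (r + 1, c) := by tauto
      omega
    · exact minLabel_below hR h2
  · have hR : (r, c + 1) ∉ μ := by tauto
    refine ⟨H, ?_⟩
    have hnb : seNeighbors μ (r, c) = ∅ := by
      ext b; rw [mem_seNeighbors]; simp only [Finset.notMem_empty, iff_false]
      rintro ⟨rfl | rfl, h⟩
      · exact hR h
      · exact h2 h
    have h0 : X (r, c) = 0 := (H.eq_zero _ H.mem).2 rfl
    funext b
    unfold kStep
    have hdel : ¬ ∃ e ∈ μ.cells, X e = 0 ∧ b ∈ seNeighbors μ e ∧ X b = minLabel μ X e := by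
      rintro ⟨e, he, he0, hbe, -⟩
      obtain rfl := (H.eq_zero e he).1 he0
      dsimp only at hbe
      rw [hnb] at hbe
      simp at hbe
    rw [if_neg hdel]
    split_ifs with hb
    · obtain rfl := (H.eq_zero b hb.1).1 hb.2
      dsimp only
      rw [minLabel_eq_zero hnb, h0]
    · rfl

/-- On a filling by distinct labels, K-promotion is ordinary promotion. -/
theorem kPromotion_eq_promotion {μ : YoungDiagram} {T : Filling} (hμ : (0, 0) ∈ μ)
    (hpos : ∀ b ∈ μ, T b ≠ 0) (h1 : ∀ b, T b = 1 ↔ b = (0, 0) ∧ b ∈ μ)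
    (hinj : Set.InjOn T μ.cells) : kPromotion μ T = promotion μ T := by
  have key : ∀ t, OneHole μ ((slideStep μ)^[t] (deleteOne T, (0, 0))) ∧
      (kStep μ)^[t] (deleteOne T) = ((slideStep μ)^[t] (deleteOne T, (0, 0))).1 := by
    intro t
    induction t with
    | zero =>
      have hz : ∀ b ∈ μ, deleteOne T b = 0 ↔ b = (0, 0) := by
        intro b hb
        have := h1 b
        have := hpos b hb
        unfold deleteOne
        split_ifs <;> tauto
      refine ⟨⟨hμ, hz, ?_⟩, rfl⟩
      intro a ha b hb hab
      change deleteOne T a = deleteOne T b at hab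
      by_cases h0 : deleteOne T a = 0
      · rw [(hz a ha).1 h0, (hz b hb).1 (hab ▸ h0)]
      · apply hinj ha hb
        unfold deleteOne at hab h0
        split_ifs at * <;> simp_all
    | succ t ih =>
      rw [Function.iterate_succ_apply', Function.iterate_succ_apply', ih.2]
      exact kStep_eq_slideStep ih.1
  rw [kPromotion, promotion, (key _).2]


/-! ### Counting functions of increasing sequences -/

/-- `R v` is the number of `c < n` with `f c ≤ v`, where `f` is increasing on `{0, …, n - 1}`. -/
def Counts (n : ℕ) (f R : ℕ → ℕ) : Prop := ∀ c < n, ∀ v, f c ≤ v ↔ c < R v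

theorem exists_counts {n : ℕ} {f : ℕ → ℕ} (hf : ∀ a b, a < b → b < n → f a < f b) :
    ∃ R : ℕ → ℕ, Counts n f R ∧ (∀ v, R v ≤ n) ∧
      ∀ v, R (v + 1) = R v + if ∃ c < n, f c = v + 1 then 1 else 0 := by
  have key : Counts n f fun v => ((Finset.range n).filter fun c => f c ≤ v).card := by
    intro c hc v
    dsimp only
    constructor
    · intro h
      have : Finset.range (c + 1) ⊆ (Finset.range n).filter fun c => f c ≤ v := by
        intro a ha
        rw [Finset.mem_range] at ha
        rw [Finset.mem_filter, Finset.mem_range]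
        refine ⟨by omega, ?_⟩
        rcases Nat.lt_or_ge a c with h' | h'
        · exact (hf a c h' hc).le.trans h
        · obtain rfl : a = c := by omega
          exact h
      have := Finset.card_le_card this
      rw [Finset.card_range] at this
      exact this
    · intro h
      by_contra hlt
      have : ((Finset.range n).filter fun c => f c ≤ v) ⊆ Finset.range c := by
        intro a ha
        rw [Finset.mem_filter, Finset.mem_range] at ha
        rw [Finset.mem_range]
        by_contra hca
        rcases Nat.lt_or_ge c a with h' | h'
        · have := hf c a h' ha.1
          omega
        · obtain rfl : a = c := by omega
          exact hlt ha.2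
      have := Finset.card_le_card this
      rw [Finset.card_range] at this
      omega
  refine ⟨_, key, fun v => (Finset.card_filter_le _ _).trans (by simp), fun v => ?_⟩
  have hsplit : ((Finset.range n).filter fun c => f c ≤ v + 1) =
      ((Finset.range n).filter fun c => f c ≤ v) ∪ (Finset.range n).filter fun c => f c = v + 1 := by
    ext a
    simp only [Finset.mem_filter, Finset.mem_union]
    have : f a ≤ v + 1 ↔ f a ≤ v ∨ f a = v + 1 := by omega
    tauto
  have hdisj : Disjoint ((Finset.range n).filter fun c => f c ≤ v)
      ((Finset.range n).filter fun c => f c = v + 1) := by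
    rw [Finset.disjoint_filter]
    intro a _ h
    omega
  rw [hsplit, Finset.card_union_of_disjoint hdisj]
  congr 1
  split_ifs with h
  · obtain ⟨c, hc, hcv⟩ := h
    rw [Finset.card_eq_one]
    refine ⟨c, ?_⟩
    ext a
    simp only [Finset.mem_filter, Finset.mem_range, Finset.mem_singleton]
    constructor
    · rintro ⟨ha, hav⟩
      rcases lt_trichotomy a c with h | h | h
      · have := hf a c h hc
        omega
      · exact h
      · have := hf c a h ha
        omega
    · rintro rfl
      exact ⟨hc, hcv⟩
  · rw [Finset.card_eq_zero]
    ext a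
    simp only [Finset.mem_filter, Finset.mem_range, Finset.notMem_empty, iff_false]
    rintro ⟨ha, hav⟩
    exact h ⟨a, ha, hav⟩

theorem Counts.congr {n : ℕ} {f f' R : ℕ → ℕ} (h : Counts n f R) (h' : Counts n f' R) {c : ℕ}
    (hc : c < n) : f c = f' c :=
  le_antisymm ((h c hc _).2 ((h' c hc _).1 le_rfl)) ((h' c hc _).2 ((h c hc _).1 le_rfl))

/-- `Counts` compares `R v` only with numbers below `n`, so a value above `n` cannot be told from
`n`; hence the two bounds. -/
theorem Counts.unique {n : ℕ} {f R R' : ℕ → ℕ} (h : Counts n f R) (h' : Counts n f R') {v : ℕ}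
    (hv : R v ≤ n) (hv' : R' v ≤ n) : R v = R' v := by
  by_contra hne
  rcases Nat.lt_or_gt_of_ne hne with hlt | hlt
  · have := (h (R v) (by omega) v).symm.trans (h' (R v) (by omega) v)
    omega
  · have := (h (R' v) (by omega) v).symm.trans (h' (R' v) (by omega) v)
    omega

/-- If `f b = v + 1`, then `R` passes `b` between `v` and `v + 1`; as it grows by at most one, `R v
= b > a`, which gives `f a ≤ v`. -/
theorem Counts.lt {n M : ℕ} {f R : ℕ → ℕ} (h : Counts n f R) (h0 : R 0 = 0) (hM : R M = n)
    (hs : ∀ v < M, R (v + 1) ≤ R v + 1) {a b : ℕ} (hab : a < b) (hb : b < n) : f a < f b := by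
  obtain ⟨v, hv⟩ | hv : (∃ v, f b = v + 1) ∨ f b = 0 := by
    cases f b <;> simp
  · have h1 := (h b hb (v + 1)).1 hv.le
    have h2 : ¬ b < R v := fun h' => by have := (h b hb v).2 h'; omega
    have h3 : f b ≤ M := (h b hb M).2 (by omega)
    have h4 := hs v (by omega)
    have := (h a (by omega) v).2 (by omega)
    omega
  · have := (h b hb 0).1 hv.le
    omega

theorem Counts.exists_eq {n : ℕ} {f R : ℕ → ℕ} (h : Counts n f R) {v : ℕ}
    (hv : R v < R (v + 1)) (hn : R (v + 1) ≤ n) : f (R v) = v + 1 := by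
  have h1 := (h (R v) (by omega) (v + 1)).2 hv
  have h2 := (h (R v) (by omega) v).1.mt (lt_irrefl _)
  omega

theorem Counts.pos {n : ℕ} {f R : ℕ → ℕ} (h : Counts n f R) (h0 : R 0 = 0) {c : ℕ} (hc : c < n) :
    f c ≠ 0 := by
  intro hf
  have := (h c hc 0).1 hf.le
  omega

theorem Counts.lt_succ {n : ℕ} {f R : ℕ → ℕ} (h : Counts n f R) {v c : ℕ} (hc : c < n)
    (hf : f c = v + 1) : R v ≤ c ∧ c < R (v + 1) := by
  have h1 := h c hc (v + 1)
  have h2 := h c hc v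
  omega

/-! ### Increasing tableaux with two rows -/

theorem mem_rect {m n r c : ℕ} : (r, c) ∈ rect m n ↔ r < m ∧ c < n := by
  rw [← YoungDiagram.mem_cells]
  simp [rect]

theorem card_rect (m n : ℕ) : (rect m n).card = m * n := by
  simp [YoungDiagram.card, rect]

/-- The numbers `R₀ v`, `R₁ v` of labels `≤ v` in the two rows of an increasing tableau. -/
structure Ballot (n M : ℕ) (R₀ R₁ : ℕ → ℕ) : Prop where
  zero₀ : R₀ 0 = 0
  zero₁ : R₁ 0 = 0
  mono₀ : ∀ v < M, R₀ v ≤ R₀ (v + 1)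
  step₀ : ∀ v < M, R₀ (v + 1) ≤ R₀ v + 1
  mono₁ : ∀ v < M, R₁ v ≤ R₁ (v + 1)
  step₁ : ∀ v < M, R₁ (v + 1) ≤ R₁ v + 1
  cover : ∀ v < M, R₀ v + R₁ v < R₀ (v + 1) + R₁ (v + 1)
  column : ∀ v < M, R₁ (v + 1) ≤ R₀ v
  top₀ : ∀ v, M ≤ v → R₀ v = n
  top₁ : ∀ v, M ≤ v → R₁ v = n

/-- `T` is a filling of two rows of length `n` with counting functions `R₀`, `R₁`. -/
structure Counts₂ (n : ℕ) (T : Filling) (R₀ R₁ : ℕ → ℕ) : Prop where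
  row₀ : Counts n (fun c => T (0, c)) R₀
  row₁ : Counts n (fun c => T (1, c)) R₁
  outside : ∀ b, b ∉ rect 2 n → T b = 0

theorem le_of_steps {M : ℕ} {R : ℕ → ℕ} (h : ∀ v < M, R v ≤ R (v + 1)) {a b : ℕ} (hab : a ≤ b)
    (hb : b ≤ M) : R a ≤ R b := by
  induction b, hab using Nat.le_induction with
  | base => exact le_rfl
  | succ b _ ih => exact (ih (by omega)).trans (h b (by omega))

theorem Counts₂.ext {n : ℕ} {T T' : Filling} {R₀ R₁ : ℕ → ℕ} (h : Counts₂ n T R₀ R₁)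
    (h' : Counts₂ n T' R₀ R₁) : T = T' := by
  funext ⟨r, c⟩
  by_cases hb : (r, c) ∈ rect 2 n
  · rw [mem_rect] at hb
    obtain rfl | rfl : r = 0 ∨ r = 1 := by omega
    · exact h.row₀.congr h'.row₀ hb.2
    · exact h.row₁.congr h'.row₁ hb.2
  · rw [h.outside _ hb, h'.outside _ hb]

theorem le_maxEntry {μ : YoungDiagram} {T : Filling} {b : ℕ × ℕ} (hb : b ∈ μ) :
    T b ≤ maxEntry μ T := Finset.le_sup (f := T) ((YoungDiagram.mem_cells _).2 hb)

theorem exists_ballot {n k : ℕ} (hn : 0 < n) {T : Filling} (hT : T ∈ Inc (rect 2 n) k) :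
    ∃ R₀ R₁, Counts₂ n T R₀ R₁ ∧ Ballot n (maxEntry (rect 2 n) T) R₀ R₁ := by
  obtain ⟨hout, ⟨hrow, hcol⟩, himg, -⟩ := hT
  set M := maxEntry (rect 2 n) T with hM
  obtain ⟨R₀, h₀, hle₀, hs₀⟩ := exists_counts (n := n) (f := fun c => T (0, c))
    fun a b hab hb => hrow 0 a b hab (mem_rect.2 ⟨by omega, hb⟩)
  obtain ⟨R₁, h₁, hle₁, hs₁⟩ := exists_counts (n := n) (f := fun c => T (1, c))
    fun a b hab hb => hrow 1 a b hab (mem_rect.2 ⟨by omega, hb⟩)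
  have hpos : ∀ r c, r < 2 → c < n → 1 ≤ T (r, c) ∧ T (r, c) ≤ M := by
    intro r c hr hc
    rw [← Finset.mem_Icc, ← himg]
    exact Finset.mem_image_of_mem T ((YoungDiagram.mem_cells _).2 (mem_rect.2 ⟨hr, hc⟩))
  have hz : ∀ {r : ℕ} {R : ℕ → ℕ}, r < 2 → Counts n (fun c => T (r, c)) R → R 0 = 0 := by
    intro r R hr h
    by_contra hne
    have h1 := (h 0 hn 0).2 (by omega)
    have h2 := hpos r 0 hr hn
    dsimp only at h1
    omega
  have htop : ∀ {r : ℕ} {R : ℕ → ℕ}, r < 2 → Counts n (fun c => T (r, c)) R → (∀ v, R v ≤ n) →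
      ∀ v, M ≤ v → R v = n := by
    intro r R hr h hle v hv
    have h1 := (h (n - 1) (by omega) v).1
    have h2 := hpos r (n - 1) hr (by omega)
    have h3 := hle v
    dsimp only at h1
    omega
  refine ⟨R₀, R₁, ⟨h₀, h₁, hout⟩, ⟨hz (by omega) h₀, hz (by omega) h₁, ?_, ?_, ?_, ?_, ?_, ?_,
    htop (by omega) h₀ hle₀, htop (by omega) h₁ hle₁⟩⟩
  · intro v _
    have := hs₀ v
    omega
  · intro v _
    have := hs₀ v
    split_ifs at this <;> omega
  · intro v _
    have := hs₁ v
    omega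
  · intro v _
    have := hs₁ v
    split_ifs at this <;> omega
  · intro v hv
    have hmem : v + 1 ∈ (rect 2 n).cells.image T := by
      rw [himg, Finset.mem_Icc]
      omega
    obtain ⟨⟨r, c⟩, hb, hbv⟩ := Finset.mem_image.1 hmem
    rw [YoungDiagram.mem_cells, mem_rect] at hb
    have e0 := hs₀ v
    have e1 := hs₁ v
    obtain rfl | rfl : r = 0 ∨ r = 1 := by omega
    · rw [if_pos ⟨c, hb.2, hbv⟩] at e0
      omega
    · rw [if_pos ⟨c, hb.2, hbv⟩] at e1
      omega
  · intro v _
    -- With `c = R₀ v < R₁ (v + 1)`, the labels of column `c` satisfy `T (0, c) < T (1, c) ≤ v + 1`,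
    -- so `c < R₀ v`, a contradiction.
    by_contra hlt
    have hc : R₀ v < n := by
      have := hle₁ (v + 1)
      omega
    have e1 := (h₁ (R₀ v) hc (v + 1)).2 (by omega)
    have e2 := hcol 0 1 (R₀ v) (by omega) (mem_rect.2 ⟨by omega, hc⟩)
    have e3 := (h₀ (R₀ v) hc v).1
    dsimp only at e1 e3
    omega

/-- `cover` makes every label up to `M` occur, the unit steps make the rows strict, and `column`
makes the columns strict. -/
theorem Ballot.inc {n M : ℕ} {R₀ R₁ : ℕ → ℕ} {T : Filling} (hB : Ballot n M R₀ R₁)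
    (hC : Counts₂ n T R₀ R₁) : maxEntry (rect 2 n) T = M ∧
      ∀ k, M + k = 2 * n → T ∈ Inc (rect 2 n) k := by
  have hle₀ : ∀ v ≤ M, R₀ v ≤ n := fun v hv => by
    have := le_of_steps hB.mono₀ hv le_rfl
    rwa [hB.top₀ M le_rfl] at this
  have hle₁ : ∀ v ≤ M, R₁ v ≤ n := fun v hv => by
    have := le_of_steps hB.mono₁ hv le_rfl
    rwa [hB.top₁ M le_rfl] at this
  have himg : (rect 2 n).cells.image T = Finset.Icc 1 M := by
    ext x
    rw [Finset.mem_image, Finset.mem_Icc]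
    constructor
    · rintro ⟨⟨r, c⟩, hb, rfl⟩
      rw [YoungDiagram.mem_cells, mem_rect] at hb
      obtain rfl | rfl : r = 0 ∨ r = 1 := by omega
      · have h1 := hC.row₀.pos hB.zero₀ hb.2
        have h2 := (hC.row₀ c hb.2 M).2 (by rw [hB.top₀ M le_rfl]; exact hb.2)
        dsimp only at h1 h2
        omega
      · have h1 := hC.row₁.pos hB.zero₁ hb.2
        have h2 := (hC.row₁ c hb.2 M).2 (by rw [hB.top₁ M le_rfl]; exact hb.2)
        dsimp only at h1 h2
        omega
    · rintro ⟨h1, h2⟩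
      obtain ⟨v, rfl⟩ : ∃ v, x = v + 1 := ⟨x - 1, by omega⟩
      have hc := hB.cover v h2
      have l0 := hle₀ (v + 1) h2
      have l1 := hle₁ (v + 1) h2
      by_cases h : R₀ v < R₀ (v + 1)
      · exact ⟨(0, R₀ v), (YoungDiagram.mem_cells _).2 (mem_rect.2 ⟨by omega, by omega⟩),
          hC.row₀.exists_eq h l0⟩
      · have h' : R₁ v < R₁ (v + 1) := by omega
        exact ⟨(1, R₁ v), (YoungDiagram.mem_cells _).2 (mem_rect.2 ⟨by omega, by omega⟩),
          hC.row₁.exists_eq h' l1⟩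
  have hM : maxEntry (rect 2 n) T = M := by
    apply le_antisymm
    · apply Finset.sup_le
      intro b hb
      have := Finset.mem_image_of_mem T hb
      rw [himg, Finset.mem_Icc] at this
      exact this.2
    · rcases Nat.eq_zero_or_pos M with h | h
      · omega
      · have : M ∈ (rect 2 n).cells.image T := by
          rw [himg, Finset.mem_Icc]
          omega
        obtain ⟨b, hb, hbM⟩ := Finset.mem_image.1 this
        rw [← hbM]
        exact le_maxEntry ((YoungDiagram.mem_cells _).1 hb)
  refine ⟨hM, fun k hk => ⟨hC.outside, ⟨?_, ?_⟩, by rw [hM, himg], by rw [hM, card_rect, hk]⟩⟩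
  · intro r a b hab hb
    rw [mem_rect] at hb
    obtain rfl | rfl : r = 0 ∨ r = 1 := by omega
    · exact hC.row₀.lt hB.zero₀ (hB.top₀ M le_rfl) hB.step₀ hab hb.2
    · exact hC.row₁.lt hB.zero₁ (hB.top₁ M le_rfl) hB.step₁ hab hb.2
  · intro a b c hab hb
    rw [mem_rect] at hb
    obtain ⟨rfl, rfl⟩ : a = 0 ∧ b = 1 := by omega
    obtain ⟨v, hv⟩ : ∃ v, T (1, c) = v + 1 :=
      ⟨T (1, c) - 1, by have := hC.row₁.pos hB.zero₁ hb.2; omega⟩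
    have h1 := (hC.row₁ c hb.2 (v + 1)).1 hv.le
    have h2 : T (1, c) ≤ M := (hC.row₁ c hb.2 M).2 (by rw [hB.top₁ M le_rfl]; exact hb.2)
    have h3 := hB.column v (by omega)
    have h4 := (hC.row₀ c hb.2 v).2 (by omega)
    dsimp only at h4
    omega

/-! ### Standard tableaux of flag shape -/

theorem mem_flagShape {n k r c : ℕ} :
    (r, c) ∈ flagShape n k ↔ r < k + 2 ∧ c < n - k ∧ (r < 2 ∨ c = 0) := by
  rw [← YoungDiagram.mem_cells]
  simp only [flagShape, Finset.mem_filter, Finset.mem_product, Finset.mem_range]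
  tauto

theorem card_flagShape {n k : ℕ} (hk : k < n) : (flagShape n k).card = 2 * (n - k) + k := by
  have : (flagShape n k).cells = (Finset.range 2 ×ˢ Finset.range (n - k)) ∪
      (Finset.range k).image fun r => (r + 2, 0) := by
    ext ⟨r, c⟩
    rw [YoungDiagram.mem_cells, mem_flagShape]
    simp only [Finset.mem_union, Finset.mem_product, Finset.mem_range, Finset.mem_image,
      Prod.mk.injEq]
    constructor
    · rintro ⟨h1, h2, h3⟩
      by_cases hr : r < 2
      · exact Or.inl ⟨hr, h2⟩
      · exact Or.inr ⟨r - 2, by omega, by omega, by omega⟩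
    · rintro (⟨h1, h2⟩ | ⟨a, h1, h2, h3⟩)
      · omega
      · omega
  rw [YoungDiagram.card, this, Finset.card_union_of_disjoint, Finset.card_image_of_injective]
  · simp
  · intro a b h
    simpa using h
  · rw [Finset.disjoint_left]
    rintro ⟨r, c⟩ h1 h2
    simp only [Finset.mem_product, Finset.mem_range, Finset.mem_image, Prod.mk.injEq] at h1 h2
    obtain ⟨a, h2⟩ := h2
    omega

/-- The numbers of labels `≤ v` in the first row, in the second row, and below the second row, for
a standard tableau of shape `(m, m, 1ᵏ)`. -/
structure FlagBallot (m k : ℕ) (N₀ N₁ N₂ : ℕ → ℕ) : Prop where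
  mono₀ : ∀ v < 2 * m + k, N₀ v ≤ N₀ (v + 1)
  mono₁ : ∀ v < 2 * m + k, N₁ v ≤ N₁ (v + 1)
  mono₂ : ∀ v < 2 * m + k, N₂ v ≤ N₂ (v + 1)
  sum : ∀ v ≤ 2 * m + k, N₀ v + N₁ v + N₂ v = v
  row : ∀ v ≤ 2 * m + k, N₁ v ≤ N₀ v
  column : ∀ v ≤ 2 * m + k, 0 < N₂ v → 0 < N₁ v
  top₀ : ∀ v, 2 * m + k ≤ v → N₀ v = m
  top₁ : ∀ v, 2 * m + k ≤ v → N₁ v = m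
  top₂ : ∀ v, 2 * m + k ≤ v → N₂ v = k

/-- `S` is a filling of the flag shape with counting functions `N₀`, `N₁`, `N₂`. -/
structure Counts₃ (n k : ℕ) (S : Filling) (N₀ N₁ N₂ : ℕ → ℕ) : Prop where
  row₀ : Counts (n - k) (fun c => S (0, c)) N₀
  row₁ : Counts (n - k) (fun c => S (1, c)) N₁
  column : Counts k (fun r => S (r + 2, 0)) N₂
  outside : ∀ b, b ∉ flagShape n k → S b = 0

theorem Counts₃.ext {n k : ℕ} {S S' : Filling} {N₀ N₁ N₂ : ℕ → ℕ} (h : Counts₃ n k S N₀ N₁ N₂)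
    (h' : Counts₃ n k S' N₀ N₁ N₂) : S = S' := by
  funext ⟨r, c⟩
  by_cases hb : (r, c) ∈ flagShape n k
  · rw [mem_flagShape] at hb
    obtain rfl | rfl | ⟨r, rfl⟩ : r = 0 ∨ r = 1 ∨ ∃ a, r = a + 2 := by
      rcases r with _ | _ | r <;> simp
    · exact h.row₀.congr h'.row₀ hb.2.1
    · exact h.row₁.congr h'.row₁ hb.2.1
    · obtain rfl : c = 0 := by omega
      exact h.column.congr h'.column (c := r) (by omega)
  · rw [h.outside _ hb, h'.outside _ hb]

theorem exists_flagBallot {n k : ℕ} (hk : k < n) {S : Filling} (hS : S ∈ SYT (flagShape n k)) :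
    ∃ N₀ N₁ N₂, Counts₃ n k S N₀ N₁ N₂ ∧ FlagBallot (n - k) k N₀ N₁ N₂ := by
  obtain ⟨hout, ⟨hrow, hcol⟩, hmaps, hinj, hsurj⟩ := hS
  rw [card_flagShape hk] at hmaps hsurj
  obtain ⟨N₀, h₀, hle₀, hs₀⟩ := exists_counts (n := n - k) (f := fun c => S (0, c))
    fun a b hab hb => hrow 0 a b hab (mem_flagShape.2 ⟨by omega, hb, by omega⟩)
  obtain ⟨N₁, h₁, hle₁, hs₁⟩ := exists_counts (n := n - k) (f := fun c => S (1, c))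
    fun a b hab hb => hrow 1 a b hab (mem_flagShape.2 ⟨by omega, hb, by omega⟩)
  obtain ⟨N₂, h₂, hle₂, hs₂⟩ := exists_counts (n := k) (f := fun r => S (r + 2, 0))
    fun a b hab hb => hcol (a + 2) (b + 2) 0 (by omega)
      (mem_flagShape.2 ⟨by omega, by omega, by omega⟩)
  have hmem : ∀ {r c}, r < k + 2 → c < n - k → (r < 2 ∨ c = 0) →
      (r, c) ∈ ((flagShape n k).cells : Set (ℕ × ℕ)) := fun a b c =>
    (YoungDiagram.mem_cells _).2 (mem_flagShape.2 ⟨a, b, c⟩)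
  have hpos : ∀ r c, r < k + 2 → c < n - k → (r < 2 ∨ c = 0) →
      1 ≤ S (r, c) ∧ S (r, c) ≤ 2 * (n - k) + k := fun r c a b c =>
    hmaps (hmem a b c)
  have z₀ : N₀ 0 = 0 := by
    by_contra hne
    have h1 := (h₀ 0 (by omega) 0).2 (by omega)
    have h2 := hpos 0 0 (by omega) (by omega) (by omega)
    dsimp only at h1
    omega
  have z₁ : N₁ 0 = 0 := by
    by_contra hne
    have h1 := (h₁ 0 (by omega) 0).2 (by omega)
    have h2 := hpos 1 0 (by omega) (by omega) (by omega)
    dsimp only at h1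
    omega
  have z₂ : N₂ 0 = 0 := by
    by_contra hne
    have h3 := hle₂ 0
    have h1 : S (2, 0) ≤ 0 := (h₂ 0 (by omega) 0).2 (by omega)
    have h2 := hpos 2 0 (by omega) (by omega) (by omega)
    omega
  -- Each label fills exactly one box, so exactly one of the three counts increases at it.
  have hsum : ∀ v ≤ 2 * (n - k) + k, N₀ v + N₁ v + N₂ v = v := by
    intro v
    induction v with
    | zero => omega
    | succ v ih =>
      intro hv
      have ih := ih (by omega)
      rw [hs₀, hs₁, hs₂]
      obtain ⟨⟨r, c⟩, hb, hbv⟩ := hsurj (show v + 1 ∈ Set.Icc 1 (2 * (n - k) + k) by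
        rw [Set.mem_Icc]; omega)
      have hb' := mem_flagShape.1 ((YoungDiagram.mem_cells _).1 hb)
      have huniq : ∀ r' c', r' < k + 2 → c' < n - k → (r' < 2 ∨ c' = 0) → S (r', c') = v + 1 →
          r' = r := by
        intro r' c' a1 a2 a3 a4
        exact congrArg Prod.fst (hinj (hmem a1 a2 a3) hb (a4.trans hbv.symm))
      have i₀ : (∃ c < n - k, S (0, c) = v + 1) ↔ r = 0 := by
        constructor
        · rintro ⟨c', h, h'⟩
          exact (huniq 0 c' (by omega) h (by omega) h').symm
        · rintro rfl
          exact ⟨c, hb'.2.1, hbv⟩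
      have i₁ : (∃ c < n - k, S (1, c) = v + 1) ↔ r = 1 := by
        constructor
        · rintro ⟨c', h, h'⟩
          exact (huniq 1 c' (by omega) h (by omega) h').symm
        · rintro rfl
          exact ⟨c, hb'.2.1, hbv⟩
      have i₂ : (∃ a < k, S (a + 2, 0) = v + 1) ↔ 2 ≤ r := by
        constructor
        · rintro ⟨c', h, h'⟩
          have := huniq (c' + 2) 0 (by omega) (by omega) (by omega) h'
          omega
        · intro hr
          obtain rfl : c = 0 := by omega
          refine ⟨r - 2, by omega, ?_⟩
          rw [Nat.sub_add_cancel hr, hbv]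
      simp only [i₀, i₁, i₂]
      split_ifs <;> omega
  refine ⟨N₀, N₁, N₂, ⟨h₀, h₁, h₂, hout⟩, ⟨?_, ?_, ?_, hsum, ?_, ?_, ?_, ?_, ?_⟩⟩
  · intro v _
    have := hs₀ v
    omega
  · intro v _
    have := hs₁ v
    omega
  · intro v _
    have := hs₂ v
    omega
  · intro v _
    by_contra hlt
    have hc : N₀ v < n - k := by
      have := hle₁ v
      omega
    have e1 := (h₁ (N₀ v) hc v).2 (by omega)
    have e2 := hcol 0 1 (N₀ v) (by omega) (mem_flagShape.2 ⟨by omega, hc, by omega⟩)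
    have e3 := (h₀ (N₀ v) hc v).1
    dsimp only at e1 e3
    omega
  · intro v _ h
    have := hle₂ v
    have e1 : S (2, 0) ≤ v := (h₂ 0 (by omega) v).2 h
    have e2 := hcol 1 2 0 (by omega) (mem_flagShape.2 ⟨by omega, by omega, by omega⟩)
    apply (h₁ 0 (by omega) v).1
    dsimp only
    omega
  · intro v hv
    have h1 := (h₀ (n - k - 1) (by omega) v).1
    have h2 := hpos 0 (n - k - 1) (by omega) (by omega) (by omega)
    have h3 := hle₀ v
    dsimp only at h1
    omega
  · intro v hv
    have h1 := (h₁ (n - k - 1) (by omega) v).1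
    have h2 := hpos 1 (n - k - 1) (by omega) (by omega) (by omega)
    have h3 := hle₁ v
    dsimp only at h1
    omega
  · intro v hv
    have h3 := hle₂ v
    rcases Nat.eq_zero_or_pos k with h | h
    · omega
    have h1 := (h₂ (k - 1) (by omega) v).1
    have h2 := hpos (k - 1 + 2) 0 (by omega) (by omega) (by omega)
    dsimp only at h1
    omega

theorem FlagBallot.syt {n k : ℕ} (hk : k < n) {N₀ N₁ N₂ : ℕ → ℕ} {S : Filling}
    (hB : FlagBallot (n - k) k N₀ N₁ N₂) (hC : Counts₃ n k S N₀ N₁ N₂) :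
    S ∈ SYT (flagShape n k) := by
  set M := 2 * (n - k) + k with hM
  have hz := hB.sum 0 (by omega)
  have t₀ := hB.top₀ M le_rfl
  have t₁ := hB.top₁ M le_rfl
  have t₂ := hB.top₂ M le_rfl
  have hle₀ : ∀ v ≤ M, N₀ v ≤ n - k := fun v hv => t₀ ▸ le_of_steps hB.mono₀ hv le_rfl
  have hle₁ : ∀ v ≤ M, N₁ v ≤ n - k := fun v hv => t₁ ▸ le_of_steps hB.mono₁ hv le_rfl
  have hle₂ : ∀ v ≤ M, N₂ v ≤ k := fun v hv => by
    have := le_of_steps hB.mono₂ hv le_rfl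
    rwa [t₂] at this
  have hs : ∀ v < M, N₀ (v + 1) ≤ N₀ v + 1 ∧ N₁ (v + 1) ≤ N₁ v + 1 ∧ N₂ (v + 1) ≤ N₂ v + 1 := by
    intro v hv
    have := hB.sum v (by omega)
    have := hB.sum (v + 1) (by omega)
    have := hB.mono₀ v hv
    have := hB.mono₁ v hv
    have := hB.mono₂ v hv
    omega
  have hlab : ∀ r c, (r, c) ∈ flagShape n k → ∃ v < M, S (r, c) = v + 1 ∧
      ((r = 0 ∧ N₀ v ≤ c ∧ c < N₀ (v + 1)) ∨ (r = 1 ∧ N₁ v ≤ c ∧ c < N₁ (v + 1)) ∨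
        (2 ≤ r ∧ c = 0 ∧ N₂ v ≤ r - 2 ∧ r - 2 < N₂ (v + 1))) := by
    intro r c hb
    rw [mem_flagShape] at hb
    obtain rfl | rfl | ⟨r, rfl⟩ : r = 0 ∨ r = 1 ∨ ∃ a, r = a + 2 := by
      rcases r with _ | _ | r <;> simp
    · have h1 := hC.row₀.pos (by omega) hb.2.1
      have h2 := (hC.row₀ c hb.2.1 M).2 (by omega)
      dsimp only at h1 h2
      have h3 : S (0, c) = S (0, c) - 1 + 1 := by omega
      exact ⟨S (0, c) - 1, by omega, h3, Or.inl ⟨rfl, hC.row₀.lt_succ hb.2.1 h3⟩⟩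
    · have h1 := hC.row₁.pos (by omega) hb.2.1
      have h2 := (hC.row₁ c hb.2.1 M).2 (by omega)
      dsimp only at h1 h2
      have h3 : S (1, c) = S (1, c) - 1 + 1 := by omega
      exact ⟨S (1, c) - 1, by omega, h3, Or.inr (Or.inl ⟨rfl, hC.row₁.lt_succ hb.2.1 h3⟩)⟩
    · have hr : r < k := by omega
      obtain rfl : c = 0 := by omega
      have h1 := hC.column.pos (by omega) hr
      have h2 := (hC.column r hr M).2 (by omega)
      dsimp only at h1 h2
      have h3 : S (r + 2, 0) = S (r + 2, 0) - 1 + 1 := by omega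
      exact ⟨S (r + 2, 0) - 1, by omega, h3,
        Or.inr (Or.inr ⟨by omega, rfl, hC.column.lt_succ hr h3⟩)⟩
  refine ⟨hC.outside, ⟨?_, ?_⟩, ?_, ?_, ?_⟩
  · intro r a b hab hb
    rw [mem_flagShape] at hb
    obtain rfl | rfl | h : r = 0 ∨ r = 1 ∨ 2 ≤ r := by omega
    · exact hC.row₀.lt (by omega) t₀ (fun v hv => (hs v hv).1) hab hb.2.1
    · exact hC.row₁.lt (by omega) t₁ (fun v hv => (hs v hv).2.1) hab hb.2.1
    · omega
  · have h01 : ∀ c < n - k, S (0, c) < S (1, c) := by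
      intro c hc
      obtain ⟨v, hv, he, hb⟩ := hlab 1 c (mem_flagShape.2 ⟨by omega, hc, by omega⟩)
      have h1 := hB.row (v + 1) (by omega)
      have h2 := hB.sum (v + 1) (by omega)
      have h3 := hB.sum v (by omega)
      have := hB.mono₀ v hv
      have := hB.mono₂ v hv
      have h4 := (hC.row₀ c hc v).2 (by omega)
      dsimp only at h4
      omega
    have h12 : 0 < k → S (1, 0) < S (2, 0) := by
      intro hk0
      obtain ⟨v, hv, he, hb⟩ := hlab 2 0 (mem_flagShape.2 ⟨by omega, by omega, by omega⟩)
      have h1 := hB.column (v + 1) (by omega) (by omega)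
      have h2 := hB.sum (v + 1) (by omega)
      have h3 := hB.sum v (by omega)
      have := hB.mono₀ v hv
      have := hB.mono₂ v hv
      have h4 := (hC.row₁ 0 (by omega) v).2 (by omega)
      dsimp only at h4
      omega
    have h22 : ∀ a b, a < b → b < k → S (a + 2, 0) < S (b + 2, 0) := fun a b hab hb =>
      hC.column.lt (by omega) t₂ (fun v hv => (hs v hv).2.2) hab hb
    have hstep : ∀ r c, (r + 1, c) ∈ flagShape n k → S (r, c) < S (r + 1, c) := by
      intro r c hb
      rw [mem_flagShape] at hb
      rcases r with _ | _ | r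
      · exact h01 c hb.2.1
      · obtain rfl : c = 0 := by omega
        exact h12 (by omega)
      · obtain rfl : c = 0 := by omega
        exact h22 r (r + 1) (by omega) (by omega)
    intro a b c hab hb
    induction b, hab using Nat.le_induction with
    | base => exact hstep a c hb
    | succ b hb' ih =>
      exact (ih ((flagShape n k).up_left_mem (by omega) le_rfl hb)).trans (hstep b c hb)
  · rintro ⟨r, c⟩ hb
    obtain ⟨v, hv, he, -⟩ := hlab r c ((YoungDiagram.mem_cells _).1 hb)
    rw [card_flagShape hk, he, Set.mem_Icc]
    omega
  -- By `sum`, only one of the three counts jumps at `v + 1`, and by one only; this fixes both the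
  -- row and the position in it.
  · rintro ⟨r, c⟩ hb ⟨r', c'⟩ hb' heq
    obtain ⟨v, hv, he, h⟩ := hlab r c ((YoungDiagram.mem_cells _).1 hb)
    obtain ⟨v', hv', he', h'⟩ := hlab r' c' ((YoungDiagram.mem_cells _).1 hb')
    obtain rfl : v = v' := by omega
    have h1 := hs v hv
    have h2 := hB.sum (v + 1) (by omega)
    have h3 := hB.sum v (by omega)
    have := hB.mono₀ v hv
    have := hB.mono₁ v hv
    have := hB.mono₂ v hv
    rw [Prod.mk.injEq]
    omega
  · intro x hx
    rw [card_flagShape hk, Set.mem_Icc] at hx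
    obtain ⟨v, rfl⟩ : ∃ v, x = v + 1 := ⟨x - 1, by omega⟩
    have h2 := hB.sum (v + 1) (by omega)
    have h3 := hB.sum v (by omega)
    have l0 := hle₀ (v + 1) hx.2
    have l1 := hle₁ (v + 1) hx.2
    have l2 := hle₂ (v + 1) hx.2
    have hmem : ∀ {r c}, r < k + 2 → c < n - k → (r < 2 ∨ c = 0) →
      (r, c) ∈ ((flagShape n k).cells : Set (ℕ × ℕ)) := fun a b c =>
      (YoungDiagram.mem_cells _).2 (mem_flagShape.2 ⟨a, b, c⟩)
    by_cases h : N₀ v < N₀ (v + 1)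
    · exact ⟨(0, N₀ v), hmem (by omega) (by omega) (by omega), hC.row₀.exists_eq h l0⟩
    by_cases h : N₁ v < N₁ (v + 1)
    · exact ⟨(1, N₁ v), hmem (by omega) (by omega) (by omega), hC.row₁.exists_eq h l1⟩
    have h : N₂ v < N₂ (v + 1) := by omega
    exact ⟨(N₂ v + 2, 0), hmem (by omega) (by omega) (by omega), hC.column.exists_eq h l2⟩

theorem SYT.maxEntry_eq {μ : YoungDiagram} {S : Filling} (hS : S ∈ SYT μ) :
    maxEntry μ S = μ.card := by
  obtain ⟨-, -, hmaps, -, hsurj⟩ := hS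
  apply le_antisymm
  · exact Finset.sup_le fun b hb => (hmaps hb).2
  · rcases Nat.eq_zero_or_pos μ.card with h | h
    · omega
    · obtain ⟨b, hb, hbM⟩ := hsurj (show μ.card ∈ Set.Icc 1 μ.card from ⟨h, le_rfl⟩)
      rw [← hbM]
      exact le_maxEntry ((YoungDiagram.mem_cells _).1 hb)


/-! ### K-promotion of two-row tableaux on counting functions -/

/-- The two counting functions agree at some label `t` with `1 ≤ t ≤ v`. -/
def Meet (R₀ R₁ : ℕ → ℕ) (v : ℕ) : Prop := ∃ t, 1 ≤ t ∧ t ≤ v ∧ R₀ t ≤ R₁ t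

/-- For some `t` with `1 ≤ t < v`, the second counting function reaches at `t + 1` the value of the
first one at `t`. -/
def Touch (R₀ R₁ : ℕ → ℕ) (v : ℕ) : Prop := ∃ t, 1 ≤ t ∧ t + 1 ≤ v ∧ R₀ t ≤ R₁ (t + 1)

theorem meet_succ {R₀ R₁ : ℕ → ℕ} {v : ℕ} :
    Meet R₀ R₁ (v + 1) ↔ Meet R₀ R₁ v ∨ R₀ (v + 1) ≤ R₁ (v + 1) := by
  constructor
  · rintro ⟨t, h1, h2, h3⟩
    rcases Nat.lt_or_ge v t with h | h
    · obtain rfl : t = v + 1 := by omega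
      exact Or.inr h3
    · exact Or.inl ⟨t, h1, h, h3⟩
  · rintro (⟨t, h1, h2, h3⟩ | h)
    · exact ⟨t, h1, by omega, h3⟩
    · exact ⟨v + 1, by omega, le_rfl, h⟩

theorem touch_one {R₀ R₁ : ℕ → ℕ} : ¬ Touch R₀ R₁ 1 := by
  rintro ⟨t, h1, h2, -⟩
  omega

theorem touch_succ {R₀ R₁ : ℕ → ℕ} {v : ℕ} (hv : 1 ≤ v) :
    Touch R₀ R₁ (v + 1) ↔ Touch R₀ R₁ v ∨ R₀ v ≤ R₁ (v + 1) := by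
  constructor
  · rintro ⟨t, h1, h2, h3⟩
    rcases Nat.lt_or_ge t v with h | h
    · exact Or.inl ⟨t, h1, by omega, h3⟩
    · obtain rfl : t = v := by omega
      exact Or.inr h3
  · rintro (⟨t, h1, h2, h3⟩ | h)
    · exact ⟨t, h1, by omega, h3⟩
    · exact ⟨v, by omega, le_rfl, h⟩

theorem Ballot.pos {n M : ℕ} {R₀ R₁ : ℕ → ℕ} (hB : Ballot n M R₀ R₁) (hn : 0 < n) : 0 < M := by
  by_contra h
  have h1 := hB.top₀ 0 (by omega)
  have h2 := hB.zero₀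
  omega

theorem Ballot.one {n M : ℕ} {R₀ R₁ : ℕ → ℕ} (hB : Ballot n M R₀ R₁) (hn : 0 < n) :
    R₀ 1 = 1 ∧ R₁ 1 = 0 := by
  have hM := hB.pos hn
  have h1 := hB.cover 0 hM
  have h2 := hB.column 0 hM
  have h3 := hB.step₀ 0 hM
  have h4 := hB.zero₀
  have h5 := hB.zero₁
  simp only [zero_add] at *
  omega

theorem Counts₂.ne_zero {n M : ℕ} {R₀ R₁ : ℕ → ℕ} {T : Filling} (hB : Ballot n M R₀ R₁)
    (hC : Counts₂ n T R₀ R₁) : ∀ b ∈ rect 2 n, T b ≠ 0 := by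
  rintro ⟨r, c⟩ hb
  rw [mem_rect] at hb
  obtain rfl | rfl : r = 0 ∨ r = 1 := by omega
  · exact hC.row₀.pos hB.zero₀ hb.2
  · exact hC.row₁.pos hB.zero₁ hb.2

theorem Counts₂.eq_one {n M : ℕ} {R₀ R₁ : ℕ → ℕ} {T : Filling} (hB : Ballot n M R₀ R₁)
    (hC : Counts₂ n T R₀ R₁) (b : ℕ × ℕ) : T b = 1 ↔ b = (0, 0) ∧ b ∈ rect 2 n := by
  obtain ⟨r, c⟩ := b
  constructor
  · intro h
    have hb : (r, c) ∈ rect 2 n := by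
      by_contra hb
      rw [hC.outside _ hb] at h
      omega
    refine ⟨?_, hb⟩
    rw [mem_rect] at hb
    have h1 := hB.one (by omega)
    have h2 := hB.zero₀
    have h3 := hB.zero₁
    obtain rfl | rfl : r = 0 ∨ r = 1 := by omega
    · have h4 := hC.row₀.lt_succ (v := 0) hb.2 h
      rw [Prod.mk.injEq]
      simp only [zero_add] at h4
      omega
    · have h4 := hC.row₁.lt_succ (v := 0) hb.2 h
      simp only [zero_add] at h4
      omega
  · rintro ⟨h, hb⟩
    rw [h, mem_rect] at hb
    have h1 := hB.one hb.2
    have h2 := hB.zero₀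
    have h3 := hC.row₀.exists_eq (v := 0) (by simp only [zero_add]; omega)
      (by simp only [zero_add]; omega)
    rw [h2] at h3
    rw [h]
    exact h3

/-- K-promotion of a tableau with two rows of equal length. In columns `≤ d` of the first row and
`≥ c` of the second row, labels move. -/
theorem kPromotion_rect {n M : ℕ} {R₀ R₁ : ℕ → ℕ} {T : Filling} (hn : 0 < n)
    (hB : Ballot n M R₀ R₁) (hC : Counts₂ n T R₀ R₁) :
    ∃ c d, c ≤ d ∧ d < n ∧ (∀ j < c, T (0, j + 1) < T (1, j)) ∧
      (∀ j < d, T (0, j + 1) ≤ T (1, j)) ∧ (c + 1 = n ∨ T (1, c) ≤ T (0, c + 1)) ∧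
      (d + 1 = n ∨ T (1, d) < T (0, d + 1)) ∧
      (∀ j < n, kPromotion (rect 2 n) T (0, j) + 1 =
        if j < d then T (0, j + 1) else if j = d then T (1, d) else T (0, j)) ∧
      (∀ j < n, kPromotion (rect 2 n) T (1, j) + 1 =
        if j < c then T (1, j) else if j + 1 < n then T (1, j + 1) else M + 1) := by
  classical
  have hpos := hC.ne_zero hB
  have h1 := hC.eq_one hB
  have hmax := (hB.inc hC).1
  -- The second row opens at the first column `c` whose lower label is at most the label to the
  -- right; the first row stops moving at the first column `d` where it is strictly smaller. A tie
  -- sends a hole both ways, so `c` and `d` may differ. The last column always ends the search.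
  have hP : ∃ c, c + 1 = n ∨ T (1, c) ≤ T (0, c + 1) := ⟨n - 1, by omega⟩
  have hQ : ∃ d, d + 1 = n ∨ T (1, d) < T (0, d + 1) := ⟨n - 1, by omega⟩
  have hc := Nat.find_spec hP
  have hd := Nat.find_spec hQ
  have hcm : ∀ j < Nat.find hP, j + 1 ≠ n ∧ T (0, j + 1) < T (1, j) := fun j hj => by
    have := Nat.find_min hP hj
    omega
  have hdm : ∀ j < Nat.find hQ, j + 1 ≠ n ∧ T (0, j + 1) ≤ T (1, j) := fun j hj => by
    have := Nat.find_min hQ hj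
    omega
  have hdn : Nat.find hQ ≤ n - 1 := Nat.find_min' hQ (by omega)
  have hcd : Nat.find hP ≤ Nat.find hQ := Nat.find_min' hP (by omega)
  have hcle : ∀ j, (j + 1 = n ∨ T (1, j) ≤ T (0, j + 1)) → Nat.find hP ≤ j := fun j hj =>
    Nat.find_min' hP hj
  generalize Nat.find hP = c at *
  generalize Nat.find hQ = d at *
  have m0 : ∀ j, j + 1 < n → minLabel (rect 2 n) T (0, j) = min (T (0, j + 1)) (T (1, j)) :=
    fun j hj => minLabel_both (mem_rect.2 ⟨by omega, hj⟩) (mem_rect.2 ⟨by omega, by omega⟩)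
  have m0' : ∀ j, j + 1 = n → minLabel (rect 2 n) T (0, j) = T (1, j) :=
    fun j hj => minLabel_below (by rw [mem_rect]; omega) (mem_rect.2 ⟨by omega, by omega⟩)
  have m1 : ∀ j, j + 1 < n → minLabel (rect 2 n) T (1, j) = T (1, j + 1) :=
    fun j hj => minLabel_right (mem_rect.2 ⟨by omega, hj⟩) (by rw [mem_rect]; omega)
  have m1' : ∀ j, j + 1 = n → minLabel (rect 2 n) T (1, j) = 0 :=
    fun j hj => minLabel_none (by rw [mem_rect]; omega) (by rw [mem_rect]; omega)
  have hole : ∀ b, IsHole (rect 2 n) T b ↔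
      b.1 = 0 ∧ b.2 ≤ d ∨ b.1 = 1 ∧ c ≤ b.2 ∧ b.2 < n := by
    intro b
    constructor
    · intro hb
      induction hb with
      | corner h => exact Or.inl ⟨rfl, Nat.zero_le _⟩
      | @slide e b _ hbe hbm ih =>
        obtain ⟨hb, hbμ⟩ := mem_seNeighbors.1 hbe
        obtain ⟨r, j⟩ := e
        dsimp only at ih hb
        rcases ih with ⟨rfl, hj⟩ | ⟨rfl, hj, hjn⟩
        · rcases hb with rfl | rfl
          · rw [mem_rect] at hbμ
            rw [m0 j hbμ.2] at hbm
            left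
            refine ⟨rfl, ?_⟩
            dsimp only
            by_contra hlt
            obtain rfl : j = d := by omega
            omega
          · rw [mem_rect] at hbμ
            right
            refine ⟨rfl, hcle j ?_, hbμ.2⟩
            by_cases hjn : j + 1 = n
            · exact Or.inl hjn
            · rw [m0 j (by omega)] at hbm
              simp only [zero_add] at hbm
              omega
        · rcases hb with rfl | rfl
          · rw [mem_rect] at hbμ
            exact Or.inr ⟨rfl, by dsimp only; omega, hbμ.2⟩
          · rw [mem_rect] at hbμ
            omega
    · have row0 : ∀ j, j ≤ d → IsHole (rect 2 n) T (0, j) := by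
        intro j
        induction j with
        | zero => exact fun _ => .corner (mem_rect.2 ⟨by omega, hn⟩)
        | succ j ih =>
          intro hj
          have := hdm j (by omega)
          refine (ih (by omega)).slide
            (mem_seNeighbors.2 ⟨Or.inl rfl, mem_rect.2 ⟨by omega, by omega⟩⟩) ?_
          rw [m0 j (by omega)]
          omega
      have row1 : ∀ j, c ≤ j → j < n → IsHole (rect 2 n) T (1, j) := by
        intro j hj
        induction j, hj using Nat.le_induction with
        | base =>
          intro hcn
          refine (row0 c hcd).slide
            (mem_seNeighbors.2 ⟨Or.inr rfl, mem_rect.2 ⟨by omega, hcn⟩⟩) ?_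
          by_cases h : c + 1 = n
          · rw [m0' c h]
          · rw [m0 c (by omega)]
            omega
        | succ j hj ih =>
          intro hjn
          refine (ih (by omega)).slide
            (mem_seNeighbors.2 ⟨Or.inl rfl, mem_rect.2 ⟨by omega, hjn⟩⟩) ?_
          rw [m1 j hjn]
      obtain ⟨r, j⟩ := b
      dsimp only
      rintro (⟨rfl, hj⟩ | ⟨rfl, hj, hjn⟩)
      · exact row0 j hj
      · exact row1 j hj hjn
  refine ⟨c, d, hcd, by omega, fun j hj => (hcm j hj).2, fun j hj => (hdm j hj).2, hc, hd, ?_, ?_⟩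
  · intro j hj
    have hp1 := hpos (1, j) (mem_rect.2 ⟨by omega, hj⟩)
    have hp2 := hpos (0, j) (mem_rect.2 ⟨by omega, hj⟩)
    by_cases hjd : j ≤ d
    · rw [kPromotion_hole hpos h1 ((hole _).2 (Or.inl ⟨rfl, hjd⟩))]
      by_cases hjn : j + 1 = n
      · obtain rfl : j = d := by omega
        rw [m0' j hjn, if_neg hp1, if_neg (lt_irrefl _), if_pos rfl]
        omega
      · have hp3 := hpos (0, j + 1) (mem_rect.2 ⟨by omega, by omega⟩)
        rw [m0 j (by omega), if_neg (by omega)]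
        split_ifs with hlt heq
        · have := hdm j hlt
          omega
        · subst heq
          omega
        · omega
    · rw [kPromotion_not_hole hpos h1 (fun h => by have := (hole _).1 h; dsimp only at this; omega)
        (mem_rect.2 ⟨by omega, hj⟩), if_neg (by omega), if_neg (by omega)]
      omega
  · intro j hj
    have hp1 := hpos (1, j) (mem_rect.2 ⟨by omega, hj⟩)
    by_cases hjc : j < c
    · rw [kPromotion_not_hole hpos h1 (fun h => by have := (hole _).1 h; dsimp only at this; omega)
        (mem_rect.2 ⟨by omega, hj⟩), if_pos hjc]
      omega
    · rw [kPromotion_hole hpos h1 ((hole _).2 (Or.inr ⟨rfl, by dsimp only; omega, hj⟩)),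
        if_neg hjc]
      by_cases hjn : j + 1 < n
      · have hp3 := hpos (1, j + 1) (mem_rect.2 ⟨by omega, hjn⟩)
        rw [m1 j hjn, if_neg hp3, if_pos hjn]
        omega
      · rw [m1' j (by omega), if_pos rfl, if_neg hjn, hmax]

open Classical in
/-- The counting function of the first row after K-promotion. -/
noncomputable def nextRow₀ (n M : ℕ) (R₀ R₁ : ℕ → ℕ) (v : ℕ) : ℕ :=
  if v < M then R₀ (v + 1) + (if Meet R₀ R₁ (v + 1) then 1 else 0) - 1 else n

open Classical in
/-- The counting function of the second row after K-promotion. -/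
noncomputable def nextRow₁ (n M : ℕ) (R₀ R₁ : ℕ → ℕ) (v : ℕ) : ℕ :=
  if v < M then R₁ (v + 1) - (if Touch R₀ R₁ (v + 1) then 1 else 0) else n

/-- Before the shift, the first row has exchanged its label `1` for `T (1, d)`, and the second row
has exchanged `T (1, c)` for `M + 1`. It remains to recognize the labels `T (1, d)` and `T (1, c)`
in the path, by `Meet` and `Touch`. -/
theorem Counts₂.kPromotion {n M : ℕ} {R₀ R₁ : ℕ → ℕ} {T : Filling} (hn : 0 < n)
    (hB : Ballot n M R₀ R₁) (hC : Counts₂ n T R₀ R₁) :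
    Counts₂ n (kPromotion (rect 2 n) T) (nextRow₀ n M R₀ R₁) (nextRow₁ n M R₀ R₁) := by
  obtain ⟨c, d, hcd, hdn, hcm, hdm, hc, hd, v0, v1⟩ := kPromotion_rect hn hB hC
  have t0 := hB.top₀ M le_rfl
  have t1 := hB.top₁ M le_rfl
  have one := hB.one hn
  have hle0 : ∀ v ≤ M, R₀ v ≤ n := fun v hv => t0 ▸ le_of_steps hB.mono₀ hv le_rfl
  have hle1 : ∀ v ≤ M, R₁ v ≤ n := fun v hv => t1 ▸ le_of_steps hB.mono₁ hv le_rfl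
  have hge0 : ∀ v ≤ M, 1 ≤ v → 1 ≤ R₀ v := fun v hv h => one.1 ▸ le_of_steps hB.mono₀ h hv
  have r0 : ∀ c < n, ∀ v, T (0, c) ≤ v ↔ c < R₀ v := hC.row₀
  have r1 : ∀ c < n, ∀ v, T (1, c) ≤ v ↔ c < R₁ v := hC.row₁
  have b0 : ∀ c < n, T (0, c) ≤ M := fun c hc => (r0 c hc M).2 (by omega)
  have b1 : ∀ c < n, T (1, c) ≤ M := fun c hc => (r1 c hc M).2 (by omega)
  have p1 : ∀ c < n, 1 ≤ T (1, c) := fun c hc => by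
    have := hC.row₁.pos hB.zero₁ hc
    omega
  have lt0 : ∀ a b, a < b → b < n → T (0, a) < T (0, b) := fun a b =>
    hC.row₀.lt hB.zero₀ t0 hB.step₀
  have lt1 : ∀ a b, a < b → b < n → T (1, a) < T (1, b) := fun a b =>
    hC.row₁.lt hB.zero₁ t1 hB.step₁
  -- `T (1, d)` is the first `t ≥ 1` with `R₀ t ≤ R₁ t`: for `j < d` the label `T (0, j + 1)` comes
  -- no later than `T (1, j)`, which keeps the first row ahead.
  have meet : ∀ v ≤ M, Meet R₀ R₁ v ↔ T (1, d) ≤ v := by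
    intro v hv
    constructor
    · rintro ⟨t, ht, htv, h⟩
      have h1 := hge0 t (by omega) ht
      have h2 := hle1 t (by omega)
      obtain ⟨e, he⟩ : ∃ e, R₁ t = e + 1 := ⟨R₁ t - 1, by omega⟩
      have h3 := (r1 e (by omega) t).2 (by omega)
      have hde : d ≤ e := by
        by_contra hlt
        have h4 := hdm e (by omega)
        have h5 := (r0 (e + 1) (by omega) t).1 (by omega)
        omega
      have := (r1 d hdn t).2 (by omega)
      omega
    · intro h
      have h1 := (r1 d hdn _).1 le_rfl
      refine ⟨T (1, d), p1 d hdn, h, ?_⟩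
      have h2 := hle0 _ (b1 d hdn)
      rcases hd with hd | hd
      · omega
      · by_contra hlt
        have := (r0 (d + 1) (by omega) (T (1, d))).2 (by omega)
        omega
  -- Likewise `T (1, c) = t + 1` for the first `t ≥ 1` with `R₀ t ≤ R₁ (t + 1)`; the shift by one
  -- turns the weak comparison into the strict one.
  have touch : ∀ v ≤ M, Touch R₀ R₁ v ↔ T (1, c) ≤ v := by
    intro v hv
    constructor
    · rintro ⟨t, ht, htv, h⟩
      have h1 := hge0 t (by omega) ht
      have h2 := hle1 (t + 1) (by omega)
      obtain ⟨e, he⟩ : ∃ e, R₁ (t + 1) = e + 1 := ⟨R₁ (t + 1) - 1, by omega⟩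
      have h3 := (r1 e (by omega) (t + 1)).2 (by omega)
      have hde : c ≤ e := by
        by_contra hlt
        have h4 := hcm e (by omega)
        have h5 := (r0 (e + 1) (by omega) t).1 (by omega)
        omega
      have := (r1 c (by omega) (t + 1)).2 (by omega)
      omega
    · intro h
      have hcn : c < n := by omega
      have h1 := (r1 c hcn _).1 le_rfl
      have h6 := (r1 c hcn 1).1
      obtain ⟨t, ht⟩ : ∃ t, T (1, c) = t + 1 := ⟨T (1, c) - 1, by have := p1 c hcn; omega⟩
      rw [ht] at h1
      refine ⟨t, by omega, by omega, ?_⟩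
      have h2 := hle0 t (by omega)
      rcases hc with hc | hc
      · omega
      · by_contra hlt
        have := (r0 (c + 1) (by omega) t).2 (by omega)
        omega
  refine ⟨?_, ?_, fun b hb => kPromotion_not_mem hb⟩
  · intro j hj v
    have e := v0 j hj
    dsimp only
    unfold nextRow₀
    split_ifs with hv hm
    · rw [meet _ hv] at hm
      have h0 := r0 j hj (v + 1)
      have h2 := r0 d hdn (v + 1)
      have hge := hge0 (v + 1) hv (by omega)
      have h3 := hle0 (v + 1) hv
      split_ifs at e with e1 e2
      · have h1 := r0 (j + 1) (by omega) (v + 1)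
        have h4 : T (0, d) ≤ T (1, d) := by
          have hd1 := r0 (d - 1 + 1) (by omega) (v + 1)
          have hd2 := r1 (d - 1) (by omega) (v + 1)
          have hd3 := hdm (d - 1) (by omega)
          have hd4 := lt1 (d - 1) d (by omega) hdn
          rw [show d - 1 + 1 = d by omega] at hd3
          omega
        omega
      · subst e2
        rcases Nat.eq_zero_or_pos j with rfl | hj0
        · omega
        · have hd3 := hdm (j - 1) (by omega)
          have hd4 := lt1 (j - 1) j (by omega) hdn
          rw [show j - 1 + 1 = j by omega] at hd3
          omega
      · rcases hd with hd | hd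
        · omega
        · have h6 := r0 (d + 1) (by omega) (v + 1)
          omega
    · rw [meet _ hv] at hm
      have h0 := r0 j hj (v + 1)
      have hge := hge0 (v + 1) hv (by omega)
      have h3 := hle0 (v + 1) hv
      split_ifs at e with e1 e2
      · have h1 := r0 (j + 1) (by omega) (v + 1)
        omega
      · subst e2
        by_cases hjn : j + 1 = n
        · omega
        · have h6 := r0 (j + 1) (by omega) (v + 1)
          omega
      · rcases hd with hd | hd
        · omega
        · have h6 := r0 (d + 1) (by omega) (v + 1)
          omega
    · have h0 := b0 j hj
      have h1 := b1 d hdn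
      split_ifs at e with e1 e2
      · have := b0 (j + 1) (by omega)
        omega
      · omega
      · omega
  · intro j hj v
    have e := v1 j hj
    dsimp only
    unfold nextRow₁
    split_ifs with hv hm
    · rw [touch _ hv] at hm
      have h0 := r1 j hj (v + 1)
      have h2 := r1 c (by omega) (v + 1)
      have h3 := hle1 (v + 1) hv
      split_ifs at e with e1 e2
      · omega
      · have h1 := r1 (j + 1) (by omega) (v + 1)
        omega
      · omega
    · rw [touch _ hv] at hm
      have h0 := r1 j hj (v + 1)
      have h2 := r1 c (by omega) (v + 1)
      split_ifs at e with e1 e2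
      · omega
      · have h1 := r1 (j + 1) (by omega) (v + 1)
        have h4 := lt1 j (j + 1) (by omega) e2
        omega
      · omega
    · split_ifs at e with e1 e2
      · have := b1 j hj
        omega
      · have := b1 (j + 1) e2
        omega
      · omega

/-- Each indicator switches on once. `Meet` does so at a label of the second row alone, where `R₀`
stands still, so the first row still grows by at most one. `Touch` does so at a label of the second
row, whose jump it cancels; if that label is not in the first row as well, `Meet` switches on there
too, so the label is still covered. -/
theorem Ballot.next {n M : ℕ} {R₀ R₁ : ℕ → ℕ} (hn : 0 < n) (hB : Ballot n M R₀ R₁) :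
    Ballot n M (nextRow₀ n M R₀ R₁) (nextRow₁ n M R₀ R₁) := by
  have hM := hB.pos hn
  have one := hB.one hn
  have z0 := hB.zero₀
  have z1 := hB.zero₁
  have t0 := hB.top₀ M le_rfl
  have t1 := hB.top₁ M le_rfl
  have hle0 : ∀ v ≤ M, R₀ v ≤ n := fun v hv => t0 ▸ le_of_steps hB.mono₀ hv le_rfl
  have hge0 : ∀ v ≤ M, 1 ≤ v → 1 ≤ R₀ v := fun v hv h => one.1 ▸ le_of_steps hB.mono₀ h hv
  have meetM : Meet R₀ R₁ M := ⟨M, hM, le_rfl, by omega⟩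
  have tpos : ∀ v ≤ M, Touch R₀ R₁ v → 1 ≤ R₁ v := by
    rintro v hv ⟨t, h1, h2, h3⟩
    have := hge0 t (by omega) h1
    have := le_of_steps hB.mono₁ h2 hv
    omega
  have touchM : Touch R₀ R₁ M := by
    have : M ≠ 1 := by
      rintro rfl
      omega
    refine ⟨M - 1, by omega, by omega, ?_⟩
    rw [show M - 1 + 1 = M by omega]
    have := hle0 (M - 1) (by omega)
    omega
  have touch1 : ¬ Touch R₀ R₁ 1 := touch_one
  have meet1 : ¬ Meet R₀ R₁ 1 := by
    rintro ⟨t, h1, h2, h3⟩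
    obtain rfl : t = 1 := by omega
    omega
  have meet_touch : ∀ v ≤ M, Meet R₀ R₁ v → Touch R₀ R₁ v := by
    rintro v hv ⟨t, h1, h2, h3⟩
    obtain ⟨u, rfl⟩ : ∃ u, t = u + 1 := ⟨t - 1, by omega⟩
    have hu : u ≠ 0 := by
      rintro rfl
      simp only [zero_add] at h3
      omega
    have := hB.mono₀ u (by omega)
    exact ⟨u, by omega, h2, by omega⟩
  have key : ∀ v < M, nextRow₀ n M R₀ R₁ v ≤ nextRow₀ n M R₀ R₁ (v + 1) ∧
      nextRow₀ n M R₀ R₁ (v + 1) ≤ nextRow₀ n M R₀ R₁ v + 1 ∧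
      nextRow₁ n M R₀ R₁ v ≤ nextRow₁ n M R₀ R₁ (v + 1) ∧
      nextRow₁ n M R₀ R₁ (v + 1) ≤ nextRow₁ n M R₀ R₁ v + 1 ∧
      nextRow₀ n M R₀ R₁ v + nextRow₁ n M R₀ R₁ v <
        nextRow₀ n M R₀ R₁ (v + 1) + nextRow₁ n M R₀ R₁ (v + 1) ∧
      nextRow₁ n M R₀ R₁ (v + 1) ≤ nextRow₀ n M R₀ R₁ v := by
    intro v hv
    by_cases hv' : v + 1 < M
    · simp only [nextRow₀, nextRow₁, if_pos hv, if_pos hv']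
      have a1 := hB.mono₀ (v + 1) hv'
      have a2 := hB.mono₁ (v + 1) hv'
      have a3 := hB.step₀ (v + 1) hv'
      have a4 := hB.step₁ (v + 1) hv'
      have a5 := hB.cover (v + 1) hv'
      have a6 := hB.column (v + 1) hv'
      have a7 := hB.column v hv
      have a8 := hge0 (v + 1) hv (by omega)
      have a9 := tpos (v + 1) hv
      have a10 := tpos (v + 1 + 1) hv'
      have a11 := meet_touch (v + 1) hv
      have s1 := meet_succ (R₀ := R₀) (R₁ := R₁) (v := v + 1)
      have s2 := touch_succ (R₀ := R₀) (R₁ := R₁) (v := v + 1) (by omega)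
      have s3 : ¬ Meet R₀ R₁ (v + 1) → R₁ (v + 1) < R₀ (v + 1) := fun h => by
        by_contra hlt
        exact h ⟨v + 1, by omega, le_rfl, by omega⟩
      by_cases m : Meet R₀ R₁ (v + 1) <;> by_cases m' : Meet R₀ R₁ (v + 1 + 1) <;>
        by_cases t : Touch R₀ R₁ (v + 1) <;> by_cases t' : Touch R₀ R₁ (v + 1 + 1) <;>
        simp only [m, m', t, t', if_true, if_false, true_or, false_or, iff_true, not_le,
          true_iff, false_iff, not_true_eq_false, not_false_eq_true, forall_const, imp_false] at * <;>
        omega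
    · obtain rfl : M = v + 1 := by omega
      simp only [nextRow₀, nextRow₁, if_pos hv, if_neg hv', if_pos meetM, if_pos touchM]
      omega
  refine ⟨?_, ?_, fun v hv => (key v hv).1, fun v hv => (key v hv).2.1,
    fun v hv => (key v hv).2.2.1, fun v hv => (key v hv).2.2.2.1,
    fun v hv => (key v hv).2.2.2.2.1, fun v hv => (key v hv).2.2.2.2.2, ?_, ?_⟩
  · simp only [nextRow₀, if_pos hM, zero_add, if_neg meet1]
    omega
  · simp only [nextRow₁, if_pos hM, zero_add, if_neg touch1]
    omega
  · intro v hv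
    rw [nextRow₀, if_neg (by omega)]
  · intro v hv
    rw [nextRow₁, if_neg (by omega)]


/-! ### Promotion of flag-shaped standard tableaux on counting functions -/

theorem FlagBallot.zero {m k : ℕ} {N₀ N₁ N₂ : ℕ → ℕ} (hB : FlagBallot m k N₀ N₁ N₂) :
    N₀ 0 = 0 ∧ N₁ 0 = 0 ∧ N₂ 0 = 0 := by
  have := hB.sum 0 (by omega)
  omega

theorem FlagBallot.one {m k : ℕ} {N₀ N₁ N₂ : ℕ → ℕ} (hm : 0 < m)
    (hB : FlagBallot m k N₀ N₁ N₂) : N₀ 1 = 1 ∧ N₁ 1 = 0 ∧ N₂ 1 = 0 := by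
  have h1 := hB.sum 1 (by omega)
  have h2 := hB.row 1 (by omega)
  have h3 := hB.column 1 (by omega)
  omega

theorem FlagBallot.succ {m k : ℕ} {N₀ N₁ N₂ : ℕ → ℕ} (hB : FlagBallot m k N₀ N₁ N₂) {v : ℕ}
    (hv : v < 2 * m + k) :
    (N₀ (v + 1) = N₀ v + 1 ∧ N₁ (v + 1) = N₁ v ∧ N₂ (v + 1) = N₂ v) ∨
    (N₀ (v + 1) = N₀ v ∧ N₁ (v + 1) = N₁ v + 1 ∧ N₂ (v + 1) = N₂ v) ∨
    (N₀ (v + 1) = N₀ v ∧ N₁ (v + 1) = N₁ v ∧ N₂ (v + 1) = N₂ v + 1) := by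
  have h1 := hB.sum v (by omega)
  have h2 := hB.sum (v + 1) (by omega)
  have h3 := hB.mono₀ v hv
  have h4 := hB.mono₁ v hv
  have h5 := hB.mono₂ v hv
  omega

theorem Counts₃.ne_zero {n k : ℕ} {N₀ N₁ N₂ : ℕ → ℕ} {S : Filling}
    (hB : FlagBallot (n - k) k N₀ N₁ N₂) (hC : Counts₃ n k S N₀ N₁ N₂) :
    ∀ b ∈ flagShape n k, S b ≠ 0 := by
  rintro ⟨r, c⟩ hb
  rw [mem_flagShape] at hb
  obtain ⟨z0, z1, z2⟩ := hB.zero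
  obtain rfl | rfl | ⟨r, rfl⟩ : r = 0 ∨ r = 1 ∨ ∃ a, r = a + 2 := by
    rcases r with _ | _ | r <;> simp
  · exact hC.row₀.pos z0 hb.2.1
  · exact hC.row₁.pos z1 hb.2.1
  · obtain rfl : c = 0 := by omega
    exact hC.column.pos z2 (c := r) (by omega)

theorem Counts₃.eq_one {n k : ℕ} {N₀ N₁ N₂ : ℕ → ℕ} {S : Filling}
    (hB : FlagBallot (n - k) k N₀ N₁ N₂) (hC : Counts₃ n k S N₀ N₁ N₂) (b : ℕ × ℕ) :
    S b = 1 ↔ b = (0, 0) ∧ b ∈ flagShape n k := by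
  obtain ⟨r, c⟩ := b
  obtain ⟨z0, z1, z2⟩ := hB.zero
  constructor
  · intro h
    have hb : (r, c) ∈ flagShape n k := by
      by_contra hb
      rw [hC.outside _ hb] at h
      omega
    refine ⟨?_, hb⟩
    rw [mem_flagShape] at hb
    have h1 := hB.one (by omega)
    obtain rfl | rfl | ⟨r, rfl⟩ : r = 0 ∨ r = 1 ∨ ∃ a, r = a + 2 := by
      rcases r with _ | _ | r <;> simp
    · have h4 := hC.row₀.lt_succ (v := 0) hb.2.1 h
      rw [Prod.mk.injEq]
      simp only [zero_add] at h4
      omega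
    · have h4 := hC.row₁.lt_succ (v := 0) hb.2.1 h
      simp only [zero_add] at h4
      omega
    · obtain rfl : c = 0 := by omega
      have h4 := hC.column.lt_succ (v := 0) (c := r) (by omega) h
      simp only [zero_add] at h4
      omega
  · rintro ⟨h, hb⟩
    rw [h, mem_flagShape] at hb
    have h1 := hB.one hb.2.1
    have h3 := hC.row₀.exists_eq (v := 0) (by simp only [zero_add]; omega)
      (by simp only [zero_add]; omega)
    rw [z0] at h3
    rw [h]
    exact h3

/-- Promotion of a standard tableau of flag shape. Either the hole leaves the first row in column
`d` and moves to the end of the second row, or it moves down the first column. -/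
theorem kPromotion_flag {n k : ℕ} {N₀ N₁ N₂ : ℕ → ℕ} {S : Filling} (hk : k < n)
    (hB : FlagBallot (n - k) k N₀ N₁ N₂) (hC : Counts₃ n k S N₀ N₁ N₂) :
    ∃ d < n - k, (∀ j < d, S (0, j + 1) ≤ S (1, j)) ∧
      (d + 1 = n - k ∨ S (1, d) < S (0, d + 1)) ∧
      (∀ j < n - k, kPromotion (flagShape n k) S (0, j) + 1 =
        if j < d then S (0, j + 1) else if j = d then S (1, d) else S (0, j)) ∧
      (((0 < d ∨ k = 0 ∨ (1 < n - k ∧ S (1, 1) < S (2, 0))) ∧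
        (∀ j < n - k, kPromotion (flagShape n k) S (1, j) + 1 =
          if j < d then S (1, j) else if j + 1 < n - k then S (1, j + 1)
          else 2 * (n - k) + k + 1) ∧
        (∀ r < k, kPromotion (flagShape n k) S (r + 2, 0) + 1 = S (r + 2, 0))) ∨
       ((d = 0 ∧ 0 < k ∧ (1 < n - k → S (2, 0) < S (1, 1))) ∧
        (∀ j < n - k, kPromotion (flagShape n k) S (1, j) + 1 =
          if j = 0 then S (2, 0) else S (1, j)) ∧
        (∀ r < k, kPromotion (flagShape n k) S (r + 2, 0) + 1 =
          if r + 1 < k then S (r + 3, 0) else 2 * (n - k) + k + 1))) := by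
  classical
  have hpos := hC.ne_zero hB
  have h1 := hC.eq_one hB
  have hS := hB.syt hk hC
  have hmax := SYT.maxEntry_eq hS
  rw [card_flagShape hk] at hmax
  have hinj : ∀ a ∈ flagShape n k, ∀ b ∈ flagShape n k, S a = S b → a = b := fun a ha b hb =>
    hS.2.2.2.1 ((YoungDiagram.mem_cells _).2 ha) ((YoungDiagram.mem_cells _).2 hb)
  set μ := flagShape n k with hμ
  have mem : ∀ {r c}, (r, c) ∈ μ ↔ r < k + 2 ∧ c < n - k ∧ (r < 2 ∨ c = 0) := mem_flagShape
  generalize hm : n - k = m at *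
  have hm0 : 0 < m := by omega
  have hne01 : ∀ j, j + 1 < m → S (0, j + 1) ≠ S (1, j) := by
    intro j hj h
    have := hinj _ (mem.2 ⟨by omega, hj, by omega⟩) _ (mem.2 ⟨by omega, by omega, by omega⟩) h
    simp at this
  have hne12 : 1 < m → 0 < k → S (1, 1) ≠ S (2, 0) := by
    intro hj hk h
    have := hinj _ (mem.2 ⟨by omega, hj, by omega⟩) _ (mem.2 ⟨by omega, by omega, by omega⟩) h
    simp at this
  have hQ : ∃ d, d + 1 = m ∨ S (1, d) < S (0, d + 1) := ⟨m - 1, by omega⟩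
  have hd := Nat.find_spec hQ
  have hdn : Nat.find hQ ≤ m - 1 := Nat.find_min' hQ (by omega)
  have hdm : ∀ j < Nat.find hQ, S (0, j + 1) < S (1, j) := fun j hj => by
    have := Nat.find_min hQ hj
    have := hne01 j (by omega)
    omega
  generalize Nat.find hQ = d at *
  have m0 : ∀ j, j + 1 < m → minLabel μ S (0, j) = min (S (0, j + 1)) (S (1, j)) :=
    fun j hj => minLabel_both (mem.2 ⟨by omega, hj, by omega⟩) (mem.2 ⟨by omega, by omega, by omega⟩)
  have m0' : ∀ j, j + 1 = m → minLabel μ S (0, j) = S (1, j) :=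
    fun j hj => minLabel_below (by rw [mem]; omega) (mem.2 ⟨by omega, by omega, by omega⟩)
  have md : minLabel μ S (0, d) = S (1, d) := by
    by_cases h : d + 1 = m
    · exact m0' d h
    · rw [m0 d (by omega)]
      omega
  have m1 : ∀ j, j + 1 < m → (0 < j ∨ k = 0) → minLabel μ S (1, j) = S (1, j + 1) :=
    fun j hj h => minLabel_right (mem.2 ⟨by omega, hj, by omega⟩) (by rw [mem]; omega)
  have m1' : ∀ j, j + 1 = m → (0 < j ∨ k = 0) → minLabel μ S (1, j) = 0 :=
    fun j hj h => minLabel_none (by rw [mem]; omega) (by rw [mem]; omega)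
  have m10 : 1 < m → 0 < k → minLabel μ S (1, 0) = min (S (1, 1)) (S (2, 0)) := fun h h' =>
    minLabel_both (mem.2 ⟨by omega, by omega, by omega⟩) (mem.2 ⟨by omega, by omega, by omega⟩)
  have m10' : m = 1 → 0 < k → minLabel μ S (1, 0) = S (2, 0) := fun h h' =>
    minLabel_below (by rw [mem]; omega) (mem.2 ⟨by omega, by omega, by omega⟩)
  have m2 : ∀ r, r + 1 < k → minLabel μ S (r + 2, 0) = S (r + 3, 0) := fun r hr =>
    minLabel_below (by rw [mem]; omega) (mem.2 ⟨by omega, by omega, by omega⟩)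
  have m2' : ∀ r, r + 1 = k → minLabel μ S (r + 2, 0) = 0 := fun r hr =>
    minLabel_none (by rw [mem]; omega) (by rw [mem]; omega)
  have row0 : ∀ j, j ≤ d → IsHole μ S (0, j) := by
    intro j
    induction j with
    | zero => exact fun _ => .corner (mem.2 ⟨by omega, by omega, by omega⟩)
    | succ j ih =>
      intro hj
      have := hdm j (by omega)
      refine (ih (by omega)).slide
        (mem_seNeighbors.2 ⟨Or.inl rfl, mem.2 ⟨by omega, by omega, by omega⟩⟩) ?_
      rw [m0 j (by omega)]
      omega
  have hole1d : IsHole μ S (1, d) := by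
    refine (row0 d le_rfl).slide
      (mem_seNeighbors.2 ⟨Or.inr rfl, mem.2 ⟨by omega, by omega, by omega⟩⟩) ?_
    rw [md]
  have hole0 : ∀ b, IsHole μ S b → (b.1 = 0 → b.2 ≤ d) ∧ (b.1 = 1 → d ≤ b.2) := by
    intro b hb
    induction hb with
    | corner h => simp
    | @slide e b _ hbe hbm ih =>
      obtain ⟨hb, hbμ⟩ := mem_seNeighbors.1 hbe
      obtain ⟨r, j⟩ := e
      dsimp only at ih hb
      rcases hb with rfl | rfl
      · rw [mem] at hbμ
        dsimp only
        refine ⟨fun hr => ?_, fun hr => by have := ih.2 hr; omega⟩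
        subst hr
        rw [m0 j hbμ.2.1] at hbm
        have := ih.1 rfl
        by_contra hlt
        obtain rfl : j = d := by omega
        omega
      · rw [mem] at hbμ
        dsimp only
        refine ⟨fun hr => by omega, fun hr => ?_⟩
        obtain rfl : r = 0 := by omega
        have := ih.1 rfl
        by_contra hlt
        have h2 := hdm j (by omega)
        rw [m0 j (by omega)] at hbm
        simp only [zero_add] at hbm
        omega
  have val0 : ∀ j < m, kPromotion μ S (0, j) + 1 =
      if j < d then S (0, j + 1) else if j = d then S (1, d) else S (0, j) := by
    intro j hj
    have hp1 := hpos (1, j) (mem.2 ⟨by omega, hj, by omega⟩)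
    have hp2 := hpos (0, j) (mem.2 ⟨by omega, hj, by omega⟩)
    by_cases hjd : j ≤ d
    · rw [kPromotion_hole hpos h1 (row0 j hjd)]
      by_cases hjd' : j = d
      · subst hjd'
        rw [md, if_neg hp1, if_neg (lt_irrefl _), if_pos rfl]
        omega
      · have hp3 := hpos (0, j + 1) (mem.2 ⟨by omega, by omega, by omega⟩)
        have := hdm j (by omega)
        rw [m0 j (by omega), if_neg (by omega), if_pos (by omega)]
        omega
    · rw [kPromotion_not_hole hpos h1 (fun h => by have := (hole0 _ h).1 rfl; omega)
        (mem.2 ⟨by omega, hj, by omega⟩), if_neg (by omega), if_neg (by omega)]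
      omega
  refine ⟨d, by omega, fun j hj => (hdm j hj).le, hd, val0, ?_⟩
  -- A hole entering the second row right of column `0` can only move right. In column `0`, the
  -- smaller of `S (1, 1)` and `S (2, 0)` decides, as far as these boxes exist.
  by_cases hA : 0 < d ∨ k = 0 ∨ (1 < m ∧ S (1, 1) < S (2, 0))
  · left
    have hole2 : ∀ b, IsHole μ S b → b.1 < 2 := by
      intro b hb
      induction hb with
      | corner h => simp
      | @slide e b he hbe hbm ih =>
        obtain ⟨hb, hbμ⟩ := mem_seNeighbors.1 hbe
        have h0 := hole0 e he
        obtain ⟨r, j⟩ := e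
        dsimp only at ih hb h0
        rcases hb with rfl | rfl
        · exact ih
        · rw [mem] at hbμ
          dsimp only
          by_contra hlt
          obtain rfl : r = 1 := by omega
          obtain rfl : j = 0 := by omega
          have := h0.2 rfl
          rw [m10 (by omega) (by omega)] at hbm
          simp only [Nat.reduceAdd] at hbm
          omega
    have mR : ∀ j, d ≤ j → j + 1 < m → minLabel μ S (1, j) = S (1, j + 1) := by
      intro j hj hjm
      by_cases h : 0 < j ∨ k = 0
      · exact m1 j hjm h
      · obtain rfl : j = 0 := by omega
        rw [m10 (by omega) (by omega), zero_add]
        omega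
    have row1 : ∀ j, d ≤ j → j < m → IsHole μ S (1, j) := by
      intro j hj
      induction j, hj using Nat.le_induction with
      | base => exact fun _ => hole1d
      | succ j hj ih =>
        intro hjn
        refine (ih (by omega)).slide
          (mem_seNeighbors.2 ⟨Or.inl rfl, mem.2 ⟨by omega, hjn, by omega⟩⟩) ?_
        rw [mR j hj hjn]
    refine ⟨hA, ?_, ?_⟩
    · intro j hj
      have hp1 := hpos (1, j) (mem.2 ⟨by omega, hj, by omega⟩)
      by_cases hjc : j < d
      · rw [kPromotion_not_hole hpos h1 (fun h => by have := (hole0 _ h).2 rfl; omega)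
          (mem.2 ⟨by omega, hj, by omega⟩), if_pos hjc]
        omega
      · rw [kPromotion_hole hpos h1 (row1 j (by omega) hj), if_neg hjc]
        by_cases hjn : j + 1 < m
        · have hp3 := hpos (1, j + 1) (mem.2 ⟨by omega, hjn, by omega⟩)
          rw [mR j (by omega) hjn, if_neg hp3, if_pos hjn]
          omega
        · rw [m1' j (by omega) (by omega), if_pos rfl, if_neg hjn, hmax]
    · intro r hr
      have hb : (r + 2, 0) ∈ μ := mem.2 ⟨by omega, by omega, by omega⟩
      have hp := hpos _ hb
      rw [kPromotion_not_hole hpos h1 (fun h => by have := hole2 _ h; dsimp only at this; omega) hb]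
      omega
  · right
    obtain rfl : d = 0 := by omega
    have hk0 : 0 < k := by omega
    have hlt : 1 < m → S (2, 0) < S (1, 1) := fun h => by
      have := hne12 h hk0
      omega
    have m10A : minLabel μ S (1, 0) = S (2, 0) := by
      by_cases h : m = 1
      · exact m10' h hk0
      · rw [m10 (by omega) hk0]
        have := hlt (by omega)
        omega
    have hole2 : ∀ b, IsHole μ S b → b.2 = 0 := by
      intro b hb
      induction hb with
      | corner h => rfl
      | @slide e b he hbe hbm ih =>
        obtain ⟨hb, hbμ⟩ := mem_seNeighbors.1 hbe
        have h0 := hole0 e he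
        obtain ⟨r, j⟩ := e
        dsimp only at ih hb h0
        subst ih
        rcases hb with rfl | rfl
        · rw [mem] at hbμ
          exfalso
          obtain rfl | rfl : r = 0 ∨ r = 1 := by omega
          · rw [md] at hbm
            have := hne01 0 (by omega)
            omega
          · rw [m10A] at hbm
            have := hlt (by omega)
            simp only [zero_add] at hbm
            omega
        · rfl
    have col : ∀ r < k, IsHole μ S (r + 2, 0) := by
      intro r
      induction r with
      | zero =>
        intro _
        refine hole1d.slide
          (mem_seNeighbors.2 ⟨Or.inr rfl, mem.2 ⟨by omega, by omega, by omega⟩⟩) ?_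
        rw [m10A]
      | succ r ih =>
        intro hr
        refine (ih (by omega)).slide
          (mem_seNeighbors.2 ⟨Or.inr rfl, mem.2 ⟨by omega, by omega, by omega⟩⟩) ?_
        rw [m2 r (by omega)]
    refine ⟨⟨rfl, hk0, hlt⟩, ?_, ?_⟩
    · intro j hj
      have hp1 := hpos (1, j) (mem.2 ⟨by omega, hj, by omega⟩)
      by_cases hj0 : j = 0
      · subst hj0
        have hp2 := hpos (2, 0) (mem.2 ⟨by omega, by omega, by omega⟩)
        rw [kPromotion_hole hpos h1 hole1d, m10A, if_neg hp2, if_pos rfl]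
        omega
      · rw [kPromotion_not_hole hpos h1 (fun h => hj0 (hole2 _ h))
          (mem.2 ⟨by omega, hj, by omega⟩), if_neg hj0]
        omega
    · intro r hr
      rw [kPromotion_hole hpos h1 (col r hr)]
      by_cases hr1 : r + 1 < k
      · have hp := hpos (r + 3, 0) (mem.2 ⟨by omega, by omega, by omega⟩)
        rw [m2 r hr1, if_neg hp, if_pos hr1]
        omega
      · rw [m2' r (by omega), if_pos rfl, if_neg hr1, hmax]

/-- The label `2` is in the second row, and the third row has a label `≤ v` that is smaller than
the second label of the second row. -/
def Climb (N₁ N₂ : ℕ → ℕ) (v : ℕ) : Prop := N₁ 2 = 1 ∧ ∃ t ≤ v, 1 ≤ N₂ t ∧ N₁ t ≤ 1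

theorem climb_succ {N₁ N₂ : ℕ → ℕ} {v : ℕ} :
    Climb N₁ N₂ (v + 1) ↔ Climb N₁ N₂ v ∨ (N₁ 2 = 1 ∧ 1 ≤ N₂ (v + 1) ∧ N₁ (v + 1) ≤ 1) := by
  constructor
  · rintro ⟨h0, t, h1, h2, h3⟩
    rcases Nat.lt_or_ge v t with h | h
    · obtain rfl : t = v + 1 := by omega
      exact Or.inr ⟨h0, h2, h3⟩
    · exact Or.inl ⟨h0, t, h, h2, h3⟩
  · rintro (⟨h0, t, h1, h2, h3⟩ | ⟨h0, h2, h3⟩)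
    · exact ⟨h0, t, by omega, h2, h3⟩
    · exact ⟨h0, v + 1, le_rfl, h2, h3⟩

open Classical in
/-- The counting function of the second row after promotion. -/
noncomputable def nextFlag₁ (m k : ℕ) (N₀ N₁ N₂ : ℕ → ℕ) (v : ℕ) : ℕ :=
  if v < 2 * m + k then N₁ (v + 1) + (if Climb N₁ N₂ (v + 1) then 1 else 0) -
    (if Meet N₀ N₁ (v + 1) then 1 else 0) else m

open Classical in
/-- The counting function of the rows below the second one after promotion. -/
noncomputable def nextFlag₂ (m k : ℕ) (N₁ N₂ : ℕ → ℕ) (v : ℕ) : ℕ :=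
  if v < 2 * m + k then N₂ (v + 1) - (if Climb N₁ N₂ (v + 1) then 1 else 0) else k

/-- With `N₁ 2 = 1`, the conditions `sum` and `row` force `N₀ 2 = 1`, so the counts meet at `2`. -/
theorem FlagBallot.meet_two {m k : ℕ} {N₀ N₁ N₂ : ℕ → ℕ} (hm : 0 < m)
    (hB : FlagBallot m k N₀ N₁ N₂) {v : ℕ} (h : N₁ 2 = 1) (hv : 2 ≤ v) : Meet N₀ N₁ v := by
  have h1 := hB.sum 2 (by omega)
  have h2 := hB.row 2 (by omega)
  exact ⟨2, by omega, hv, by omega⟩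

theorem FlagBallot.climb_ge {m k : ℕ} {N₀ N₁ N₂ : ℕ → ℕ} (hm : 0 < m)
    (hB : FlagBallot m k N₀ N₁ N₂) {v : ℕ} (hv : v ≤ 2 * m + k) (h : Climb N₁ N₂ v) :
    2 ≤ v ∧ 1 ≤ N₂ v ∧ 1 ≤ N₁ v := by
  obtain ⟨h0, t, h1, h2, h3⟩ := h
  have one := hB.one hm
  have zero := hB.zero
  have h4 := le_of_steps hB.mono₂ h1 hv
  have h5 := hB.column v hv (by omega)
  refine ⟨?_, by omega, h5⟩
  by_contra hlt
  obtain rfl | rfl : v = 0 ∨ v = 1 := by omega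
  · omega
  · omega

/-- The first row exchanges `1` for `S (1, d)`, as in the rectangle, and the second row loses `S (1,
d)`. What it gains is either the new largest label or, if the hole descends, the label `S (2, 0)`,
in which case the column gains the largest label. `Climb` indicates that `S (2, 0)` has moved up. -/
theorem Counts₃.kPromotion {n k : ℕ} {N₀ N₁ N₂ : ℕ → ℕ} {S : Filling} (hk : k < n)
    (hB : FlagBallot (n - k) k N₀ N₁ N₂) (hC : Counts₃ n k S N₀ N₁ N₂) :
    Counts₃ n k (kPromotion (flagShape n k) S) (nextRow₀ (n - k) (2 * (n - k) + k) N₀ N₁)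
      (nextFlag₁ (n - k) k N₀ N₁ N₂) (nextFlag₂ (n - k) k N₁ N₂) := by
  obtain ⟨d, hdn, hdm, hd, v0, vals⟩ := kPromotion_flag hk hB hC
  have r0 : ∀ c < n - k, ∀ v, S (0, c) ≤ v ↔ c < N₀ v := hC.row₀
  have r1 : ∀ c < n - k, ∀ v, S (1, c) ≤ v ↔ c < N₁ v := hC.row₁
  have r2 : ∀ c < k, ∀ v, S (c + 2, 0) ≤ v ↔ c < N₂ v := hC.column
  have r2' : 0 < k → ∀ v, S (2, 0) ≤ v ↔ 0 < N₂ v := hC.column 0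
  have hrow1 := hC.row₁
  have hcol2 := hC.column
  have hout : ∀ b, b ∉ flagShape n k → IncTableau.kPromotion (flagShape n k) S b = 0 :=
    fun b hb => kPromotion_not_mem hb
  suffices h : Counts (n - k) (fun c => IncTableau.kPromotion (flagShape n k) S (0, c))
        (nextRow₀ (n - k) (2 * (n - k) + k) N₀ N₁) ∧
      Counts (n - k) (fun c => IncTableau.kPromotion (flagShape n k) S (1, c))
        (nextFlag₁ (n - k) k N₀ N₁ N₂) ∧
      Counts k (fun r => IncTableau.kPromotion (flagShape n k) S (r + 2, 0))
        (nextFlag₂ (n - k) k N₁ N₂) from ⟨h.1, h.2.1, h.2.2, hout⟩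
  generalize n - k = m at *
  have hm0 : 0 < m := by omega
  set M := 2 * m + k with hM
  obtain ⟨z0, z1, z2⟩ := hB.zero
  have t0 := hB.top₀ M le_rfl
  have t1 := hB.top₁ M le_rfl
  have t2 := hB.top₂ M le_rfl
  have one := hB.one hm0
  have hle0 : ∀ v ≤ M, N₀ v ≤ m := fun v hv => by
    have := le_of_steps hB.mono₀ hv le_rfl
    omega
  have hle1 : ∀ v ≤ M, N₁ v ≤ m := fun v hv => by
    have := le_of_steps hB.mono₁ hv le_rfl
    omega
  have hle2 : ∀ v ≤ M, N₂ v ≤ k := fun v hv => by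
    have := le_of_steps hB.mono₂ hv le_rfl
    omega
  have hge0 : ∀ v ≤ M, 1 ≤ v → 1 ≤ N₀ v := fun v hv h => by
    have := le_of_steps hB.mono₀ h hv
    omega
  have b0 : ∀ c < m, S (0, c) ≤ M := fun c hc => (r0 c hc M).2 (by omega)
  have b1 : ∀ c < m, S (1, c) ≤ M := fun c hc => (r1 c hc M).2 (by omega)
  have b2 : ∀ c < k, S (c + 2, 0) ≤ M := fun c hc => (r2 c hc M).2 (by omega)
  have s1 : ∀ v < M, N₁ (v + 1) ≤ N₁ v + 1 := fun v hv => by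
    have := hB.succ hv
    omega
  have s2 : ∀ v < M, N₂ (v + 1) ≤ N₂ v + 1 := fun v hv => by
    have := hB.succ hv
    omega
  have p1 : ∀ c < m, 1 ≤ S (1, c) := fun c hc => by
    have := hrow1.pos z1 hc
    omega
  have lt1 : ∀ a b, a < b → b < m → S (1, a) < S (1, b) := fun a b => hrow1.lt z1 t1 s1
  have lt2 : ∀ a b, a < b → b < k → S (a + 2, 0) < S (b + 2, 0) := fun a b => hcol2.lt z2 t2 s2
  have meet : ∀ v ≤ M, Meet N₀ N₁ v ↔ S (1, d) ≤ v := by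
    intro v hv
    constructor
    · rintro ⟨t, ht, htv, h⟩
      have h1 := hge0 t (by omega) ht
      have h2 := hle1 t (by omega)
      obtain ⟨e, he⟩ : ∃ e, N₁ t = e + 1 := ⟨N₁ t - 1, by omega⟩
      have h3 := (r1 e (by omega) t).2 (by omega)
      have hde : d ≤ e := by
        by_contra hlt
        have h4 := hdm e (by omega)
        have h5 := (r0 (e + 1) (by omega) t).1 (by omega)
        omega
      have := (r1 d hdn t).2 (by omega)
      omega
    · intro h
      have h1 := (r1 d hdn _).1 le_rfl
      refine ⟨S (1, d), p1 d hdn, h, ?_⟩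
      have h2 := hle0 _ (b1 d hdn)
      rcases hd with hd | hd
      · omega
      · by_contra hlt
        have := (r0 (d + 1) (by omega) (S (1, d))).2 (by omega)
        omega
  -- The hole leaves the first row in column `0` exactly when the label `2` lies below the label
  -- `1`.
  have two : N₁ 2 = 1 ↔ d = 0 := by
    have h2 := hB.sum 2 (by omega)
    have h3 := hB.row 2 (by omega)
    have h4 := hB.column 2 (by omega)
    have h5 := hB.succ (v := 1) (by omega)
    simp only [Nat.reduceAdd] at h5
    constructor
    · intro h
      have hm := (meet 2 (by omega)).1 (hB.meet_two hm0 h le_rfl)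
      have := (r1 d hdn 2).1 hm
      omega
    · rintro rfl
      by_contra hne
      have h6 := hle0 2 (by omega)
      rcases hd with hd | hd
      · omega
      · have h7 := (r0 1 (by omega) 2).2 (by omega)
        have h8 := (r1 0 hdn 2).1
        simp only [zero_add] at hd
        omega
  refine ⟨?_, ?_, ?_⟩
  · intro j hj v
    have e := v0 j hj
    dsimp only
    unfold nextRow₀
    split_ifs with hv hm
    · rw [meet _ hv] at hm
      have h0 := r0 j hj (v + 1)
      have h2 := r0 d hdn (v + 1)
      have hge := hge0 (v + 1) hv (by omega)
      have h3 := hle0 (v + 1) hv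
      split_ifs at e with e1 e2
      · have h1 := r0 (j + 1) (by omega) (v + 1)
        have hd1 := r0 (d - 1 + 1) (by omega) (v + 1)
        have hd3 := hdm (d - 1) (by omega)
        have hd4 := lt1 (d - 1) d (by omega) hdn
        rw [show d - 1 + 1 = d by omega] at hd3
        omega
      · subst e2
        rcases Nat.eq_zero_or_pos j with rfl | hj0
        · omega
        · have hd3 := hdm (j - 1) (by omega)
          have hd4 := lt1 (j - 1) j (by omega) hdn
          rw [show j - 1 + 1 = j by omega] at hd3
          omega
      · rcases hd with hd | hd
        · omega
        · have h6 := r0 (d + 1) (by omega) (v + 1)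
          omega
    · rw [meet _ hv] at hm
      have h0 := r0 j hj (v + 1)
      have hge := hge0 (v + 1) hv (by omega)
      have h3 := hle0 (v + 1) hv
      split_ifs at e with e1 e2
      · have h1 := r0 (j + 1) (by omega) (v + 1)
        omega
      · subst e2
        by_cases hjn : j + 1 = m
        · omega
        · have h6 := r0 (j + 1) (by omega) (v + 1)
          omega
      · have h6 := r0 (d + 1) (by omega) (v + 1)
        omega
    · have h0 := b0 j hj
      have h1 := b1 d hdn
      split_ifs at e with e1 e2
      · have := b0 (j + 1) (by omega)
        omega
      · omega
      · omega
  all_goals rcases vals with ⟨hcase, v1, v2⟩ | ⟨⟨rfl, hk0, hcase⟩, v1, v2⟩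
  · have nclimb : ∀ v ≤ M, ¬ Climb N₁ N₂ v := by
      rintro v hv ⟨h0, t, h1, h2, h3⟩
      have h4 := two.1 h0
      have h5 := hle2 t (by omega)
      have h6 := (r2' (by omega) t).2 h2
      have h7 := (r1 1 (by omega) t).1 (by omega)
      omega
    intro j hj v
    have e := v1 j hj
    dsimp only
    unfold nextFlag₁
    by_cases hv : v < M
    · rw [if_pos hv, if_neg (nclimb (v + 1) hv)]
      have h0 := r1 j hj (v + 1)
      have h2 := r1 d hdn (v + 1)
      have h3 := hle1 (v + 1) hv
      have hm := meet (v + 1) hv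
      have h1 : j + 1 < m → (S (1, j + 1) ≤ v + 1 ↔ j + 1 < N₁ (v + 1)) := fun h =>
        r1 (j + 1) h (v + 1)
      have h4 : j + 1 < m → S (1, j) < S (1, j + 1) := fun h => lt1 j (j + 1) (by omega) h
      rw [hm]
      split_ifs at e ⊢ <;> omega
    · rw [if_neg hv]
      split_ifs at e with e1 e2
      · have := b1 j hj
        omega
      · have := b1 (j + 1) e2
        omega
      · omega
  · have climb : ∀ v ≤ M, Climb N₁ N₂ v ↔ 0 < N₂ v := by
      intro v hv
      constructor
      · intro h
        exact (hB.climb_ge hm0 hv h).2.1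
      · intro h
        have h2 := (r2' hk0 v).2 h
        have h3 := (r2' hk0 _).1 le_rfl
        refine ⟨two.2 rfl, S (2, 0), h2, h3, ?_⟩
        by_contra hlt
        have h4 := hle1 (S (2, 0)) (by omega)
        have h5 := (r1 1 (by omega) (S (2, 0))).2 (by omega)
        have := hcase (by omega)
        omega
    intro j hj v
    have e := v1 j hj
    dsimp only
    unfold nextFlag₁
    by_cases hv : v < M
    · rw [if_pos hv]
      have h0 := r1 j hj (v + 1)
      have h2 := r1 0 hdn (v + 1)
      have h3 := hle1 (v + 1) hv
      have hm := meet (v + 1) hv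
      have hc := climb (v + 1) hv
      have h4 := hB.column (v + 1) hv
      have h5 := r2' hk0 (v + 1)
      have h6 : 1 < m → (S (1, 1) ≤ v + 1 ↔ 1 < N₁ (v + 1)) := fun h => r1 1 h (v + 1)
      have h7 : 1 < j → S (1, 1) < S (1, j) := fun h => lt1 1 j h hj
      rw [hm, hc]
      split_ifs at e ⊢ <;> omega
    · rw [if_neg hv]
      split_ifs at e with e1
      · have : S (2, 0) ≤ M := b2 0 hk0
        omega
      · have := b1 j hj
        omega
  · have nclimb : ∀ v ≤ M, ¬ Climb N₁ N₂ v := by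
      rintro v hv ⟨h0, t, h1, h2, h3⟩
      have h4 := two.1 h0
      have h5 := hle2 t (by omega)
      have h6 := (r2' (by omega) t).2 h2
      have h7 := (r1 1 (by omega) t).1 (by omega)
      omega
    intro r hr v
    have e := v2 r hr
    dsimp only
    unfold nextFlag₂
    by_cases hv : v < M
    · rw [if_pos hv, if_neg (nclimb (v + 1) hv)]
      have h0 := r2 r hr (v + 1)
      omega
    · rw [if_neg hv]
      have := b2 r hr
      omega
  · have climb : ∀ v ≤ M, Climb N₁ N₂ v ↔ 0 < N₂ v := by
      intro v hv
      constructor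
      · intro h
        exact (hB.climb_ge hm0 hv h).2.1
      · intro h
        have h2 := (r2' hk0 v).2 h
        have h3 := (r2' hk0 _).1 le_rfl
        refine ⟨two.2 rfl, S (2, 0), h2, h3, ?_⟩
        by_contra hlt
        have h4 := hle1 (S (2, 0)) (by omega)
        have h5 := (r1 1 (by omega) (S (2, 0))).2 (by omega)
        have := hcase (by omega)
        omega
    intro r hr v
    have e := v2 r hr
    dsimp only
    unfold nextFlag₂
    by_cases hv : v < M
    · rw [if_pos hv]
      have h3 := hle2 (v + 1) hv
      rw [climb (v + 1) hv]
      by_cases e1 : r + 1 < k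
      · have h0 := r2 (r + 1) e1 (v + 1)
        rw [show r + 1 + 2 = r + 3 by omega] at h0
        rw [if_pos e1] at e
        split_ifs <;> omega
      · rw [if_neg e1] at e
        split_ifs <;> omega
    · rw [if_neg hv]
      split_ifs at e with e1
      · have h0 := b2 (r + 1) e1
        rw [show r + 1 + 2 = r + 3 by omega] at h0
        omega
      · omega

theorem FlagBallot.next {m k : ℕ} {N₀ N₁ N₂ : ℕ → ℕ} (hm : 0 < m)
    (hB : FlagBallot m k N₀ N₁ N₂) :
    FlagBallot m k (nextRow₀ m (2 * m + k) N₀ N₁) (nextFlag₁ m k N₀ N₁ N₂)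
      (nextFlag₂ m k N₁ N₂) := by
  set M := 2 * m + k with hM
  have one := hB.one hm
  obtain ⟨z0, z1, z2⟩ := hB.zero
  have t0 := hB.top₀ M le_rfl
  have t1 := hB.top₁ M le_rfl
  have t2 := hB.top₂ M le_rfl
  have hge0 : ∀ v ≤ M, 1 ≤ v → 1 ≤ N₀ v := fun v hv h => by
    have := le_of_steps hB.mono₀ h hv
    omega
  have meetM : Meet N₀ N₁ M := ⟨M, by omega, le_rfl, by omega⟩
  have climb_meet : ∀ v ≤ M, Climb N₁ N₂ v → Meet N₀ N₁ v := fun v hv h =>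
    hB.meet_two hm h.1 (hB.climb_ge hm hv h).1
  have climb_pos : ∀ v ≤ M, Climb N₁ N₂ v → 1 ≤ N₂ v := fun v hv h =>
    (hB.climb_ge hm hv h).2.1
  have meet_pos : ∀ v ≤ M, Meet N₀ N₁ v → 1 ≤ N₁ v := by
    rintro v hv ⟨t, h1, h2, h3⟩
    have := hge0 t (by omega) h1
    have := le_of_steps hB.mono₁ h2 hv
    omega
  have not_meet : ∀ v ≤ M, 1 ≤ v → ¬ Meet N₀ N₁ v → N₁ v < N₀ v := fun v _ h1 h => by
    by_contra hlt
    exact h ⟨v, h1, le_rfl, by omega⟩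
  -- This is needed for `column`: if `Meet` removes the only second-row label so far, that label is
  -- `2`, and then any label already in the column makes `Climb` replace it.
  have two : ∀ v ≤ M, Meet N₀ N₁ v → N₁ v = 1 → N₁ 2 = 1 := by
    rintro v hv ⟨t, h1, h2, h3⟩ h4
    have h5 := le_of_steps hB.mono₁ h2 hv
    have ht : 2 ≤ t := by
      by_contra hlt
      obtain rfl : t = 1 := by omega
      omega
    have h6 := le_of_steps hB.mono₀ ht (by omega)
    have h7 := hge0 2 (by omega) (by omega)
    have h8 := hB.sum 2 (by omega)
    have h9 := hB.column 2 (by omega)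
    have h10 := hB.row 2 (by omega)
    omega
  have sum : ∀ v ≤ M, nextRow₀ m M N₀ N₁ v + nextFlag₁ m k N₀ N₁ N₂ v +
      nextFlag₂ m k N₁ N₂ v = v := by
    intro v hv
    unfold nextRow₀ nextFlag₁ nextFlag₂
    by_cases hv' : v < M
    · rw [if_pos hv', if_pos hv', if_pos hv']
      have a1 := hB.sum (v + 1) hv'
      have a2 := hge0 (v + 1) hv' (by omega)
      have a3 := climb_pos (v + 1) hv'
      have a4 := meet_pos (v + 1) hv'
      by_cases c : Climb N₁ N₂ (v + 1) <;> by_cases e : Meet N₀ N₁ (v + 1) <;>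
        simp only [c, e, if_true, if_false, forall_const] at * <;> omega
    · rw [if_neg hv', if_neg hv', if_neg hv']
      omega
  have key : ∀ v < M, nextRow₀ m M N₀ N₁ v ≤ nextRow₀ m M N₀ N₁ (v + 1) ∧
      nextFlag₁ m k N₀ N₁ N₂ v ≤ nextFlag₁ m k N₀ N₁ N₂ (v + 1) ∧
      nextFlag₂ m k N₁ N₂ v ≤ nextFlag₂ m k N₁ N₂ (v + 1) := by
    intro v hv
    unfold nextRow₀ nextFlag₁ nextFlag₂
    by_cases hv' : v + 1 < M
    · rw [if_pos hv, if_pos hv, if_pos hv, if_pos hv', if_pos hv', if_pos hv']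
      have a1 := hB.succ hv'
      have a2 := hge0 (v + 1) hv (by omega)
      have a3 := climb_pos (v + 1) hv
      have a4 := meet_pos (v + 1) hv
      have a5 := not_meet (v + 1) hv (by omega)
      have a6 := hB.row (v + 1 + 1) hv'
      have s1 := meet_succ (R₀ := N₀) (R₁ := N₁) (v := v + 1)
      have s2 := climb_succ (N₁ := N₁) (N₂ := N₂) (v := v + 1)
      have s3 : ¬ Climb N₁ N₂ (v + 1) → ¬ (1 ≤ N₂ (v + 1) ∧ N₁ (v + 1) ≤ 1 ∧ N₁ 2 = 1) :=
        fun h h' => h ⟨h'.2.2, v + 1, le_rfl, h'.1, h'.2.1⟩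
      have a7 := climb_meet (v + 1) hv
      have a8 := climb_meet (v + 1 + 1) hv'
      by_cases c : Climb N₁ N₂ (v + 1) <;> by_cases e : Meet N₀ N₁ (v + 1) <;>
        by_cases c' : Climb N₁ N₂ (v + 1 + 1) <;> by_cases e' : Meet N₀ N₁ (v + 1 + 1) <;>
        simp only [c, e, c', e', if_true, if_false, forall_const, true_or, false_or, true_iff,
          false_iff, iff_true, not_true_eq_false, not_false_eq_true] at * <;> omega
    · obtain hM' : M = v + 1 := by omega
      rw [if_pos hv, if_pos hv, if_pos hv, if_neg hv', if_neg hv', if_neg hv', ← hM']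
      rw [if_pos meetM]
      split_ifs <;> omega
  refine ⟨fun v hv => (key v hv).1, fun v hv => (key v hv).2.1, fun v hv => (key v hv).2.2, sum,
    ?_, ?_, ?_, ?_, ?_⟩
  · intro v hv
    unfold nextRow₀ nextFlag₁
    by_cases hv' : v < M
    · rw [if_pos hv', if_pos hv']
      have a1 := hB.row (v + 1) hv'
      have a2 := hge0 (v + 1) hv' (by omega)
      have a3 := climb_meet (v + 1) hv'
      have a4 := not_meet (v + 1) hv' (by omega)
      by_cases c : Climb N₁ N₂ (v + 1) <;> by_cases e : Meet N₀ N₁ (v + 1) <;>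
        simp only [c, e, if_true, if_false, forall_const, not_true_eq_false,
          not_false_eq_true] at * <;> omega
    · rw [if_neg hv', if_neg hv']
  · intro v hv
    unfold nextFlag₁ nextFlag₂
    by_cases hv' : v < M
    · rw [if_pos hv', if_pos hv']
      have a1 := hB.column (v + 1) hv'
      have a2 := two (v + 1) hv'
      have a3 : ¬ Climb N₁ N₂ (v + 1) → ¬ (1 ≤ N₂ (v + 1) ∧ N₁ (v + 1) ≤ 1 ∧ N₁ 2 = 1) :=
        fun h h' => h ⟨h'.2.2, v + 1, le_rfl, h'.1, h'.2.1⟩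
      have a4 := meet_pos (v + 1) hv'
      have a5 := climb_pos (v + 1) hv'
      by_cases c : Climb N₁ N₂ (v + 1) <;> by_cases e : Meet N₀ N₁ (v + 1) <;>
        simp only [c, e, if_true, if_false, forall_const, not_true_eq_false,
          not_false_eq_true] at * <;> omega
    · rw [if_neg hv', if_neg hv']
      omega
  · intro v hv
    rw [nextRow₀, if_neg (by omega)]
  · intro v hv
    rw [nextFlag₁, if_neg (by omega)]
  · intro v hv
    rw [nextFlag₂, if_neg (by omega)]


/-! ### The flag map on counting functions -/

/-- The relation between the counting functions `R₀`, `R₁` of an increasing tableau `T` with two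
rows and the counting functions `N₀`, `N₁`, `N₂` of its image of flag shape. The value `ε v` tells
whether the largest label `≤ v` of the second row of `T` appears twice. -/
structure FlagRel (M : ℕ) (R₀ R₁ N₀ N₁ N₂ ε : ℕ → ℕ) : Prop where
  start : ε 0 = 0
  final : ε M = 0
  zero : N₀ 0 = 0 ∧ N₁ 0 = 0 ∧ N₂ 0 = 0
  eq₀ : ∀ v ≤ M, R₀ v = N₀ v + N₂ v + ε v
  eq₁ : ∀ v ≤ M, R₁ v = N₁ v + N₂ v
  le_one : ∀ v ≤ M, ε v ≤ 1
  step : ∀ v < M,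
    (N₀ (v + 1) = N₀ v + 1 ∧ N₁ (v + 1) = N₁ v ∧ N₂ (v + 1) = N₂ v ∧ ε (v + 1) = ε v) ∨
    (N₀ (v + 1) = N₀ v ∧ N₁ (v + 1) = N₁ v + 1 ∧ N₂ (v + 1) = N₂ v ∧ ε v = 0) ∨
    (N₀ (v + 1) = N₀ v ∧ N₁ (v + 1) = N₁ v ∧ N₂ (v + 1) = N₂ v + 1 ∧ ε v = 1)

/-- In terms of `R`, the inequality `N₁ ≤ N₀` reads `R₁ + ε ≤ R₀`. It survives a label appearing
twice because `column` bounds `R₁ (v + 1)` by the count `R₀ v` taken before the first row grows. -/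
theorem FlagRel.flagBallot {n k M : ℕ} {R₀ R₁ N₀ N₁ N₂ ε : ℕ → ℕ} (hB : Ballot n M R₀ R₁)
    (hR : FlagRel M R₀ R₁ N₀ N₁ N₂ ε) (hM : M + k = 2 * n) (hk : k < n)
    (t₀ : ∀ v, M ≤ v → N₀ v = n - k) (t₁ : ∀ v, M ≤ v → N₁ v = n - k)
    (t₂ : ∀ v, M ≤ v → N₂ v = k) : FlagBallot (n - k) k N₀ N₁ N₂ := by
  obtain ⟨z0, z1, z2⟩ := hR.zero
  have hM' : 2 * (n - k) + k = M := by omega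
  have key : ∀ v ≤ M, N₀ v + N₁ v + N₂ v = v ∧ R₁ v + ε v ≤ R₀ v ∧
      (ε v = 1 ∨ 0 < N₂ v → 0 < N₁ v) := by
    intro v
    induction v with
    | zero =>
      intro _
      have := hB.zero₀
      have := hB.zero₁
      have := hR.start
      omega
    | succ v ih =>
      intro hv
      have ih := ih (by omega)
      have h1 := hR.step v hv
      have h2 := hB.column v hv
      have h3 := hR.eq₀ v (by omega)
      have h4 := hR.eq₁ v (by omega)
      have h5 := hR.eq₀ (v + 1) hv
      have h6 := hR.eq₁ (v + 1) hv
      have h7 := hR.le_one (v + 1) hv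
      omega
  constructor
  · intro v hv
    have := hR.step v (by omega)
    omega
  · intro v hv
    have := hR.step v (by omega)
    omega
  · intro v hv
    have := hR.step v (by omega)
    omega
  · intro v hv
    exact (key v (by omega)).1
  · intro v hv
    have h1 := key v (by omega)
    have h3 := hR.eq₀ v (by omega)
    have h4 := hR.eq₁ v (by omega)
    omega
  · intro v hv h
    exact (key v (by omega)).2.2 (Or.inr h)
  · rwa [hM']
  · rwa [hM']
  · rwa [hM']

theorem FlagRel.ballot {n k M : ℕ} {R₀ R₁ N₀ N₁ N₂ ε : ℕ → ℕ}
    (hB : FlagBallot (n - k) k N₀ N₁ N₂) (hR : FlagRel M R₀ R₁ N₀ N₁ N₂ ε)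
    (hM : M + k = 2 * n) (hk : k < n) (t₀ : ∀ v, M ≤ v → R₀ v = n) (t₁ : ∀ v, M ≤ v → R₁ v = n) :
    Ballot n M R₀ R₁ := by
  obtain ⟨z0, z1, z2⟩ := hR.zero
  have key : ∀ v < M, R₀ v ≤ R₀ (v + 1) ∧ R₀ (v + 1) ≤ R₀ v + 1 ∧ R₁ v ≤ R₁ (v + 1) ∧
      R₁ (v + 1) ≤ R₁ v + 1 ∧ R₀ v + R₁ v < R₀ (v + 1) + R₁ (v + 1) ∧ R₁ (v + 1) ≤ R₀ v := by
    intro v hv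
    have h1 := hR.step v hv
    have h3 := hR.eq₀ v (by omega)
    have h4 := hR.eq₁ v (by omega)
    have h5 := hR.eq₀ (v + 1) hv
    have h6 := hR.eq₁ (v + 1) hv
    have h7 := hR.le_one (v + 1) hv
    have h8 := hB.row v (by omega)
    have h9 := hB.row (v + 1) (by omega)
    omega
  have e0 := hR.eq₀ 0 (by omega)
  have e1 := hR.eq₁ 0 (by omega)
  have s := hR.start
  exact ⟨by omega, by omega, fun v hv => (key v hv).1, fun v hv => (key v hv).2.1,
    fun v hv => (key v hv).2.2.1, fun v hv => (key v hv).2.2.2.1,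
    fun v hv => (key v hv).2.2.2.2.1, fun v hv => (key v hv).2.2.2.2.2, t₀, t₁⟩

/-- `1` if the largest label `≤ v` of the second row appears twice, `0` otherwise. -/
def lastTwice (R₀ R₁ : ℕ → ℕ) : ℕ → ℕ
  | 0 => 0
  | v + 1 => if R₁ (v + 1) = R₁ v then lastTwice R₀ R₁ v else R₀ (v + 1) - R₀ v

/-- The number of labels `≤ v` of the second row that are right of a label appearing twice. -/
def rightOfTwice (R₀ R₁ : ℕ → ℕ) : ℕ → ℕ
  | 0 => 0
  | v + 1 => rightOfTwice R₀ R₁ v + if R₁ (v + 1) = R₁ v then 0 else lastTwice R₀ R₁ v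

/-- `R₀ v + R₁ v` exceeds `v` by the number of labels `≤ v` appearing twice. Each of these has its
right neighbor among the labels `≤ v` or is the last of its row so far, and is counted by
`rightOfTwice` or `lastTwice` accordingly. At `M` none is pending, so `rightOfTwice` equals `2 * n -
M = k`. -/
theorem exists_flagRel {n M k : ℕ} {R₀ R₁ : ℕ → ℕ} (hn : 0 < n) (hB : Ballot n M R₀ R₁)
    (hM : M + k = 2 * n) (hk : k < n) :
    ∃ N₀ N₁ N₂ ε, FlagRel M R₀ R₁ N₀ N₁ N₂ ε ∧ FlagBallot (n - k) k N₀ N₁ N₂ := by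
  have hz0 := hB.zero₀
  have hz1 := hB.zero₁
  have key : ∀ v ≤ M, rightOfTwice R₀ R₁ v + lastTwice R₀ R₁ v ≤ R₀ v ∧
      rightOfTwice R₀ R₁ v + lastTwice R₀ R₁ v ≤ R₁ v ∧ lastTwice R₀ R₁ v ≤ 1 ∧
      R₀ v + R₁ v = v + rightOfTwice R₀ R₁ v + lastTwice R₀ R₁ v := by
    intro v
    induction v with
    | zero =>
      intro _
      simp only [rightOfTwice, lastTwice]
      omega
    | succ v ih =>
      intro hv
      have ih := ih (by omega)
      have h1 := hB.mono₀ v hv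
      have h2 := hB.mono₁ v hv
      have h3 := hB.step₀ v hv
      have h4 := hB.step₁ v hv
      have h5 := hB.cover v hv
      simp only [rightOfTwice, lastTwice]
      split_ifs <;> omega
  have hMpos := hB.pos hn
  have tM0 := hB.top₀ M le_rfl
  have tM1 := hB.top₁ M le_rfl
  -- By `column`, the first row is full before label `M`, so `M` lies in the second row only.
  have final : lastTwice R₀ R₁ M = 0 := by
    obtain ⟨v, rfl⟩ : ∃ v, M = v + 1 := ⟨M - 1, by omega⟩
    have h1 := hB.mono₀ v (by omega)
    have h2 := hB.column v (by omega)
    have h5 := hB.cover v (by omega)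
    rw [lastTwice, if_neg (by omega)]
    omega
  have kM := key M le_rfl
  -- The counting functions must be constant from `M` on, whereas the recursions know nothing of
  -- `M`; hence the case distinction.
  obtain ⟨N₀, h₀, h₀'⟩ : ∃ N : ℕ → ℕ, (∀ v ≤ M, N v + rightOfTwice R₀ R₁ v + lastTwice R₀ R₁ v =
      R₀ v) ∧ ∀ v, M ≤ v → N v = n - k := by
    refine ⟨fun v => if v < M then R₀ v - rightOfTwice R₀ R₁ v - lastTwice R₀ R₁ v else n - k,
      fun v hv => ?_, fun v hv => if_neg (by omega)⟩
    have := key v hv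
    dsimp only
    split_ifs with h
    · omega
    · obtain rfl : v = M := by omega
      omega
  obtain ⟨N₁, h₁, h₁'⟩ : ∃ N : ℕ → ℕ, (∀ v ≤ M, N v + rightOfTwice R₀ R₁ v = R₁ v) ∧
      ∀ v, M ≤ v → N v = n - k := by
    refine ⟨fun v => if v < M then R₁ v - rightOfTwice R₀ R₁ v else n - k,
      fun v hv => ?_, fun v hv => if_neg (by omega)⟩
    have := key v hv
    dsimp only
    split_ifs with h
    · omega
    · obtain rfl : v = M := by omega
      omega
  obtain ⟨N₂, h₂, h₂'⟩ : ∃ N : ℕ → ℕ, (∀ v ≤ M, N v = rightOfTwice R₀ R₁ v) ∧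
      ∀ v, M ≤ v → N v = k := by
    refine ⟨fun v => if v < M then rightOfTwice R₀ R₁ v else k,
      fun v hv => ?_, fun v hv => if_neg (by omega)⟩
    dsimp only
    split_ifs with h
    · rfl
    · obtain rfl : v = M := by omega
      omega
  have hrel : FlagRel M R₀ R₁ N₀ N₁ N₂ (lastTwice R₀ R₁) := by
    refine ⟨rfl, final, ?_, ?_, ?_, fun v hv => (key v hv).2.2.1, ?_⟩
    · have e0 := h₀ 0 (by omega)
      have e1 := h₁ 0 (by omega)
      have e2 := h₂ 0 (by omega)
      rw [rightOfTwice] at e0 e1 e2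
      omega
    · intro v hv
      rw [h₂ v hv, h₀ v hv]
    · intro v hv
      rw [h₂ v hv, h₁ v hv]
    · intro v hv
      have m0 := hB.mono₀ v hv
      have m1 := hB.mono₁ v hv
      have s0 := hB.step₀ v hv
      have s1 := hB.step₁ v hv
      have hc := hB.cover v hv
      have k1 := (key v hv.le).2.2.1
      have e0 := h₀ v hv.le
      have e1 := h₁ v hv.le
      have e2 := h₂ v hv.le
      have f0 := h₀ (v + 1) hv
      have f1 := h₁ (v + 1) hv
      have f2 := h₂ (v + 1) hv
      have hs : rightOfTwice R₀ R₁ (v + 1) = rightOfTwice R₀ R₁ v +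
        if R₁ (v + 1) = R₁ v then 0 else lastTwice R₀ R₁ v := rfl
      have hs' : lastTwice R₀ R₁ (v + 1) =
        if R₁ (v + 1) = R₁ v then lastTwice R₀ R₁ v else R₀ (v + 1) - R₀ v := rfl
      by_cases h : R₁ (v + 1) = R₁ v
      · rw [if_pos h] at hs hs'
        exact Or.inl ⟨by omega, by omega, by omega, hs'⟩
      · rw [if_neg h] at hs hs'
        by_cases hl : lastTwice R₀ R₁ v = 0
        · exact Or.inr (Or.inl ⟨by omega, by omega, by omega, hl⟩)
        · exact Or.inr (Or.inr ⟨by omega, by omega, by omega, by omega⟩)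
  exact ⟨_, _, _, _, hrel, hrel.flagBallot hB hM hk h₀' h₁' h₂'⟩

/-- The counting functions of the image determine those of the increasing tableau. -/
theorem FlagRel.unique_symm {M : ℕ} {R₀ R₁ R₀' R₁' N₀ N₁ N₂ ε ε' : ℕ → ℕ}
    (h : FlagRel M R₀ R₁ N₀ N₁ N₂ ε) (h' : FlagRel M R₀' R₁' N₀ N₁ N₂ ε') :
    ∀ v ≤ M, R₀ v = R₀' v ∧ R₁ v = R₁' v := by
  -- Downwards from `ε M = 0`: a label of the first row copies the value of `ε`, one of the second
  -- row forces `0`, and one of the column forces `1`.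
  have key : ∀ j ≤ M, ε (M - j) = ε' (M - j) := by
    intro j
    induction j with
    | zero => exact fun _ => h.final.trans h'.final.symm
    | succ j ih =>
      intro hj
      have h1 := ih (by omega)
      have h2 := h.step (M - (j + 1)) (by omega)
      have h3 := h'.step (M - (j + 1)) (by omega)
      rw [show M - (j + 1) + 1 = M - j by omega] at h2 h3
      omega
  intro v hv
  have h1 := key (M - v) (by omega)
  rw [show M - (M - v) = v by omega] at h1
  have := h.eq₀ v hv
  have := h'.eq₀ v hv
  have := h.eq₁ v hv
  have := h'.eq₁ v hv
  omega

theorem FlagBallot.exists_flagRel {n k : ℕ} {N₀ N₁ N₂ : ℕ → ℕ} (hk : k < n)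
    (hB : FlagBallot (n - k) k N₀ N₁ N₂) : ∃ R₀ R₁ ε,
      FlagRel (2 * (n - k) + k) R₀ R₁ N₀ N₁ N₂ ε ∧ Ballot n (2 * (n - k) + k) R₀ R₁ := by
  classical
  set M := 2 * (n - k) + k with hM
  -- `ε v` has to be `1` exactly when the next label outside the first row goes to the column; that
  -- is, when `N₂` grows at some point before `N₁` does.
  obtain ⟨ε, hε⟩ : ∃ ε : ℕ → ℕ, ∀ v, ε v =
    if ∃ u ≤ M, N₂ v < N₂ u ∧ N₁ u = N₁ v then 1 else 0 := ⟨_, fun _ => rfl⟩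
  have t0 := hB.top₀ M le_rfl
  have t1 := hB.top₁ M le_rfl
  have t2 := hB.top₂ M le_rfl
  obtain ⟨z0, z1, z2⟩ := hB.zero
  have mono : ∀ u v, u ≤ v → v ≤ M → N₁ u ≤ N₁ v ∧ N₂ u ≤ N₂ v := fun u v h h' =>
    ⟨le_of_steps hB.mono₁ h h', le_of_steps hB.mono₂ h h'⟩
  have final : ε M = 0 := by
    rw [hε, if_neg]
    rintro ⟨u, hu, h, -⟩
    have := mono u M hu le_rfl
    omega
  have hrel : FlagRel M (fun v => if v < M then N₀ v + N₂ v + ε v else n)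
      (fun v => if v < M then N₁ v + N₂ v else n) N₀ N₁ N₂ ε := by
    refine ⟨?_, final, hB.zero, ?_, ?_, ?_, ?_⟩
    · rw [hε, if_neg]
      rintro ⟨u, hu, h, h'⟩
      have := hB.column u hu (by omega)
      omega
    · intro v hv
      split_ifs with h
      · rfl
      · obtain rfl : v = M := by omega
        omega
    · intro v hv
      split_ifs with h
      · rfl
      · obtain rfl : v = M := by omega
        omega
    · intro v _
      rw [hε]
      split_ifs <;> omega
    · intro v hv
      rcases hB.succ hv with h | h | h
      · left
        refine ⟨h.1, h.2.1, h.2.2, ?_⟩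
        rw [hε, hε, h.2.1, h.2.2]
      · right
        left
        refine ⟨h.1, h.2.1, h.2.2, ?_⟩
        rw [hε, if_neg]
        rintro ⟨u, hu, h1, h2⟩
        rcases Nat.lt_or_ge v u with h3 | h3
        · have := mono (v + 1) u h3 hu
          omega
        · have := mono u v h3 (by omega)
          omega
      · right
        right
        refine ⟨h.1, h.2.1, h.2.2, ?_⟩
        rw [hε, if_pos]
        exact ⟨v + 1, hv, by omega, h.2.1⟩
  exact ⟨_, _, _, hrel, hrel.ballot hB (by omega) hk (fun v hv => if_neg (by omega))
    fun v hv => if_neg (by omega)⟩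

/-- Counting the entries of an increasing list. -/
theorem counts_list {M : ℕ} {N : ℕ → ℕ} {l : List ℕ} (hl : l.Pairwise (· < ·))
    (hmem : ∀ x ∈ l, 1 ≤ x ∧ x ≤ M) (h0 : N 0 = 0)
    (hs : ∀ v < M, N (v + 1) = N v + if v + 1 ∈ l then 1 else 0)
    (ht : ∀ v, M ≤ v → N v = N M) :
    l.length = N M ∧ Counts l.length (fun c => l.getD c 0) N := by
  have hget : ∀ c, c < l.length → l.getD c 0 ∈ l := fun c hc => by
    rw [List.getD_eq_getElem _ _ hc]
    exact List.getElem_mem hc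
  obtain ⟨R, hR, hle, hRs⟩ := exists_counts (n := l.length) (f := fun c => l.getD c 0) (by
    intro a b hab hb
    rw [List.getD_eq_getElem _ _ hb, List.getD_eq_getElem _ _ (hab.trans hb)]
    exact List.pairwise_iff_getElem.1 hl a b _ _ hab)
  have hiff : ∀ v, (∃ c < l.length, l.getD c 0 = v) ↔ v ∈ l := by
    intro v
    constructor
    · rintro ⟨c, hc, rfl⟩
      exact hget c hc
    · intro h
      obtain ⟨c, hc, rfl⟩ := List.getElem_of_mem h
      exact ⟨c, hc, List.getD_eq_getElem _ _ hc⟩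
  simp only [hiff] at hRs
  have hR0 : R 0 = 0 := by
    by_contra hne
    have h1 := hle 0
    have h2 := (hR 0 (by omega) 0).2 (by omega)
    have h3 := hmem _ (hget 0 (by omega))
    dsimp only at h2
    omega
  have hRN : ∀ v ≤ M, R v = N v := by
    intro v
    induction v with
    | zero => exact fun _ => hR0.trans h0.symm
    | succ v ih =>
      intro hv
      rw [hRs, hs v hv, ih (by omega)]
  have hRt : ∀ v, M ≤ v → R v = l.length := by
    intro v hv
    by_contra hne
    have h1 := hle v
    have h2 := (hR (l.length - 1) (by omega) v).1
    have h3 := hmem _ (hget (l.length - 1) (by omega))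
    dsimp only at h2
    omega
  have hlen : l.length = N M := by rw [← hRt M le_rfl, hRN M le_rfl]
  have hall : R = N := by
    funext v
    rcases Nat.le_total v M with h | h
    · exact hRN v h
    · rw [hRt v h, ht v h, hlen]
  exact ⟨hlen, hall ▸ hR⟩

theorem mem_rowList {n r x : ℕ} {T : Filling} : x ∈ rowList n T r ↔ ∃ c < n, T (r, c) = x := by
  simp [rowList]

theorem Counts.exists_iff {n M : ℕ} {f R : ℕ → ℕ} (h : Counts n f R) {v : ℕ} (hv : v < M)
    (hs : ∀ v < M, R v ≤ R (v + 1)) (hM : R M = n) :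
    (∃ c < n, f c = v + 1) ↔ R v < R (v + 1) := by
  constructor
  · rintro ⟨c, hc, hf⟩
    have := h.lt_succ hc hf
    omega
  · intro hlt
    have := le_of_steps hs (show v + 1 ≤ M from hv) le_rfl
    exact ⟨R v, by omega, h.exists_eq hlt (by omega)⟩

theorem pairwise_rowList {n r : ℕ} {T : Filling}
    (h : ∀ a b, a < b → b < n → T (r, a) < T (r, b)) : (rowList n T r).Pairwise (· < ·) := by
  rw [rowList, List.pairwise_map]
  refine List.Pairwise.imp_of_mem ?_ List.pairwise_lt_range
  intro a b _ hb hab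
  exact h a b hab (List.mem_range.1 hb)

/-- The point is to read `A` and `B` from the path: `ε v = 1` says that the last second-row label `≤
v` is in `A`, so a second-row label `v + 1` is in `B` iff `ε v = 1`. The three lists then have the
jumps prescribed by `FlagRel.step`. -/
theorem Counts₂.flagMap {n k M : ℕ} {R₀ R₁ N₀ N₁ N₂ ε : ℕ → ℕ} {T : Filling}
    (hB : Ballot n M R₀ R₁) (hC : Counts₂ n T R₀ R₁) (hR : FlagRel M R₀ R₁ N₀ N₁ N₂ ε)
    (hM : M + k = 2 * n) (hk : k < n) (hF : FlagBallot (n - k) k N₀ N₁ N₂) :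
    Counts₃ n k (flagMap n T) N₀ N₁ N₂ := by
  have hMk : 2 * (n - k) + k = M := by omega
  have t0 := hB.top₀ M le_rfl
  have t1 := hB.top₁ M le_rfl
  obtain ⟨z0, z1, z2⟩ := hR.zero
  have T0 : ∀ v, M ≤ v → N₀ v = n - k := fun v hv => hF.top₀ v (by omega)
  have T1 : ∀ v, M ≤ v → N₁ v = n - k := fun v hv => hF.top₁ v (by omega)
  have T2 : ∀ v, M ≤ v → N₂ v = k := fun v hv => hF.top₂ v (by omega)
  have mem0 : ∀ v < M, v + 1 ∈ rowList n T 0 ↔ R₀ v < R₀ (v + 1) := fun v hv =>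
    mem_rowList.trans (hC.row₀.exists_iff hv hB.mono₀ t0)
  have mem1 : ∀ v < M, v + 1 ∈ rowList n T 1 ↔ R₁ v < R₁ (v + 1) := fun v hv =>
    mem_rowList.trans (hC.row₁.exists_iff hv hB.mono₁ t1)
  have memA : ∀ v < M, v + 1 ∈ setA n T ↔ R₀ v < R₀ (v + 1) ∧ R₁ v < R₁ (v + 1) := by
    intro v hv
    rw [setA, Finset.mem_inter, List.mem_toFinset, List.mem_toFinset, mem0 v hv, mem1 v hv]
  -- `R₁ v - 1` is the column of the last second-row label `≤ v`; the clause `1 ≤ R₁ v` guards the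
  -- truncated subtraction.
  have lastA : ∀ v ≤ M, ε v = 1 ↔ 1 ≤ R₁ v ∧ T (1, R₁ v - 1) ∈ setA n T := by
    intro v
    induction v with
    | zero =>
      intro _
      rw [hR.start, hB.zero₁]
      simp
    | succ v ih =>
      intro hv
      have ih := ih (by omega)
      have h1 := hR.step v hv
      have h3 := hR.eq₀ v (by omega)
      have h4 := hR.eq₁ v (by omega)
      have h5 := hR.eq₀ (v + 1) hv
      have h6 := hR.eq₁ (v + 1) hv
      have h7 := hR.le_one (v + 1) hv
      by_cases h : R₁ v < R₁ (v + 1)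
      · have h8 := hB.step₁ v hv
        have h9 := le_of_steps hB.mono₁ hv le_rfl
        have h10 := hC.row₁.exists_eq h (by omega)
        rw [show R₁ (v + 1) - 1 = R₁ v by omega, h10, memA v hv]
        omega
      · rw [show R₁ (v + 1) = R₁ v by omega, show ε (v + 1) = ε v by omega]
        exact ih
  have memB : ∀ v < M, v + 1 ∈ setB n T ↔ R₁ v < R₁ (v + 1) ∧ ε v = 1 := by
    intro v hv
    rw [lastA v hv.le, setB, Finset.mem_image]
    simp only [Finset.mem_filter, Finset.mem_range]
    have h8 := hB.step₁ v hv
    have h9 := le_of_steps hB.mono₁ (show v + 1 ≤ M from hv) le_rfl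
    constructor
    · rintro ⟨c, ⟨hc, hc1, hA⟩, he⟩
      have := hC.row₁.lt_succ hc1 he
      have hc' : R₁ v - 1 = c := by omega
      rw [hc']
      exact ⟨by omega, by omega, hA⟩
    · rintro ⟨hlt, h1, hA⟩
      refine ⟨R₁ v - 1, ⟨by omega, by omega, hA⟩, ?_⟩
      rw [show R₁ v - 1 + 1 = R₁ v by omega]
      exact hC.row₁.exists_eq hlt (by omega)
  have lt0 : ∀ a b, a < b → b < n → T (0, a) < T (0, b) := fun a b =>
    hC.row₀.lt hB.zero₀ t0 hB.step₀
  have lt1 : ∀ a b, a < b → b < n → T (1, a) < T (1, b) := fun a b =>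
    hC.row₁.lt hB.zero₁ t1 hB.step₁
  have bd0 : ∀ x ∈ rowList n T 0, 1 ≤ x ∧ x ≤ M := by
    intro x hx
    obtain ⟨c, hc, rfl⟩ := mem_rowList.1 hx
    exact ⟨Nat.pos_of_ne_zero (hC.row₀.pos hB.zero₀ hc), (hC.row₀ c hc M).2 (by omega)⟩
  have bd1 : ∀ x ∈ rowList n T 1, 1 ≤ x ∧ x ≤ M := by
    intro x hx
    obtain ⟨c, hc, rfl⟩ := mem_rowList.1 hx
    exact ⟨Nat.pos_of_ne_zero (hC.row₁.pos hB.zero₁ hc), (hC.row₁ c hc M).2 (by omega)⟩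
  have bdB : ∀ x ∈ setB n T, 1 ≤ x ∧ x ≤ M := by
    intro x hx
    rw [setB, Finset.mem_image] at hx
    obtain ⟨c, hc, rfl⟩ := hx
    rw [Finset.mem_filter] at hc
    exact bd1 _ (mem_rowList.2 ⟨c + 1, hc.2.1, rfl⟩)
  obtain ⟨len0, c0⟩ := counts_list (M := M) (N := N₀)
    (l := (rowList n T 0).filter (· ∉ setA n T)) ((pairwise_rowList lt0).filter _)
    (fun x hx => bd0 x (List.mem_filter.1 hx).1) z0 (by
      intro v hv
      have h1 := hR.step v hv
      have h3 := hR.eq₀ v (by omega)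
      have h4 := hR.eq₁ v (by omega)
      have h5 := hR.eq₀ (v + 1) hv
      have h6 := hR.eq₁ (v + 1) hv
      have h7 := hR.le_one (v + 1) hv
      simp only [List.mem_filter, decide_eq_true_iff, mem0 v hv, memA v hv]
      split_ifs <;> omega) (fun v hv => by rw [T0 v hv, T0 M le_rfl])
  obtain ⟨len1, c1⟩ := counts_list (M := M) (N := N₁)
    (l := (rowList n T 1).filter (· ∉ setB n T)) ((pairwise_rowList lt1).filter _)
    (fun x hx => bd1 x (List.mem_filter.1 hx).1) z1 (by
      intro v hv
      have h1 := hR.step v hv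
      have h4 := hR.eq₁ v (by omega)
      have h6 := hR.eq₁ (v + 1) hv
      simp only [List.mem_filter, decide_eq_true_iff, mem1 v hv, memB v hv]
      split_ifs <;> omega) (fun v hv => by rw [T1 v hv, T1 M le_rfl])
  obtain ⟨len2, c2⟩ := counts_list (M := M) (N := N₂)
    (l := (setB n T).sort (· ≤ ·)) (Finset.sortedLT_sort _).pairwise
    (fun x hx => bdB x ((Finset.mem_sort _).1 hx)) z2 (by
      intro v hv
      have h1 := hR.step v hv
      have h4 := hR.eq₁ v (by omega)
      have h6 := hR.eq₁ (v + 1) hv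
      simp only [Finset.mem_sort, memB v hv]
      split_ifs <;> omega) (fun v hv => by rw [T2 v hv, T2 M le_rfl])
  rw [T0 M le_rfl] at len0
  rw [T1 M le_rfl] at len1
  rw [T2 M le_rfl] at len2
  rw [len0] at c0
  rw [len1] at c1
  rw [len2] at c2
  refine ⟨?_, ?_, ?_, ?_⟩
  · simpa [IncTableau.flagMap] using c0
  · simpa [IncTableau.flagMap] using c1
  · simpa [IncTableau.flagMap] using c2
  · rintro ⟨r, c⟩ hb
    rw [mem_flagShape] at hb
    unfold IncTableau.flagMap
    dsimp only
    split_ifs with h1 h2 h3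
    · exact List.getD_eq_default _ _ (by omega)
    · exact List.getD_eq_default _ _ (by omega)
    · exact List.getD_eq_default _ _ (by omega)
    · rfl

/-- The entry in column `c` is the least `v` at which the count exceeds `c`. -/
theorem exists_counts₂ {n M : ℕ} {R₀ R₁ : ℕ → ℕ} (hB : Ballot n M R₀ R₁) :
    ∃ T, Counts₂ n T R₀ R₁ := by
  have key : ∀ R : ℕ → ℕ, (∀ v < M, R v ≤ R (v + 1)) → (∀ v, M ≤ v → R v = n) →
      Counts n (fun c => sInf {v | c < R v}) R := by
    intro R hs ht c hc v
    have hmono : ∀ u v, u ≤ v → R u ≤ R v := by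
      intro u v huv
      rcases Nat.le_total v M with h | h
      · exact le_of_steps hs huv h
      · rw [ht v h]
        rcases Nat.le_total u M with h' | h'
        · rw [← ht M le_rfl]
          exact le_of_steps hs h' le_rfl
        · rw [ht u h']
    constructor
    · intro h
      have hne : {v | c < R v}.Nonempty := ⟨M, show c < R M by rw [ht M le_rfl]; exact hc⟩
      have hmem : c < R (sInf {v | c < R v}) := Nat.sInf_mem hne
      exact hmem.trans_le (hmono _ _ h)
    · intro h
      exact Nat.sInf_le h
  refine ⟨fun b => if b ∈ rect 2 n then
    (if b.1 = 0 then sInf {v | b.2 < R₀ v} else sInf {v | b.2 < R₁ v}) else 0, ?_, ?_, ?_⟩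
  · intro c hc v
    dsimp only
    rw [if_pos (mem_rect.2 ⟨by omega, hc⟩), if_pos rfl]
    exact key R₀ hB.mono₀ hB.top₀ c hc v
  · intro c hc v
    dsimp only
    rw [if_pos (mem_rect.2 ⟨by omega, hc⟩), if_neg (by omega)]
    exact key R₁ hB.mono₁ hB.top₁ c hc v
  · intro b hb
    exact if_neg hb

/-- The label `1` is not in the second row, so its `n` labels are among the other `M - 1 = 2 * n - k
- 1`. -/
theorem Inc.lt {n k : ℕ} (hn : 0 < n) {T : Filling} (hT : T ∈ Inc (rect 2 n) k) : k < n := by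
  obtain ⟨R₀, R₁, hC, hB⟩ := exists_ballot hn hT
  have hM := hT.2.2.2
  rw [card_rect] at hM
  set M := maxEntry (rect 2 n) T
  have hpos := hB.pos hn
  have h1 := hB.one hn
  have h2 := hB.top₁ M le_rfl
  have key : ∀ v ≤ M, 1 ≤ v → R₁ v + 1 ≤ v := by
    intro v hv h
    induction v, h using Nat.le_induction with
    | base => omega
    | succ v h ih =>
      have := ih (by omega)
      have := hB.step₁ v hv
      omega
  have := key M le_rfl hpos
  omega

/-- Injectivity is the recovery of `ε`, hence of `R₀` and `R₁`, from the triple. Surjectivity builds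
such an `ε` for a given triple. -/
theorem bijOn_flagMap {n k : ℕ} (hk : k < n) :
    Set.BijOn (flagMap n) (Inc (rect 2 n) k) (SYT (flagShape n k)) := by
  have hn : 0 < n := by omega
  have data : ∀ T ∈ Inc (rect 2 n) k, ∃ R₀ R₁ N₀ N₁ N₂ ε, Counts₂ n T R₀ R₁ ∧
      Ballot n (2 * (n - k) + k) R₀ R₁ ∧ FlagRel (2 * (n - k) + k) R₀ R₁ N₀ N₁ N₂ ε ∧
      FlagBallot (n - k) k N₀ N₁ N₂ ∧ Counts₃ n k (flagMap n T) N₀ N₁ N₂ := by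
    intro T hT
    obtain ⟨R₀, R₁, hC, hB⟩ := exists_ballot hn hT
    have hM := hT.2.2.2
    rw [card_rect] at hM
    have hM' : maxEntry (rect 2 n) T = 2 * (n - k) + k := by omega
    rw [hM'] at hB
    obtain ⟨N₀, N₁, N₂, ε, hR, hF⟩ := exists_flagRel hn hB (by omega) hk
    exact ⟨R₀, R₁, N₀, N₁, N₂, ε, hC, hB, hR, hF, hC.flagMap hB hR (by omega) hk hF⟩
  refine ⟨?_, ?_, ?_⟩
  · intro T hT
    obtain ⟨R₀, R₁, N₀, N₁, N₂, ε, hC, hB, hR, hF, hC'⟩ := data T hT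
    exact hF.syt hk hC'
  · intro T hT T' hT' heq
    obtain ⟨R₀, R₁, N₀, N₁, N₂, ε, hC, hB, hR, hF, hC3⟩ := data T hT
    obtain ⟨R₀', R₁', N₀', N₁', N₂', ε', hC', hB', hR', hF', hC3'⟩ := data T' hT'
    rw [← heq] at hC3'
    have le : ∀ {N : ℕ → ℕ} {m : ℕ}, (∀ v < 2 * (n - k) + k, N v ≤ N (v + 1)) →
        (∀ v, 2 * (n - k) + k ≤ v → N v = m) → ∀ v, N v ≤ m := by
      intro N m hs ht v
      rcases Nat.le_total v (2 * (n - k) + k) with h | h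
      · rw [← ht _ le_rfl]
        exact le_of_steps hs h le_rfl
      · rw [ht v h]
    have e0 : N₀ = N₀' := funext fun v => hC3.row₀.unique hC3'.row₀ (le hF.mono₀ hF.top₀ v)
      (le hF'.mono₀ hF'.top₀ v)
    have e1 : N₁ = N₁' := funext fun v => hC3.row₁.unique hC3'.row₁ (le hF.mono₁ hF.top₁ v)
      (le hF'.mono₁ hF'.top₁ v)
    have e2 : N₂ = N₂' := funext fun v => hC3.column.unique hC3'.column (le hF.mono₂ hF.top₂ v)
      (le hF'.mono₂ hF'.top₂ v)
    subst e0 e1 e2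
    have hu := hR.unique_symm hR'
    have f0 : R₀ = R₀' := funext fun v => by
      rcases Nat.le_total v (2 * (n - k) + k) with h | h
      · exact (hu v h).1
      · rw [hB.top₀ v h, hB'.top₀ v h]
    have f1 : R₁ = R₁' := funext fun v => by
      rcases Nat.le_total v (2 * (n - k) + k) with h | h
      · exact (hu v h).2
      · rw [hB.top₁ v h, hB'.top₁ v h]
    subst f0 f1
    exact hC.ext hC'
  · intro S hS
    obtain ⟨N₀, N₁, N₂, hC, hF⟩ := exists_flagBallot hk hS
    obtain ⟨R₀, R₁, ε, hR, hB⟩ := hF.exists_flagRel hk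
    obtain ⟨T, hT⟩ := exists_counts₂ hB
    exact ⟨T, (hB.inc hT).2 k (by omega),
      (hT.flagMap hB hR (by omega) hk hF).ext hC⟩


/-! ### Iterated K-promotion of two-row tableaux -/

theorem Ballot.letter {n M : ℕ} {R₀ R₁ : ℕ → ℕ} (hB : Ballot n M R₀ R₁) {v : ℕ} (hv : v < M) :
    ((R₀ (v + 1) = R₀ v + 1 ∧ R₁ (v + 1) = R₁ v) ∨ (R₀ (v + 1) = R₀ v ∧ R₁ (v + 1) = R₁ v + 1) ∨
      (R₀ (v + 1) = R₀ v + 1 ∧ R₁ (v + 1) = R₁ v + 1)) ∧ R₁ (v + 1) ≤ R₀ v := by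
  have h1 := hB.mono₀ v hv
  have h2 := hB.mono₁ v hv
  have h3 := hB.step₀ v hv
  have h4 := hB.step₁ v hv
  have h5 := hB.cover v hv
  have h6 := hB.column v hv
  omega

theorem Ballot.le {n M : ℕ} {R₀ R₁ : ℕ → ℕ} (hB : Ballot n M R₀ R₁) {v : ℕ} (hv : v ≤ M) :
    R₁ v ≤ R₀ v := by
  rcases v with _ | v
  · have h1 := hB.zero₀
    have h2 := hB.zero₁
    omega
  · have := hB.letter (v := v) hv
    omega

/-- The minimum of `R₀ - R₁` on the interval from `i` to `i + j`. -/
def lowHeight (R₀ R₁ : ℕ → ℕ) (i : ℕ) : ℕ → ℕ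
  | 0 => R₀ i - R₁ i
  | j + 1 => min (lowHeight R₀ R₁ i j) (R₀ (i + j + 1) - R₁ (i + j + 1))

/-- The minimum of `R₀ - R₁` on the interval from `i` to `i + j`, where a label that appears twice
is first counted in the second row and then in the first one. -/
def lowDip (R₀ R₁ : ℕ → ℕ) (i : ℕ) : ℕ → ℕ
  | 0 => R₀ i - R₁ i
  | j + 1 => min (lowDip R₀ R₁ i j) (R₀ (i + j) - R₁ (i + j + 1))

/-- The definition extends the interval at its right end, while a promotion removes its left end. -/
theorem lowHeight_succ (R₀ R₁ : ℕ → ℕ) (i j : ℕ) :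
    lowHeight R₀ R₁ i (j + 1) = min (R₀ i - R₁ i) (lowHeight R₀ R₁ (i + 1) j) := by
  induction j with
  | zero => rfl
  | succ j ih =>
    rw [lowHeight, ih, lowHeight, show i + (j + 1) + 1 = i + 1 + j + 1 by omega]
    omega

theorem Ballot.lowDip_succ {n M : ℕ} {R₀ R₁ : ℕ → ℕ} (hB : Ballot n M R₀ R₁) {i j : ℕ}
    (h : i + 1 + j ≤ M) : lowDip R₀ R₁ i (j + 1) =
      min (min (R₀ i - R₁ i) (R₀ i - R₁ (i + 1))) (lowDip R₀ R₁ (i + 1) j) := by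
  induction j with
  | zero =>
    have := hB.letter (v := i) (by omega)
    simp only [lowDip, Nat.add_zero]
    omega
  | succ j ih =>
    rw [lowDip, ih (by omega), lowDip, show i + (j + 1) + 1 = i + 1 + j + 1 by omega,
      show i + (j + 1) = i + 1 + j by omega]
    omega

/-- Only a label appearing twice takes the path below both adjacent heights, and then by one. -/
theorem Ballot.low {n M : ℕ} {R₀ R₁ : ℕ → ℕ} (hB : Ballot n M R₀ R₁) {i j : ℕ}
    (h : i + j ≤ M) : lowHeight R₀ R₁ i j ≤ R₀ (i + j) - R₁ (i + j) ∧
      lowHeight R₀ R₁ i j ≤ R₀ i - R₁ i ∧ lowDip R₀ R₁ i j ≤ lowHeight R₀ R₁ i j ∧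
      lowHeight R₀ R₁ i j ≤ lowDip R₀ R₁ i j + 1 := by
  induction j with
  | zero =>
    simp only [lowHeight, lowDip, Nat.add_zero]
    omega
  | succ j ih =>
    have h1 := ih (by omega)
    have h2 := hB.letter (v := i + j) (by omega)
    simp only [lowHeight, lowDip]
    rw [show i + (j + 1) = i + j + 1 by omega]
    omega

/-- The counting functions of the `i`-th K-promotion, up to the label `M - i`. -/
structure RectState (M : ℕ) (R₀ R₁ : ℕ → ℕ) (i : ℕ) (A₀ A₁ : ℕ → ℕ) : Prop where
  row₀ : ∀ j, i + j ≤ M → A₀ j + R₁ i + lowHeight R₀ R₁ i j = R₀ (i + j)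
  row₁ : ∀ j, i + j ≤ M → A₁ j + R₀ i = R₁ (i + j) + lowDip R₀ R₁ i j

/-- With `h = R₀ - R₁`, one has `A₀ t - A₁ t = h (i + t) + h i - lowHeight - lowDip`. This vanishes
iff `h (i + t) = h i` and the path never goes below that level, dips included. For some `t ≥ 1` this
means that label `i + 1` is a pure step up and that the path returns to height `h i`; the first
return serves. -/
theorem RectState.meet {n M i : ℕ} {R₀ R₁ A₀ A₁ : ℕ → ℕ} (hn : 0 < n) (hB : Ballot n M R₀ R₁)
    (hA : Ballot n M A₀ A₁) (h : RectState M R₀ R₁ i A₀ A₁) {j : ℕ} (hj : i + 1 + j ≤ M) :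
    Meet A₀ A₁ (j + 1) ↔
      R₁ (i + 1) = R₁ i ∧ lowHeight R₀ R₁ (i + 1) j ≤ R₀ i - R₁ i := by
  have hx := hB.letter (v := i) (by omega)
  have hle := hB.le (v := i) (by omega)
  induction j with
  | zero =>
    have h1 := hA.one hn
    constructor
    · rintro ⟨t, a1, a2, a3⟩
      obtain rfl : t = 1 := by omega
      omega
    · rintro ⟨a1, a2⟩
      rw [lowHeight] at a2
      omega
  | succ j ih =>
    have ih := ih (by omega)
    refine meet_succ.trans ((or_congr ih Iff.rfl).trans ?_)
    have e0 := h.row₀ (j + 1 + 1) (by omega)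
    have e1 := h.row₁ (j + 1 + 1) (by omega)
    have l0 := hB.low (i := i + 1) (j := j) (by omega)
    have hv := hB.letter (v := i + 1 + j) (by omega)
    have hv' := hB.le (v := i + 1 + j) (by omega)
    have hd := hB.lowDip_succ (i := i) (j := j + 1) (by omega)
    rw [lowHeight_succ] at e0
    rw [hd] at e1
    rw [lowHeight] at e0 ⊢
    rw [lowDip] at e1
    rw [show i + (j + 1 + 1) = i + 1 + j + 1 by omega] at e0 e1
    omega

/-- `A₀ t - A₁ (t + 1)` is a sum of two nonnegative gaps: from the lowest height up to `i + t` to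
the starting height, and from the lowest dip to the dip at label `i + t + 1`. Both first vanish when
the path, having started with a first-row label, dips below its height at `i + 1`. -/
theorem RectState.touch {n M i : ℕ} {R₀ R₁ A₀ A₁ : ℕ → ℕ} (hB : Ballot n M R₀ R₁)
    (h : RectState M R₀ R₁ i A₀ A₁) {j : ℕ} (hj : i + 1 + j ≤ M) :
    Touch A₀ A₁ (j + 1) ↔ R₀ (i + 1) = R₀ i + 1 ∧
      lowDip R₀ R₁ (i + 1) j < R₀ (i + 1) - R₁ (i + 1) := by
  have hx := hB.letter (v := i) (by omega)
  have hle := hB.le (v := i) (by omega)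
  induction j with
  | zero =>
    have h3 := touch_one (R₀ := A₀) (R₁ := A₁)
    simp only [lowDip, zero_add] at *
    simp [h3]
  | succ j ih =>
    have ih := ih (by omega)
    refine (touch_succ (by omega)).trans ((or_congr ih Iff.rfl).trans ?_)
    have e0 := h.row₀ (j + 1) (by omega)
    have e1 := h.row₁ (j + 1 + 1) (by omega)
    have l0 := hB.low (i := i + 1) (j := j) (by omega)
    have hv := hB.letter (v := i + 1 + j) (by omega)
    have hv' := hB.le (v := i + 1 + j) (by omega)
    have hd := hB.lowDip_succ (i := i) (j := j + 1) (by omega)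
    rw [lowHeight_succ] at e0
    rw [hd] at e1
    have d1 : lowDip R₀ R₁ (i + 1) (j + 1) =
      min (lowDip R₀ R₁ (i + 1) j) (R₀ (i + 1 + j) - R₁ (i + 1 + j + 1)) := rfl
    rw [d1] at e1 ⊢
    rw [show i + (j + 1 + 1) = i + 1 + j + 1 by omega] at e1
    rw [show i + (j + 1) = i + 1 + j by omega] at e0
    clear hd d1 h hB
    generalize lowDip R₀ R₁ (i + 1) j = d at *
    generalize lowHeight R₀ R₁ (i + 1) j = l at *
    obtain ⟨hv, hv2⟩ := hv
    obtain ⟨hx, hx2⟩ := hx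
    by_cases hd : R₀ (i + 1) = R₀ i + 1 ∧ d < R₀ (i + 1) - R₁ (i + 1)
    · exact iff_of_true (Or.inl hd) ⟨hd.1, by omega⟩
    · have hd' : R₀ (i + 1) = R₀ i + 1 → R₀ (i + 1) - R₁ (i + 1) ≤ d := by omega
      clear ih
      simp only [hd, false_or]
      rcases hx with hx | hx | hx
      · have := hd' hx.1
        clear hd hd'
        constructor
        · intro h
          rcases hv with hv | hv | hv <;> omega
        · intro h
          rcases hv with hv | hv | hv <;> omega
      · constructor
        · intro h
          rcases hv with hv | hv | hv <;> omega
        · intro h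
          omega
      · have := hd' hx.1
        clear hd hd'
        constructor
        · intro h
          rcases hv with hv | hv | hv <;> omega
        · intro h
          rcases hv with hv | hv | hv <;> omega

/-- The corrections `Meet` and `Touch` are precisely what compensates the change of the minima when
the left end `i` of the interval is dropped. -/
theorem RectState.next {n M i : ℕ} {R₀ R₁ A₀ A₁ : ℕ → ℕ} (hn : 0 < n) (hB : Ballot n M R₀ R₁)
    (hA : Ballot n M A₀ A₁) (h : RectState M R₀ R₁ i A₀ A₁) (hi : i < M) :
    RectState M R₀ R₁ (i + 1) (nextRow₀ n M A₀ A₁) (nextRow₁ n M A₀ A₁) := by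
  have hx := hB.letter hi
  have hle := hB.le (v := i) (by omega)
  constructor
  · intro j hj
    have hm := h.meet hn hB hA hj
    have e0 := h.row₀ (j + 1) (by omega)
    have l0 := hB.low (i := i + 1) (j := j) (by omega)
    have h1 := hA.one hn
    have h2 := le_of_steps hA.mono₀ (show 1 ≤ j + 1 by omega) (by omega)
    rw [lowHeight_succ] at e0
    rw [nextRow₀, if_pos (by omega)]
    rw [show i + (j + 1) = i + 1 + j by omega] at e0
    split_ifs with hc
    · rw [hm] at hc
      omega
    · rw [hm] at hc
      omega
  · intro j hj
    have hm := h.touch hB hj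
    have e1 := h.row₁ (j + 1) (by omega)
    have l0 := hB.low (i := i + 1) (j := j) (by omega)
    rw [hB.lowDip_succ hj] at e1
    rw [nextRow₁, if_pos (by omega)]
    rw [show i + (j + 1) = i + 1 + j by omega] at e1
    have h3 : Touch A₀ A₁ (j + 1) → 1 ≤ A₁ (j + 1) := by
      rintro ⟨t, a1, a2, a3⟩
      have h1 := hA.one hn
      have h2 := le_of_steps hA.mono₀ a1 (by omega)
      have h3 := le_of_steps hA.mono₁ a2 (by omega)
      omega
    split_ifs with hc
    · have := h3 hc
      rw [hm] at hc
      omega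
    · rw [hm] at hc
      omega

theorem iterate_kPromotion_rect {n M : ℕ} {R₀ R₁ : ℕ → ℕ} {T : Filling} (hn : 0 < n)
    (hB : Ballot n M R₀ R₁) (hC : Counts₂ n T R₀ R₁) : ∀ i ≤ M, ∃ A₀ A₁,
      Counts₂ n ((kPromotion (rect 2 n))^[i] T) A₀ A₁ ∧ Ballot n M A₀ A₁ ∧
        RectState M R₀ R₁ i A₀ A₁ := by
  intro i
  induction i with
  | zero =>
    intro _
    have z0 := hB.zero₀
    have z1 := hB.zero₁
    refine ⟨R₀, R₁, hC, hB, ?_, ?_⟩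
    · intro j hj
      have := hB.low hj
      simp only [zero_add] at *
      omega
    · intro j hj
      have := hB.low hj
      simp only [zero_add] at *
      omega
  | succ i ih =>
    intro hi
    obtain ⟨A₀, A₁, h1, h2, h3⟩ := ih (by omega)
    rw [Function.iterate_succ_apply']
    exact ⟨_, _, h1.kPromotion hn h2, h2.next hn, h3.next hn hB h2 hi⟩

/-! ### Iterated promotion on the flag shape -/

open Classical in
/-- `1` if the smallest label `> i` of the first row appears twice, `0` otherwise. -/
noncomputable def nextTwice (M : ℕ) (R₀ R₁ : ℕ → ℕ) (i : ℕ) : ℕ :=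
  if ∃ u, i ≤ u ∧ u < M ∧ R₀ u = R₀ i ∧ R₀ u < R₀ (u + 1) ∧ R₁ u < R₁ (u + 1) then 1 else 0

theorem nextTwice_le {M : ℕ} {R₀ R₁ : ℕ → ℕ} {i : ℕ} : nextTwice M R₀ R₁ i ≤ 1 := by
  unfold nextTwice
  split_ifs <;> omega

theorem nextTwice_top {M : ℕ} {R₀ R₁ : ℕ → ℕ} : nextTwice M R₀ R₁ M = 0 := by
  rw [nextTwice, if_neg]
  rintro ⟨u, h1, h2, -⟩
  omega

/-- The first label `> i` of the first row appears twice iff `nextTwice` says so. -/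
theorem Ballot.nextTwice_jump {n M : ℕ} {R₀ R₁ : ℕ → ℕ} (hB : Ballot n M R₀ R₁) {i u : ℕ}
    (hi : i ≤ u) (hu : u < M) (h0 : R₀ u = R₀ i) (h1 : R₀ u < R₀ (u + 1)) :
    nextTwice M R₀ R₁ i = 1 ↔ R₁ u < R₁ (u + 1) := by
  constructor
  · intro h
    have : ∃ u, i ≤ u ∧ u < M ∧ R₀ u = R₀ i ∧ R₀ u < R₀ (u + 1) ∧ R₁ u < R₁ (u + 1) := by
      by_contra hne
      rw [nextTwice, if_neg hne] at h
      omega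
    obtain ⟨w, a1, a2, a3, a4, a5⟩ := this
    rcases lt_trichotomy w u with hlt | rfl | hlt
    · have := le_of_steps hB.mono₀ (show w + 1 ≤ u from hlt) hu.le
      omega
    · exact a5
    · have := le_of_steps hB.mono₀ (show u + 1 ≤ w from hlt) a2.le
      omega
  · intro h
    rw [nextTwice, if_pos]
    exact ⟨u, hi, hu, h0, h1, h⟩

theorem Ballot.nextTwice_same {n M : ℕ} {R₀ R₁ : ℕ → ℕ} (hB : Ballot n M R₀ R₁) {i : ℕ}
    (hi : i < M) (h : R₀ (i + 1) = R₀ i) : nextTwice M R₀ R₁ i = nextTwice M R₀ R₁ (i + 1) := by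
  have := hB.letter hi
  unfold nextTwice
  congr 1
  rw [eq_iff_iff]
  constructor
  · rintro ⟨u, a1, a2, a3, a4, a5⟩
    have : u ≠ i := by
      rintro rfl
      omega
    exact ⟨u, by omega, a2, by omega, a4, a5⟩
  · rintro ⟨u, a1, a2, a3, a4, a5⟩
    exact ⟨u, by omega, a2, by omega, a4, a5⟩

/-- `lastTwice`, for the labels in the interval from `i + 1` to `i + j`. -/
def lastTwiceFrom (R₀ R₁ : ℕ → ℕ) (i j : ℕ) : ℕ :=
  lastTwice (fun v => R₀ (i + v)) (fun v => R₁ (i + v)) j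

/-- `rightOfTwice`, for the labels in the interval from `i + 1` to `i + j`. -/
def rightOfTwiceFrom (R₀ R₁ : ℕ → ℕ) (i j : ℕ) : ℕ :=
  rightOfTwice (fun v => R₀ (i + v)) (fun v => R₁ (i + v)) j

theorem lastTwiceFrom_zero (R₀ R₁ : ℕ → ℕ) (i : ℕ) : lastTwiceFrom R₀ R₁ i 0 = 0 := rfl

theorem rightOfTwiceFrom_zero (R₀ R₁ : ℕ → ℕ) (i : ℕ) : rightOfTwiceFrom R₀ R₁ i 0 = 0 := rfl

theorem lastTwiceFrom_succ (R₀ R₁ : ℕ → ℕ) (i j : ℕ) : lastTwiceFrom R₀ R₁ i (j + 1) =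
    if R₁ (i + j + 1) = R₁ (i + j) then lastTwiceFrom R₀ R₁ i j
    else R₀ (i + j + 1) - R₀ (i + j) := rfl

theorem rightOfTwiceFrom_succ (R₀ R₁ : ℕ → ℕ) (i j : ℕ) : rightOfTwiceFrom R₀ R₁ i (j + 1) =
    rightOfTwiceFrom R₀ R₁ i j +
      if R₁ (i + j + 1) = R₁ (i + j) then 0 else lastTwiceFrom R₀ R₁ i j := rfl

/-- Facts about the labels between `i + 1` and `i + j`. -/
theorem Ballot.interval {n M : ℕ} {R₀ R₁ : ℕ → ℕ} (hB : Ballot n M R₀ R₁) {i j : ℕ}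
    (h : i + j ≤ M) :
    lowDip R₀ R₁ i j + lastTwiceFrom R₀ R₁ i j ≤ R₀ (i + j) - R₁ (i + j) ∧
    rightOfTwiceFrom R₀ R₁ i j + lastTwiceFrom R₀ R₁ i j + (R₀ i + R₁ i) + j =
      R₀ (i + j) + R₁ (i + j) ∧
    lastTwiceFrom R₀ R₁ i j ≤ 1 ∧
    lowDip R₀ R₁ i j ≤ R₀ i - R₁ i ∧
    R₀ i + rightOfTwiceFrom R₀ R₁ i j ≤ R₁ (i + j) + lowDip R₀ R₁ i j ∧
    R₀ i ≤ R₀ (i + j) ∧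
    (R₀ (i + j) = R₀ i → lastTwiceFrom R₀ R₁ i j = 0 ∧ rightOfTwiceFrom R₀ R₁ i j = 0 ∧
      lowDip R₀ R₁ i j = R₀ (i + j) - R₁ (i + j)) := by
  induction j with
  | zero =>
    have := hB.le (v := i) (by omega)
    have d : lowDip R₀ R₁ i 0 = R₀ i - R₁ i := rfl
    have l := lastTwiceFrom_zero R₀ R₁ i
    have r := rightOfTwiceFrom_zero R₀ R₁ i
    rw [Nat.add_zero]
    omega
  | succ j ih =>
    have ih := ih (by omega)
    have hv := hB.letter (v := i + j) (by omega)
    have h1 := hB.le (v := i + j) (by omega)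
    have h2 := hB.le (v := i) (by omega)
    have d : lowDip R₀ R₁ i (j + 1) =
      min (lowDip R₀ R₁ i j) (R₀ (i + j) - R₁ (i + j + 1)) := rfl
    have l := lastTwiceFrom_succ R₀ R₁ i j
    have r := rightOfTwiceFrom_succ R₀ R₁ i j
    rw [show i + (j + 1) = i + j + 1 by omega]
    split_ifs at l r with hc
    · omega
    · omega

/-- Up to the first first-row label the path only descends. That label appears twice, so it dips
below everything before it and sets `lowDip`. Until the next second-row label nothing in the last
two equations changes, and that label makes `rightOfTwice` positive. -/
theorem Ballot.interval_one {n M : ℕ} {R₀ R₁ : ℕ → ℕ} (hB : Ballot n M R₀ R₁) {i j : ℕ}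
    (h : i + j ≤ M) (hz : nextTwice M R₀ R₁ i = 1) (hj : R₀ i < R₀ (i + j)) :
    lowDip R₀ R₁ i j + 1 ≤ R₀ i - R₁ i ∧
      (rightOfTwiceFrom R₀ R₁ i j = 0 → lastTwiceFrom R₀ R₁ i j = 1 ∧
        R₀ i = R₁ (i + j) + lowDip R₀ R₁ i j) := by
  induction j with
  | zero => simp at hj
  | succ j ih =>
    have hv := hB.letter (v := i + j) (by omega)
    have h1 := hB.le (v := i + j) (by omega)
    have h2 := hB.le (v := i) (by omega)
    have hi := hB.interval (i := i) (j := j) (by omega)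
    have d : lowDip R₀ R₁ i (j + 1) =
      min (lowDip R₀ R₁ i j) (R₀ (i + j) - R₁ (i + j + 1)) := rfl
    have l := lastTwiceFrom_succ R₀ R₁ i j
    have r := rightOfTwiceFrom_succ R₀ R₁ i j
    rw [show i + (j + 1) = i + j + 1 by omega] at hj ⊢
    by_cases hlt : R₀ i < R₀ (i + j)
    · have ih := ih (by omega) hlt
      split_ifs at l r with hc <;> omega
    · have hjump := (hB.nextTwice_jump (i := i) (u := i + j) (by omega) (by omega) (by omega)
        (by omega)).1 hz
      rw [if_neg (by omega)] at l r
      omega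

/-- The first first-row label lifts the path above its minimum. The next second-row label therefore
raises `R₁` without lowering `lowDip` or adding to `rightOfTwice`; this gains one over the
inequality of `Ballot.interval`, and the gain persists. -/
theorem Ballot.interval_zero {n M : ℕ} {R₀ R₁ : ℕ → ℕ} (hB : Ballot n M R₀ R₁) {i j : ℕ}
    (h : i + j ≤ M) (hz : nextTwice M R₀ R₁ i = 0) (hj : R₀ i < R₀ (i + j)) :
    R₀ i + rightOfTwiceFrom R₀ R₁ i j + 1 ≤ R₁ (i + j) + lowDip R₀ R₁ i j ∨
      (rightOfTwiceFrom R₀ R₁ i j = 0 ∧ lastTwiceFrom R₀ R₁ i j = 0 ∧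
        lowDip R₀ R₁ i j < R₀ (i + j) - R₁ (i + j)) := by
  induction j with
  | zero => simp at hj
  | succ j ih =>
    have hv := hB.letter (v := i + j) (by omega)
    have h1 := hB.le (v := i + j) (by omega)
    have h2 := hB.le (v := i) (by omega)
    have hi := hB.interval (i := i) (j := j) (by omega)
    have d : lowDip R₀ R₁ i (j + 1) =
      min (lowDip R₀ R₁ i j) (R₀ (i + j) - R₁ (i + j + 1)) := rfl
    have l := lastTwiceFrom_succ R₀ R₁ i j
    have r := rightOfTwiceFrom_succ R₀ R₁ i j
    rw [show i + (j + 1) = i + j + 1 by omega] at hj ⊢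
    by_cases hlt : R₀ i < R₀ (i + j)
    · have ih := ih (by omega) hlt
      split_ifs at l r with hc <;> omega
    · have hjump := hB.nextTwice_jump (i := i) (u := i + j) (by omega) (by omega) (by omega)
        (by omega)
      rw [if_pos (by omega)] at l r
      omega

/-- The two intervals differ by label `i + 1`, which matters only if it appears twice: it is pending
until the next second-row label, and from then on contributes one to `rightOfTwice`. -/
theorem Ballot.interval_shift {n M : ℕ} {R₀ R₁ : ℕ → ℕ} (hB : Ballot n M R₀ R₁) {i j : ℕ}
    (h : i + 1 + j ≤ M) :
    (¬ (R₀ i < R₀ (i + 1) ∧ R₁ i < R₁ (i + 1)) →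
      rightOfTwiceFrom R₀ R₁ i (j + 1) = rightOfTwiceFrom R₀ R₁ (i + 1) j ∧
      lastTwiceFrom R₀ R₁ i (j + 1) = lastTwiceFrom R₀ R₁ (i + 1) j) ∧
    (R₀ i < R₀ (i + 1) ∧ R₁ i < R₁ (i + 1) → R₁ (i + 1) ≤ R₁ (i + 1 + j) ∧
      (R₁ (i + 1 + j) = R₁ (i + 1) → rightOfTwiceFrom R₀ R₁ i (j + 1) = 0 ∧
        rightOfTwiceFrom R₀ R₁ (i + 1) j = 0 ∧ lastTwiceFrom R₀ R₁ i (j + 1) = 1 ∧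
        lastTwiceFrom R₀ R₁ (i + 1) j = 0) ∧
      (R₁ (i + 1) < R₁ (i + 1 + j) →
        rightOfTwiceFrom R₀ R₁ i (j + 1) = rightOfTwiceFrom R₀ R₁ (i + 1) j + 1 ∧
        lastTwiceFrom R₀ R₁ i (j + 1) = lastTwiceFrom R₀ R₁ (i + 1) j)) := by
  induction j with
  | zero =>
    have hx := hB.letter (v := i) (by omega)
    have l := lastTwiceFrom_succ R₀ R₁ i 0
    have r := rightOfTwiceFrom_succ R₀ R₁ i 0
    have l0 := lastTwiceFrom_zero R₀ R₁ i
    have r0 := rightOfTwiceFrom_zero R₀ R₁ i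
    have l1 := lastTwiceFrom_zero R₀ R₁ (i + 1)
    have r1 := rightOfTwiceFrom_zero R₀ R₁ (i + 1)
    simp only [Nat.add_zero, zero_add] at *
    split_ifs at l r with hc <;> omega
  | succ j ih =>
    have ih := ih (by omega)
    have hx := hB.letter (v := i) (by omega)
    have hv := hB.letter (v := i + 1 + j) (by omega)
    have l := lastTwiceFrom_succ R₀ R₁ i (j + 1)
    have r := rightOfTwiceFrom_succ R₀ R₁ i (j + 1)
    have l1 := lastTwiceFrom_succ R₀ R₁ (i + 1) j
    have r1 := rightOfTwiceFrom_succ R₀ R₁ (i + 1) j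
    rw [show i + (j + 1) + 1 = i + 1 + j + 1 by omega,
      show i + (j + 1) = i + 1 + j by omega] at l r
    rw [show i + 1 + (j + 1) = i + 1 + j + 1 by omega]
    split_ifs at l r l1 r1 with hc <;> omega


/-- The counting functions of the first row and of the column of the `i`-th promotion of the image
of flag shape, up to the label `M - i`. -/
structure FlagState (M : ℕ) (R₀ R₁ : ℕ → ℕ) (i : ℕ) (A₀ A₂ : ℕ → ℕ) : Prop where
  row₀ : ∀ j, i + j ≤ M → A₀ j + lowDip R₀ R₁ i j + R₁ (i + j) = j + R₀ i
  column : ∀ j, i + j ≤ M → A₂ j = rightOfTwiceFrom R₀ R₁ i j - nextTwice M R₀ R₁ i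

/-- This is the inequality `A₁ ≤ A₀` of a flag tableau with the counts of `FlagState`, written in
terms of the path so that it can be used for the interval starting at `i + 1` before the next state
is known. -/
theorem Ballot.two_mul_lowDip_le {n M : ℕ} {R₀ R₁ : ℕ → ℕ} (hB : Ballot n M R₀ R₁) {i j : ℕ}
    (h : i + j ≤ M) : 2 * (lowDip R₀ R₁ i j + R₁ (i + j)) ≤
      j + 2 * R₀ i + (rightOfTwiceFrom R₀ R₁ i j - nextTwice M R₀ R₁ i) := by
  have h0 := hB.interval h
  have h1 := hB.le h
  have h2 := hB.le (v := i) (by omega)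
  have hz := nextTwice_le (M := M) (R₀ := R₀) (R₁ := R₁) (i := i)
  have h3 : nextTwice M R₀ R₁ i = 1 → R₀ i < R₀ (i + j) →
    lowDip R₀ R₁ i j + 1 ≤ R₀ i - R₁ i := fun a b => (hB.interval_one h a b).1
  omega

theorem FlagState.row_succ {n M i : ℕ} {R₀ R₁ A₀ A₂ : ℕ → ℕ} (hB : Ballot n M R₀ R₁)
    (h : FlagState M R₀ R₁ i A₀ A₂) {j : ℕ} (hj : i + 1 + j ≤ M) :
    A₀ (j + 1) + lowDip R₀ R₁ (i + 1) j + R₁ (i + 1 + j) = j + R₀ (i + 1) +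
      if R₀ (i + 1) = R₀ i + 1 ∧ lowDip R₀ R₁ (i + 1) j < R₀ (i + 1) - R₁ (i + 1) then 0
      else 1 := by
  have hx := hB.letter (v := i) (by omega)
  have e := h.row₀ (j + 1) (by omega)
  have h0 := (hB.interval hj).2.2.2.1
  rw [hB.lowDip_succ hj, show i + (j + 1) = i + 1 + j by omega] at e
  split_ifs with hc <;> omega

/-- If label `i + 1` appears twice, its contributions to `rightOfTwiceFrom` and `nextTwice` cancel.
While no second-row label follows, the former is still `0`, and the truncated subtraction gives the
right value. -/
theorem FlagState.column_succ {n M i : ℕ} {R₀ R₁ A₀ A₂ : ℕ → ℕ} (hB : Ballot n M R₀ R₁)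
    (h : FlagState M R₀ R₁ i A₀ A₂) {j : ℕ} (hj : i + 1 + j ≤ M) :
    (R₀ (i + 1) = R₀ i + 1 → A₂ (j + 1) = rightOfTwiceFrom R₀ R₁ (i + 1) j) ∧
    (R₀ (i + 1) = R₀ i →
      A₂ (j + 1) = rightOfTwiceFrom R₀ R₁ (i + 1) j - nextTwice M R₀ R₁ (i + 1)) := by
  have hx := hB.letter (v := i) (by omega)
  have e := h.column (j + 1) (by omega)
  have hs := hB.interval_shift hj
  have hz := nextTwice_le (M := M) (R₀ := R₀) (R₁ := R₁) (i := i)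
  constructor
  · intro hR
    have := hB.nextTwice_jump (i := i) (u := i) le_rfl (by omega) rfl (by omega)
    omega
  · intro hR
    have := hB.nextTwice_same (by omega) hR
    omega

/-- The criterion is that of `RectState.touch`: the first row of the flag is corrected exactly when
the second row of the rectangle is, so the two promotions run in step. -/
theorem FlagState.meet {n m k M i : ℕ} {R₀ R₁ A₀ A₁ A₂ : ℕ → ℕ} (hm : 0 < m)
    (hM : 2 * m + k = M) (hB : Ballot n M R₀ R₁) (hA : FlagBallot m k A₀ A₁ A₂)
    (h : FlagState M R₀ R₁ i A₀ A₂) {j : ℕ} (hj : i + 1 + j ≤ M) :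
    Meet A₀ A₁ (j + 1) ↔ R₀ (i + 1) = R₀ i + 1 ∧
      lowDip R₀ R₁ (i + 1) j < R₀ (i + 1) - R₁ (i + 1) := by
  have hx := hB.letter (v := i) (by omega)
  induction j with
  | zero =>
    have h1 := hA.one hm
    refine iff_of_false ?_ ?_
    · rintro ⟨t, a1, a2, a3⟩
      obtain rfl : t = 1 := by omega
      omega
    · rw [lowDip]
      omega
  | succ j ih =>
    have ih := ih (by omega)
    refine meet_succ.trans ((or_congr ih Iff.rfl).trans ?_)
    have sum := hA.sum (j + 1 + 1) (by omega)
    have e0 := h.row_succ hB hj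
    have e2 := h.column_succ hB hj
    have q := hB.two_mul_lowDip_le hj
    have hv := hB.letter (v := i + 1 + j) (by omega)
    have hv' := hB.le (v := i + 1 + j) (by omega)
    have hI := hB.interval (i := i + 1) (j := j) (by omega)
    have d : lowDip R₀ R₁ (i + 1) (j + 1) =
      min (lowDip R₀ R₁ (i + 1) j) (R₀ (i + 1 + j) - R₁ (i + 1 + j + 1)) := rfl
    have r := rightOfTwiceFrom_succ R₀ R₁ (i + 1) j
    rw [show i + 1 + (j + 1) = i + 1 + j + 1 by omega] at *
    by_cases hc : R₀ (i + 1) = R₀ i + 1 ∧ lowDip R₀ R₁ (i + 1) j < R₀ (i + 1) - R₁ (i + 1)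
    · exact iff_of_true (Or.inl hc) ⟨hc.1, by omega⟩
    rw [or_iff_right hc]
    by_cases hc' : R₀ (i + 1) = R₀ i + 1 ∧
      lowDip R₀ R₁ (i + 1) (j + 1) < R₀ (i + 1) - R₁ (i + 1)
    · rw [if_pos hc'] at e0
      refine iff_of_true ?_ hc'
      have e2 := e2.1 hc'.1
      obtain ⟨i1, i2, -, i4, -⟩ := hI
      obtain ⟨c1, c2⟩ := hc'
      -- The inequality holds now and not one label earlier, so label `i + j + 2` of `T` is a
      -- second-row label dipping exactly one below the height at `i + 1`, and no label appearing
      -- twice is pending. This gives equality of the two counts.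
      have f1 : lowDip R₀ R₁ (i + 1) j = R₀ (i + 1) - R₁ (i + 1) := by omega
      have f2 : R₀ (i + 1 + j) < R₀ (i + 1) - R₁ (i + 1) + R₁ (i + 1 + j + 1) := by omega
      have f3 : R₁ (i + 1 + j + 1) = R₁ (i + 1 + j) + 1 := by omega
      rw [f1] at i1 i4 d
      rw [f3] at f2
      clear q ih hv
      have f4 : lastTwiceFrom R₀ R₁ (i + 1) j = 0 := by omega
      rw [if_neg (by omega), f4] at r
      rw [f4] at i2
      rw [f3] at d
      have f5 : lowDip R₀ R₁ (i + 1) (j + 1) + 1 = R₀ (i + 1) - R₁ (i + 1) := by omega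
      have f6 : R₀ (i + 1 + j) = R₁ (i + 1 + j) + (R₀ (i + 1) - R₁ (i + 1)) := by omega
      clear d f2 i4 i1 c2
      omega
    · rw [if_neg hc'] at e0
      refine iff_of_false ?_ hc'
      have hx1 := hx.1
      clear hv hv' hI d r ih hc hc' hx
      by_cases hR : R₀ (i + 1) = R₀ i + 1
      · have e2 := e2.1 hR
        omega
      · have e2 := e2.2 (by omega)
        omega

/-- `Climb` asks for a column label while the second row has at most one. If the next first-row
label after `i + 1` appears twice, `Ballot.interval_one` gives an exact count when the first right
neighbor arrives, leaving one second-row label. Otherwise `Ballot.interval_zero` shows that the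
second row already has two. -/
theorem FlagState.climb {n m k M i : ℕ} {R₀ R₁ A₀ A₁ A₂ : ℕ → ℕ} (hm : 0 < m)
    (hM : 2 * m + k = M) (hB : Ballot n M R₀ R₁) (hA : FlagBallot m k A₀ A₁ A₂)
    (h : FlagState M R₀ R₁ i A₀ A₂) {j : ℕ} (hj : i + 1 + j ≤ M) :
    Climb A₁ A₂ (j + 1) ↔ R₀ (i + 1) = R₀ i + 1 ∧ nextTwice M R₀ R₁ (i + 1) = 1 ∧
      1 ≤ rightOfTwiceFrom R₀ R₁ (i + 1) j := by
  have hx := hB.letter (v := i) (by omega)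
  have hz := nextTwice_le (M := M) (R₀ := R₀) (R₁ := R₁) (i := i + 1)
  constructor
  · rintro ⟨h0, t, h1, h2, h3⟩
    obtain ⟨ht, -, -⟩ := hA.climb_ge hm (show t ≤ 2 * m + k by omega) ⟨h0, t, le_rfl, h2, h3⟩
    obtain ⟨s, rfl⟩ : ∃ s, t = s + 1 := ⟨t - 1, by omega⟩
    by_cases hR : R₀ (i + 1) = R₀ i + 1
    · have hmono := le_of_steps hA.mono₂ h1 (by omega)
      have e2 := (h.column_succ hB hj).1 hR
      refine ⟨hR, ?_, by omega⟩
      by_contra hz1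
      have f2 := (h.column_succ hB (j := s) (by omega)).1 hR
      have hI := hB.interval (i := i + 1) (j := s) (by omega)
      have hI0 := hB.interval_zero (i := i + 1) (j := s) (by omega) (by omega) (by omega)
      have hmeet := (h.meet hm hM hB hA (j := s) (by omega)).1 (hA.meet_two hm h0 (by omega))
      have e0 := h.row_succ hB (j := s) (by omega)
      rw [if_pos hmeet] at e0
      have sum := hA.sum (s + 1) (by omega)
      omega
    · exfalso
      have e0 := h.row_succ hB (j := 1) (by omega)
      have q := hB.two_mul_lowDip_le (i := i + 1) (j := 1) (by omega)
      have e2 := (h.column_succ hB (j := 1) (by omega)).2 (by omega)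
      have sum := hA.sum 2 (by omega)
      have one := hA.one hm
      have m0 := hA.mono₀ 1 (by omega)
      rw [if_neg (fun hc => hR hc.1)] at e0
      simp only [Nat.reduceAdd] at *
      omega
  · rintro ⟨hR, hz1, hG⟩
    induction j with
    | zero =>
      rw [rightOfTwiceFrom_zero] at hG
      omega
    | succ j ih =>
      by_cases hG' : 1 ≤ rightOfTwiceFrom R₀ R₁ (i + 1) j
      · exact climb_succ.2 (Or.inl (ih (by omega) hG'))
      · refine climb_succ.2 (Or.inr ?_)
        have sum := hA.sum (j + 1 + 1) (by omega)
        have e0 := h.row_succ hB hj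
        have e2 := (h.column_succ hB hj).1 hR
        have hv := hB.letter (v := i + 1 + j) (by omega)
        have hv' := hB.le (v := i + 1 + j) (by omega)
        have hI := hB.interval (i := i + 1) (j := j) (by omega)
        have d : lowDip R₀ R₁ (i + 1) (j + 1) =
          min (lowDip R₀ R₁ (i + 1) j) (R₀ (i + 1 + j) - R₁ (i + 1 + j + 1)) := rfl
        have r := rightOfTwiceFrom_succ R₀ R₁ (i + 1) j
        have hI1 := hB.interval_one (i := i + 1) (j := j) (by omega) hz1
        rw [show i + 1 + (j + 1) = i + 1 + j + 1 by omega] at *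
        refine ⟨?_, by omega, ?_⟩
        · have hu := hB.letter (v := i + 1) (by omega)
          have hjump := hB.nextTwice_jump (i := i + 1) (u := i + 1) le_rfl (by omega) rfl
          have sum2 := hA.sum 2 (by omega)
          have f0 := h.row_succ hB (j := 1) (by omega)
          have f2 := (h.column_succ hB (j := 1) (by omega)).1 hR
          have r1 := rightOfTwiceFrom_succ R₀ R₁ (i + 1) 0
          have r0 := rightOfTwiceFrom_zero R₀ R₁ (i + 1)
          have l0 := lastTwiceFrom_zero R₀ R₁ (i + 1)
          have d1 : lowDip R₀ R₁ (i + 1) 1 =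
            min (R₀ (i + 1) - R₁ (i + 1)) (R₀ (i + 1) - R₁ (i + 1 + 1)) := rfl
          simp only [Nat.add_zero, zero_add, Nat.reduceAdd, l0, r0, ite_self] at r1 f0 f2
          clear d r hI hI1 e0 e2 sum hv hv' ih hG hG'
          have f4 : R₁ (i + 1 + 1) = R₁ (i + 1) + 1 := by omega
          have f5 : R₀ (i + 1) = R₁ (i + 1) + (R₀ (i + 1) - R₁ (i + 1)) := by omega
          rw [if_pos (by omega)] at f0
          omega
        · split_ifs at r with hc
          · omega
          · rw [if_pos (by omega)] at e0
            omega

theorem FlagState.next {n m k M i : ℕ} {R₀ R₁ A₀ A₁ A₂ : ℕ → ℕ} (hm : 0 < m)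
    (hM : 2 * m + k = M) (hB : Ballot n M R₀ R₁) (hA : FlagBallot m k A₀ A₁ A₂)
    (h : FlagState M R₀ R₁ i A₀ A₂) (hi : i < M) :
    FlagState M R₀ R₁ (i + 1) (nextRow₀ m (2 * m + k) A₀ A₁) (nextFlag₂ m k A₁ A₂) := by
  have hx := hB.letter hi
  have hz := nextTwice_le (M := M) (R₀ := R₀) (R₁ := R₁) (i := i + 1)
  constructor
  · intro j hj
    have hmeet := h.meet hm hM hB hA hj
    have e0 := h.row_succ hB hj
    have one := hA.one hm
    have mono := le_of_steps hA.mono₀ (show 1 ≤ j + 1 by omega) (by omega)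
    rw [nextRow₀, if_pos (by omega)]
    split_ifs at e0 with hc
    · rw [if_pos (hmeet.2 hc)]
      omega
    · rw [if_neg (fun hc' => hc (hmeet.1 hc'))]
      omega
  · intro j hj
    have hclimb := h.climb hm hM hB hA hj
    have e2 := h.column_succ hB hj
    rw [nextFlag₂, if_pos (by omega)]
    split_ifs with hc
    · rw [hclimb] at hc
      omega
    · rw [hclimb] at hc
      omega

theorem Ballot.nextTwice_zero {n M : ℕ} {R₀ R₁ : ℕ → ℕ} (hB : Ballot n M R₀ R₁) (hn : 0 < n) :
    nextTwice M R₀ R₁ 0 = 0 := by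
  have z0 := hB.zero₀
  have z1 := hB.zero₁
  have one := hB.one hn
  have h1 := hB.nextTwice_jump (i := 0) (u := 0) le_rfl (hB.pos hn) rfl
  have h2 := nextTwice_le (M := M) (R₀ := R₀) (R₁ := R₁) (i := 0)
  simp only [zero_add] at *
  omega

theorem Ballot.flagState_zero {n m k M : ℕ} {R₀ R₁ N₀ N₁ N₂ ε : ℕ → ℕ} (hn : 0 < n)
    (hM : 2 * m + k = M) (hB : Ballot n M R₀ R₁) (hR : FlagRel M R₀ R₁ N₀ N₁ N₂ ε)
    (hF : FlagBallot m k N₀ N₁ N₂) : FlagState M R₀ R₁ 0 N₀ N₂ := by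
  have z0 := hB.zero₀
  have z1 := hB.zero₁
  have key : ∀ j ≤ M, rightOfTwiceFrom R₀ R₁ 0 j = N₂ j ∧ lastTwiceFrom R₀ R₁ 0 j = ε j := by
    intro j
    induction j with
    | zero =>
      intro _
      have h1 := hR.zero
      have h2 := hR.start
      rw [rightOfTwiceFrom_zero, lastTwiceFrom_zero]
      omega
    | succ j ih =>
      intro hj
      have ih := ih (by omega)
      have hs := hR.step j hj
      have a0 := hR.eq₀ j (by omega)
      have a1 := hR.eq₁ j (by omega)
      have b0 := hR.eq₀ (j + 1) hj
      have b1 := hR.eq₁ (j + 1) hj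
      have l := hR.le_one (j + 1) hj
      rw [rightOfTwiceFrom_succ, lastTwiceFrom_succ]
      simp only [zero_add] at *
      split_ifs <;> omega
  have hz := hB.nextTwice_zero hn
  constructor
  · intro j hj
    have h1 := hB.low hj
    have sum := hF.sum j (by omega)
    have a1 := hR.eq₁ j (by omega)
    simp only [zero_add] at *
    omega
  · intro j hj
    rw [(key j (by omega)).1, hz]
    rfl

theorem Counts₃.kPromotion_eq {n k : ℕ} {N₀ N₁ N₂ : ℕ → ℕ} {S : Filling} (hk : k < n)
    (hB : FlagBallot (n - k) k N₀ N₁ N₂) (hC : Counts₃ n k S N₀ N₁ N₂) :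
    IncTableau.kPromotion (flagShape n k) S = promotion (flagShape n k) S :=
  kPromotion_eq_promotion (mem_flagShape.2 ⟨by omega, by omega, by omega⟩) (hC.ne_zero hB)
    (hC.eq_one hB) (hB.syt hk hC).2.2.2.1

/-- Every iterate is again standard, so the two kinds of promotion keep agreeing. -/
theorem iterate_promotion_flag {n k M : ℕ} {R₀ R₁ N₀ N₁ N₂ ε : ℕ → ℕ} {S : Filling} (hk : k < n)
    (hM : M + k = 2 * n) (hB : Ballot n M R₀ R₁) (hR : FlagRel M R₀ R₁ N₀ N₁ N₂ ε)
    (hF : FlagBallot (n - k) k N₀ N₁ N₂) (hC : Counts₃ n k S N₀ N₁ N₂) : ∀ i ≤ M, ∃ A₀ A₁ A₂,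
      Counts₃ n k ((kPromotion (flagShape n k))^[i] S) A₀ A₁ A₂ ∧
      FlagBallot (n - k) k A₀ A₁ A₂ ∧ FlagState M R₀ R₁ i A₀ A₂ ∧
      (promotion (flagShape n k))^[i] S = (kPromotion (flagShape n k))^[i] S := by
  intro i
  induction i with
  | zero =>
    exact fun _ => ⟨N₀, N₁, N₂, hC, hF, hB.flagState_zero (by omega) (by omega) hR hF, rfl⟩
  | succ i ih =>
    intro hi
    obtain ⟨A₀, A₁, A₂, h1, h2, h3, h4⟩ := ih (by omega)
    rw [Function.iterate_succ_apply', Function.iterate_succ_apply', h4, ← h1.kPromotion_eq hk h2]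
    exact ⟨_, _, _, h1.kPromotion hk h2, h2.next (by omega),
      h3.next (by omega) (by omega) hB h2 hi, rfl⟩


/-! ### Evacuation as rotation, and the conclusion -/

theorem evacuationVia_of_mem {P : Filling → Filling} {μ : YoungDiagram} {T : Filling}
    {b : ℕ × ℕ} (hb : b ∈ μ) : evacuationVia P μ T b =
      sInf {j | j ≤ maxEntry μ T ∧ P^[maxEntry μ T - j] T b ≤ j} := by
  simp only [evacuationVia, sublevel, Finset.mem_filter, YoungDiagram.mem_cells, hb, true_and]

theorem evacuationVia_of_notMem {P : Filling → Filling} {μ : YoungDiagram} {T : Filling}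
    {b : ℕ × ℕ} (hb : b ∉ μ) : evacuationVia P μ T b = 0 := by
  simp [evacuationVia, sublevel, hb]

theorem evacuationVia_congr {P P' : Filling → Filling} {μ : YoungDiagram} {T : Filling}
    (h : ∀ i ≤ maxEntry μ T, P^[i] T = P'^[i] T) : evacuationVia P μ T = evacuationVia P' μ T := by
  funext b
  by_cases hb : b ∈ μ
  · rw [evacuationVia_of_mem hb, evacuationVia_of_mem hb]
    simp only [h _ (Nat.sub_le _ _)]
  · rw [evacuationVia_of_notMem hb, evacuationVia_of_notMem hb]

/-- On the line of boxes `g`, the `j`th member of the chain is an initial segment of length `A j`.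
Only the value at `j` of the `(M - j)`th iterate enters, so it suffices to know each iterate up to
label `M - i`. -/
theorem counts_evacuationVia {P : Filling → Filling} {μ : YoungDiagram} {T : Filling} {n M : ℕ}
    {R : ℕ → ℕ} {g : ℕ → ℕ × ℕ} (hM : maxEntry μ T = M) (hg : ∀ c < n, g c ∈ μ)
    (h : ∀ j ≤ M, ∃ A : ℕ → ℕ, Counts n (fun c => P^[M - j] T (g c)) A ∧ A j = R j)
    (mono : ∀ v < M, R v ≤ R (v + 1)) (top : ∀ v, M ≤ v → R v = n) :
    Counts n (fun c => evacuationVia P μ T (g c)) R := by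
  intro c hc v
  dsimp only
  have hS : {j | j ≤ maxEntry μ T ∧ P^[maxEntry μ T - j] T (g c) ≤ j} = {j | j ≤ M ∧ c < R j} := by
    rw [hM]
    ext j
    refine and_congr_right fun hj => ?_
    obtain ⟨A, hA, hAR⟩ := h j hj
    rw [← hAR]
    exact hA c hc j
  rw [evacuationVia_of_mem (hg c hc), hS]
  have hmem : M ∈ {j | j ≤ M ∧ c < R j} := ⟨le_rfl, by rw [top M le_rfl]; exact hc⟩
  obtain ⟨h1, h2⟩ := Nat.sInf_mem ⟨M, hmem⟩
  constructor
  · intro hv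
    rcases Nat.lt_or_ge v M with hvM | hvM
    · exact h2.trans_le (le_of_steps mono hv hvM.le)
    · rwa [top v hvM]
  · intro hv
    rcases Nat.lt_or_ge v M with hvM | hvM
    · exact Nat.sInf_le ⟨hvM.le, hv⟩
    · exact h1.trans hvM

/-- Rotating a tableau with two rows by half a turn and reversing the labels. -/
theorem Ballot.rotate {n M : ℕ} {R₀ R₁ : ℕ → ℕ} (hB : Ballot n M R₀ R₁) :
    Ballot n M (fun v => n - R₁ (M - v)) (fun v => n - R₀ (M - v)) := by
  have t0 := hB.top₀ M le_rfl
  have t1 := hB.top₁ M le_rfl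
  have z0 := hB.zero₀
  have z1 := hB.zero₁
  have key : ∀ v < M, ∃ i, M - v = i + 1 ∧ M - (v + 1) = i ∧ R₀ (i + 1) ≤ n ∧ R₁ (i + 1) ≤ n ∧
      (((R₀ (i + 1) = R₀ i + 1 ∧ R₁ (i + 1) = R₁ i) ∨
        (R₀ (i + 1) = R₀ i ∧ R₁ (i + 1) = R₁ i + 1) ∨
        (R₀ (i + 1) = R₀ i + 1 ∧ R₁ (i + 1) = R₁ i + 1)) ∧ R₁ (i + 1) ≤ R₀ i) := by
    intro v hv
    refine ⟨M - (v + 1), by omega, rfl, ?_, ?_, hB.letter (by omega)⟩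
    · rw [← t0]
      exact le_of_steps hB.mono₀ (by omega) le_rfl
    · rw [← t1]
      exact le_of_steps hB.mono₁ (by omega) le_rfl
  constructor
  · simp only [Nat.sub_zero]
    omega
  · simp only [Nat.sub_zero]
    omega
  iterate 6
    · intro v hv
      obtain ⟨i, e1, e2, h⟩ := key v hv
      simp only [e1, e2]
      omega
  · intro v hv
    simp only [Nat.sub_eq_zero_of_le hv]
    omega
  · intro v hv
    simp only [Nat.sub_eq_zero_of_le hv]
    omega

/-- At `i + j = M` the height is `0`, so both minima in `RectState` vanish and only `n - R₁ i` and
`n - R₀ i` remain. -/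
theorem Counts₂.kEvacuation {n M : ℕ} {R₀ R₁ : ℕ → ℕ} {T : Filling} (hn : 0 < n)
    (hB : Ballot n M R₀ R₁) (hC : Counts₂ n T R₀ R₁) :
    Counts₂ n (kEvacuation (rect 2 n) T) (fun v => n - R₁ (M - v)) (fun v => n - R₀ (M - v)) := by
  have hM := (hB.inc hC).1
  have hV := hB.rotate
  have t0 := hB.top₀ M le_rfl
  have t1 := hB.top₁ M le_rfl
  refine ⟨counts_evacuationVia hM (fun c hc => mem_rect.2 ⟨by omega, hc⟩) (fun j hj => ?_)
    hV.mono₀ hV.top₀, counts_evacuationVia hM (fun c hc => mem_rect.2 ⟨by omega, hc⟩)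
    (fun j hj => ?_) hV.mono₁ hV.top₁, fun b hb => evacuationVia_of_notMem hb⟩
  all_goals
    obtain ⟨A₀, A₁, h1, h2, h3⟩ := iterate_kPromotion_rect hn hB hC (M - j) (by omega)
    have e0 := h3.row₀ j (by omega)
    have e1 := h3.row₁ j (by omega)
    have l := hB.low (i := M - j) (j := j) (by omega)
    rw [show M - j + j = M by omega] at e0 e1 l
  · exact ⟨A₀, h1.row₀, by omega⟩
  · exact ⟨A₁, h1.row₁, by omega⟩

/-- At `M` no label appearing twice is pending, so one that appears twice has a right neighbor in
the interval. Hence the subtraction in `FlagState.column` is not truncated at the labels used by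
evacuation. -/
theorem Ballot.nextTwice_le_rightOfTwiceFrom {n M : ℕ} {R₀ R₁ : ℕ → ℕ} (hB : Ballot n M R₀ R₁)
    {i j : ℕ} (h : i + j = M) : nextTwice M R₀ R₁ i ≤ rightOfTwiceFrom R₀ R₁ i j := by
  by_contra hlt
  have hz := nextTwice_le (M := M) (R₀ := R₀) (R₁ := R₁) (i := i)
  have hI := hB.interval h.le
  have h1 : ∃ u, i ≤ u ∧ u < M ∧ R₀ u = R₀ i ∧ R₀ u < R₀ (u + 1) ∧ R₁ u < R₁ (u + 1) := by
    by_contra hne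
    rw [nextTwice, if_neg hne] at hlt
    omega
  obtain ⟨u, a1, a2, a3, a4, -⟩ := h1
  have h2 := le_of_steps hB.mono₀ (show u + 1 ≤ M from a2) le_rfl
  have h3 := hB.interval_one h.le (by omega) (by rw [h]; omega)
  have t0 := hB.top₀ M le_rfl
  have t1 := hB.top₁ M le_rfl
  rw [h] at hI
  omega

/-- The image of flag shape of the rotated tableau, given by the states of the iterated promotion
at the labels that enter the evacuation. -/
theorem Ballot.flagRel_rotate {n m k M : ℕ} {R₀ R₁ : ℕ → ℕ} {A₀ A₁ A₂ : ℕ → ℕ → ℕ} (hn : 0 < n)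
    (hM : 2 * m + k = M) (hB : Ballot n M R₀ R₁) (hA : ∀ i ≤ M, FlagBallot m k (A₀ i) (A₁ i) (A₂ i))
    (hS : ∀ i ≤ M, FlagState M R₀ R₁ i (A₀ i) (A₂ i)) :
    FlagRel M (fun v => n - R₁ (M - v)) (fun v => n - R₀ (M - v)) (fun v => A₀ (M - v) v)
      (fun v => A₁ (M - v) v) (fun v => A₂ (M - v) v) (fun v => nextTwice M R₀ R₁ (M - v)) := by
  have t0 := hB.top₀ M le_rfl
  have t1 := hB.top₁ M le_rfl
  have key : ∀ i v, i + v = M → A₀ i v + n = v + R₀ i ∧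
      A₂ i v + nextTwice M R₀ R₁ i + R₀ i + R₁ i + v = 2 * n ∧ A₀ i v + A₁ i v + A₂ i v = v ∧
      R₀ i ≤ n ∧ R₁ i ≤ n := by
    intro i v h
    have e0 := (hS i (by omega)).row₀ v h.le
    have e2 := (hS i (by omega)).column v h.le
    have sum := (hA i (by omega)).sum v (by omega)
    have hI := hB.interval h.le
    have hz := hB.nextTwice_le_rightOfTwiceFrom h
    have m0 := le_of_steps hB.mono₀ (show i ≤ M by omega) le_rfl
    have m1 := le_of_steps hB.mono₁ (show i ≤ M by omega) le_rfl
    rw [h] at e0 hI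
    omega
  constructor
  · exact nextTwice_top
  · simp only [Nat.sub_self]
    exact hB.nextTwice_zero hn
  · have := key M 0 rfl
    simp only [Nat.sub_zero]
    omega
  · intro v hv
    have := key (M - v) v (by omega)
    omega
  · intro v hv
    have := key (M - v) v (by omega)
    omega
  · exact fun v _ => nextTwice_le
  · intro v hv
    obtain ⟨i, hi, hi'⟩ : ∃ i, M - v = i + 1 ∧ M - (v + 1) = i := ⟨M - (v + 1), by omega, rfl⟩
    simp only [hi, hi']
    have k1 := key (i + 1) v (by omega)
    have k2 := key i (v + 1) (by omega)
    have hx := (hB.letter (v := i) (by omega)).1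
    have z1 := nextTwice_le (M := M) (R₀ := R₀) (R₁ := R₁) (i := i)
    have z2 := nextTwice_le (M := M) (R₀ := R₀) (R₁ := R₁) (i := i + 1)
    have hs := hB.nextTwice_same (i := i) (by omega)
    have hj := hB.nextTwice_jump (i := i) (u := i) le_rfl (by omega) rfl
    generalize nextTwice M R₀ R₁ i = x at *
    generalize nextTwice M R₀ R₁ (i + 1) = y at *
    obtain ⟨p1, p2, p3, p4, p5⟩ := k1
    obtain ⟨q1, q2, q3, -, -⟩ := k2
    -- Passing from `v` to `v + 1` in the rotated tableau reads label `i + 1` of `T` with the rows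
    -- exchanged. The old value `y` of `ε` then decides between second row and column.
    rcases hx with hx | hx | hx
    · have hj : x = 0 := by
        have := hj (by omega)
        omega
      right
      rcases Nat.eq_zero_or_pos y with hy | hy
      · exact Or.inl ⟨by omega, by omega, by omega, hy⟩
      · exact Or.inr ⟨by omega, by omega, by omega, by omega⟩
    · have hs := hs hx.1
      exact Or.inl ⟨by omega, by omega, by omega, hs⟩
    · have hj : x = 1 := (hj (by omega)).2 (by omega)
      right
      rcases Nat.eq_zero_or_pos y with hy | hy
      · exact Or.inl ⟨by omega, by omega, by omega, hy⟩
      · exact Or.inr ⟨by omega, by omega, by omega, by omega⟩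

/-- Both sides have the counts `A₀`, `A₁`, `A₂` of the `(M - v)`th promotion, taken at `v`: the left
side by the definition of evacuation, the right side because these satisfy `FlagRel` with the
rotated pair. -/
theorem evacuation_flagMap {n k : ℕ} (hk : k < n) {T : Filling} (hT : T ∈ Inc (rect 2 n) k) :
    kEvacuation (rect 2 n) T ∈ Inc (rect 2 n) k ∧
      evacuation (flagShape n k) (flagMap n T) = flagMap n (kEvacuation (rect 2 n) T) ∧
      kEvacuation (flagShape n k) (flagMap n T) = flagMap n (kEvacuation (rect 2 n) T) := by
  have hn : 0 < n := by omega
  obtain ⟨R₀, R₁, hC, hB⟩ := exists_ballot hn hT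
  have hM : maxEntry (rect 2 n) T + k = 2 * n := by
    rw [hT.2.2.2, card_rect]
  generalize maxEntry (rect 2 n) T = M at *
  have hM' : 2 * (n - k) + k = M := by omega
  have hV := hC.kEvacuation hn hB
  have hVB := hB.rotate
  have hVT := (hVB.inc hV).2 k hM
  obtain ⟨N₀, N₁, N₂, ε, hR, hF⟩ := exists_flagRel hn hB hM hk
  have hS := hC.flagMap hB hR hM hk hF
  have hiter := iterate_promotion_flag hk hM hB hR hF hS
  have hmax : maxEntry (flagShape n k) (flagMap n T) = M := by
    rw [SYT.maxEntry_eq (hF.syt hk hS), card_flagShape hk, hM']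
  have heq : evacuation (flagShape n k) (flagMap n T) =
      kEvacuation (flagShape n k) (flagMap n T) :=
    evacuationVia_congr fun i hi => by
      obtain ⟨-, -, -, -, -, -, h⟩ := hiter i (hi.trans_eq hmax)
      exact h
  choose! A₀ A₁ A₂ hA hAB hAS _ using hiter
  have hER := hB.flagRel_rotate hn hM' hAB hAS
  have zero : ∀ v, M ≤ v → M - v = 0 := fun v hv => by omega
  have hEB := hER.flagBallot hVB hM hk
    (fun v hv => by rw [zero v hv]; exact (hAB 0 (by omega)).top₀ v (by omega))
    (fun v hv => by rw [zero v hv]; exact (hAB 0 (by omega)).top₁ v (by omega))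
    (fun v hv => by rw [zero v hv]; exact (hAB 0 (by omega)).top₂ v (by omega))
  have hE := hV.flagMap hVB hER hM hk hEB
  have hE' : Counts₃ n k (kEvacuation (flagShape n k) (flagMap n T)) (fun v => A₀ (M - v) v)
      (fun v => A₁ (M - v) v) (fun v => A₂ (M - v) v) := by
    refine ⟨counts_evacuationVia hmax
      (fun c hc => mem_flagShape.2 ⟨by omega, hc, by omega⟩)
      (fun j hj => ⟨_, (hA (M - j) (by omega)).row₀, rfl⟩) ?_ ?_, counts_evacuationVia hmax
      (fun c hc => mem_flagShape.2 ⟨by omega, hc, by omega⟩)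
      (fun j hj => ⟨_, (hA (M - j) (by omega)).row₁, rfl⟩) ?_ ?_, counts_evacuationVia hmax
      (fun c hc => mem_flagShape.2 ⟨by omega, by omega, by omega⟩)
      (fun j hj => ⟨_, (hA (M - j) (by omega)).column, rfl⟩) ?_ ?_,
      fun b hb => evacuationVia_of_notMem hb⟩
    · exact hM' ▸ hEB.mono₀
    · exact hM' ▸ hEB.top₀
    · exact hM' ▸ hEB.mono₁
    · exact hM' ▸ hEB.top₁
    · exact hM' ▸ hEB.mono₂
    · exact hM' ▸ hEB.top₂
  have hfin := hE'.ext hE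
  exact ⟨hVT, heq.trans hfin, hfin⟩

/-- Here `k < n` fails, but both shapes are empty and all fillings involved are zero. -/
theorem evacuation_flagMap_zero {k : ℕ} {T : Filling} (hT : T ∈ Inc (rect 2 0) k) :
    kEvacuation (rect 2 0) T ∈ Inc (rect 2 0) k ∧
      evacuation (flagShape 0 k) (flagMap 0 T) = flagMap 0 (kEvacuation (rect 2 0) T) ∧
      kEvacuation (flagShape 0 k) (flagMap 0 T) = flagMap 0 (kEvacuation (rect 2 0) T) := by
  have h1 : ∀ b, b ∉ rect 2 0 := fun b hb => by
    rw [mem_rect] at hb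
    omega
  have h2 : ∀ b, b ∉ flagShape 0 k := fun b hb => by
    rw [mem_flagShape] at hb
    omega
  have e1 : kEvacuation (rect 2 0) T = T := by
    funext b
    rw [hT.1 b (h1 b)]
    exact evacuationVia_of_notMem (h1 b)
  have e2 : ∀ S, flagMap 0 S = fun _ => 0 := by
    intro S
    funext b
    simp [flagMap, rowList, setB]
  rw [e1, e2]
  refine ⟨hT, ?_, ?_⟩
  all_goals
    funext b
    exact evacuationVia_of_notMem (h2 b)

end IncTableau

theorem mainTheorem6 (n k : ℕ) :
    (k < n → Set.BijOn (flagMap n) (Inc (rect 2 n) k) (SYT (flagShape n k))) ∧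
    ∀ T ∈ Inc (rect 2 n) k,
      kEvacuation (rect 2 n) T ∈ Inc (rect 2 n) k ∧
      evacuation (flagShape n k) (flagMap n T) = flagMap n (kEvacuation (rect 2 n) T) ∧
      kEvacuation (flagShape n k) (flagMap n T) = flagMap n (kEvacuation (rect 2 n) T) := by
  refine ⟨bijOn_flagMap, fun T hT => ?_⟩
  rcases Nat.eq_zero_or_pos n with rfl | hn
  · exact evacuation_flagMap_zero hT
  · exact evacuation_flagMap (Inc.lt hn hT) hT
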